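/- **Setting.** Let $k,m\ge 1$ be integers, let $\mathbf a_0=(a_1,\dots,a_k)\in\mathbb R^k$ with $\|\mathbf a_0\|_2=1$, and let $\theta\in[1/k,1)$. Let $\mathbf x_0\in\mathbb R^m$ have i.i.d. Bernoulli–Gaussian $\mathrm{BG}(\theta)$ entries, i.e. $\mathbf x_0(i)=\omega_i g_i$ with all $\omega_i\sim\mathrm{Ber}(\theta)$, $g_i\sim\mathcal N(0,1)$ jointly independent. Let $\mathbf y\in\mathbb R^m$ be the cyclic convolution of $\mathbf a_0$ and $\mathbf x_0$, that is $y_i=\sum_{s=1}^{k}a_s\,\mathbf x_0(i-s+1)$ with indices modulo $m$, and let $\mathbf Y\in\mathbb R^{k\times m}$ be the matrix whose $i$-th column is $(y_i,y_{i+1},\dots,y_{i+k-1})^T$ (indices modulo $m$). Let $\mathbf A_0\in\mathbb R^{k\times(2k-1)}$ be the convolution matrix whose first row is $(a_k,a_{k-1},\dots,a_1,0,\dots,0)$ and each of whose further rows is the previous one shifted one step to the right. Let $\sigma_{\min}$ and $\kappa$ be the smallest singular value and the condition number of $\mathbf A_0$ (one has $\sigma_{\min}>0$). Put $\mathbf A=(\mathbf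 A_0\mathbf A_0^T)^{-1/2}\mathbf A_0=[\mathbf a_1,\dots,\mathbf a_{2k-1}]$ and $\mu=\max_{i\ne j}|\langle\mathbf a_i,\mathbf a_j\rangle|$. For $\mathbf q\in\mathbb R^k$ set $$\psi(\mathbf q)=-\tfrac1{4m}\big\|\mathbf Y^T(\mathbf Y\mathbf Y^T)^{-1/2}\mathbf q\big\|_4^4,\qquad \varphi(\mathbf q)=-\tfrac14\|\mathbf A^T\mathbf q\|_4^4,$$ let $\mathrm{grad}[f](\mathbf q)=(\mathbf I-\mathbf q\mathbf q^T)\nabla f(\mathbf q)$ be the Riemannian gradient on the unit sphere $\mathbb S^{k-1}$, and for $D>0$ let $\hat{\mathcal R}_{D}=\{\mathbf q\in\mathbb S^{k-1}:\|\mathbf A^T\mathbf q\|_4^6\ge D\mu\kappa^2\}$. **Lemma.** For every $C_\star\ge 10$ there are constants $C>0$ and $0<c\le 3/(2C_\star)\le 3/20$, depending only on $C_\star$, such that the following holds for all $k,m,\mathbf a_0,\theta$ as above. If $$m\ \ge\ C\,\frac{\min\{(2C_\star\mu)^{-1},\,\kappa^2k^2\}}{(1-\theta)^2\sigma_{\min}^2}\,\kappa^8k^4\log^3(\kappa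 k)$$ (where $(2C_\star\mu)^{-1}=+\infty$ if $\mu=0$), then with probability at least $$1-e^{-k}-\theta^2(1-\theta)^2k^{-4}-2e^{-\theta k}-48k^{-7}-48m^{-5}-24k\exp\!\big(-\tfrac1{144}\min\{k,3\sqrt{\theta m}\}\big)$$ the inequality $$\Big\|\mathrm{grad}[\psi](\mathbf q)-\frac{3(1-\theta)}{\theta m^2}\,\mathrm{grad}[\varphi](\mathbf q)\Big\|_2\ \le\ c\,\frac{1-\theta}{\theta m^2}\,\frac{\|\mathbf A^T\mathbf q\|_4^6}{\kappa^2}$$ holds simultaneously for all $\mathbf q\in\hat{\mathcal R}_{2C_\star}$. -/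

import Mathlib

open MeasureTheory ProbabilityTheory

noncomputable section

namespace SparseBlindDeconv

/-- The Bernoulli-Gaussian distribution with rate `θ`: the law of `ω * g` for independent
`ω ∼ Ber(θ)` and `g ∼ N(0, 1)`. -/
def bernoulliGaussian (θ : unitInterval) : Measure ℝ :=
  ((bernoulliMeasure (1 : ℝ) 0 θ).prod (gaussianReal 0 1)).map (fun p => p.1 * p.2)

open scoped MatrixOrder in
/-- The inverse square root of a (symmetric positive definite) real matrix. -/
def invSqrt {k : ℕ} (M : Matrix (Fin k) (Fin k) ℝ) : Matrix (Fin k) (Fin k) ℝ :=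
  (CFC.sqrt M)⁻¹

/-- The entrywise `ℓ⁴` norm of a vector. -/
def norm4 {ι : Type*} [Fintype ι] (v : ι → ℝ) : ℝ :=
  (∑ i, |v i| ^ 4) ^ (1 / 4 : ℝ)

/-- The Riemannian gradient on the unit sphere at `q`: the Euclidean gradient projected onto
the orthogonal complement of `q`, by `I - q qᵀ`. -/
def riemGrad {k : ℕ} (f : EuclideanSpace ℝ (Fin k) → ℝ) (q : EuclideanSpace ℝ (Fin k)) :
    EuclideanSpace ℝ (Fin k) :=
  gradient f q - (inner ℝ q (gradient f q)) • q

section Kernel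

variable {k : ℕ} (a : EuclideanSpace ℝ (Fin k))

/-- The `k × (2k-1)` convolution matrix `A₀` of the kernel `a = (a₁, …, a_k)`: its first row is
`(a_k, …, a₁, 0, …, 0)` and each further row is the previous one moved one step to the right. -/
def convMatrix : Matrix (Fin k) (Fin (2 * k - 1)) ℝ := fun r j =>
  if h : (r : ℕ) ≤ j ∧ (j : ℕ) ≤ r + (k - 1) then a ⟨r + (k - 1) - j, by omega⟩ else 0

/-- The preconditioned convolution matrix `A = (A₀ A₀ᵀ)^{-1/2} A₀`. -/
def precond : Matrix (Fin k) (Fin (2 * k - 1)) ℝ :=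
  invSqrt (convMatrix a * (convMatrix a).transpose) * convMatrix a

/-- The smallest of the `k` singular values of the `k × (2k-1)` matrix `A₀`
(Mathlib lists them from index `0` in decreasing order). -/
def sigmaMin : ℝ := (Matrix.toEuclideanLin (convMatrix a)).singularValues (k - 1)

/-- The largest singular value of `A₀`. -/
def sigmaMax : ℝ := (Matrix.toEuclideanLin (convMatrix a)).singularValues 0

/-- The condition number of `A₀`. -/
def kappa : ℝ := sigmaMax a / sigmaMin a

/-- The column coherence `max_{i ≠ j} |⟨a_i, a_j⟩|` of `A` (zero if `A` has a single column). -/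
def coherence : ℝ :=
  ⨆ p : {p : Fin (2 * k - 1) × Fin (2 * k - 1) // p.1 ≠ p.2},
    |(precond a).col p.1.1 ⬝ᵥ (precond a).col p.1.2|

/-- The vector `ζ = Aᵀ q`. -/
def zeta (q : EuclideanSpace ℝ (Fin k)) : Fin (2 * k - 1) → ℝ :=
  (precond a).transpose.mulVec q.ofLp

/-- The population objective `φ(q) = -¼ ‖Aᵀ q‖₄⁴`. -/
def phi (q : EuclideanSpace ℝ (Fin k)) : ℝ := -(1 / 4) * norm4 (zeta a q) ^ 4

/-- The region `{q ∈ S^{k-1} : ‖Aᵀ q‖₄⁶ ≥ D μ κ²}`. -/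
def regionHat (D : ℝ) : Set (EuclideanSpace ℝ (Fin k)) :=
  {q | ‖q‖ = 1 ∧ D * coherence a * kappa a ^ 2 ≤ norm4 (zeta a q) ^ 6}

/-- `min {(D μ)⁻¹, κ² k²}`, where `(D μ)⁻¹ = +∞` if `μ = 0`. -/
def minFactor (D : ℝ) : ℝ :=
  if coherence a = 0 then kappa a ^ 2 * (k : ℝ) ^ 2
  else min (D * coherence a)⁻¹ (kappa a ^ 2 * (k : ℝ) ^ 2)

/-- The cyclic convolution `y` in `ℝ^m` of the zero-padded kernel `a` and the signal `x`. The
entries of a signal in `ℝ^m` are indexed by the integers modulo `m`, from `0`. -/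
def observation {m : ℕ} (x : ZMod m → ℝ) : ZMod m → ℝ := fun i =>
  ∑ s : Fin k, a s * x (i - ((s : ℕ) : ZMod m))

/-- The `k × m` matrix `Y` whose `i`-th column is the window `(y_i, …, y_{i+k-1})`, with indices
modulo `m`. -/
def windows {m : ℕ} (x : ZMod m → ℝ) : Matrix (Fin k) (ZMod m) ℝ := fun r i =>
  observation a x (i + ((r : ℕ) : ZMod m))

/-- The finite sample objective `ψ(q) = -1/(4m) ‖Yᵀ (Y Yᵀ)^{-1/2} q‖₄⁴`. -/
def psi {m : ℕ} [NeZero m] (x : ZMod m → ℝ) (q : EuclideanSpace ℝ (Fin k)) : ℝ :=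
  -(1 / (4 * (m : ℝ))) *
    norm4 (((windows a x).transpose *
      invSqrt (windows a x * (windows a x).transpose)).mulVec q.ofLp) ^ 4

end Kernel

end SparseBlindDeconv

end

open SparseBlindDeconv

/-! Write `Y = A₀ X`, where the columns of `X` are the windows of length `2k - 1` of the signal. For
a fixed vector `ζ` the inner product with a window has second moment `θ‖ζ‖₂²` and fourth moment
`3θ(1-θ)‖ζ‖₄⁴ + 3θ²‖ζ‖₂⁴` (`integral_windowInner_pow`). Hence `(Y Yᵀ)^{-1/2}` is close to
`(mθ)^{-1/2} (A₀ A₀ᵀ)^{-1/2}`, and on the sphere `ψ` is close to `3(1-θ)/(θm²) φ` plus a constant: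
the `ℓ²` part is constant there and leaves no Riemannian gradient.

All randomness enters through one event, `WindowMomentControl`, whose probability is bounded in
`exists_measure_not_windowMomentControl_le`. The fourth power of a window inner product is a sum of
monomials in the entries. For monomials with a repeated index it suffices to bound every
shift-averaged monomial separately: the shifts are coloured so that equally coloured monomials are
independent, and a Rosenthal type moment bound, Markov's inequality and a union bound apply. The
square-free part is `24 e₄`, the elementary symmetric polynomial. An entrywise bound there costs
`‖ζ‖₁⁴`, which is up to a factor of order `k` too much. Sorted by its largest index, however, `e₄`
summed over the windows is a martingale: each new entry multiplies an `e₃` expression in earlier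
entries. A Freedman inequality bounds it for fixed `ζ`, its quadratic variation being controlled by
monomials of degree six, and a net over `ζ` gives uniformity.

The rest is deterministic. Polarization turns fourth moments into the cubic forms of the gradient; a
perturbation bound for positive square roots (`norm_sub_apply_le`) shows that the empirical
whitening is stable, at the cost of one factor `κ`; `norm_riemGrad_psi_sub_le` combines both, and
`exists_deviationScale_le` checks that the sample size makes the error small enough. The failure
probability is at most `48 k⁻⁷` for `k ≥ 100`; for smaller `k` the claimed probability bound is not
positive. -/

namespace SparseBlindDeconv

/-! ### Moments and sub-Gaussianity of the Bernoulli-Gaussian law. -/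

section BernoulliGaussian

/-- The mixture form reduces every integral to a Gaussian one and the value at `0`. -/
lemma bernoulliGaussian_eq (θ : unitInterval) :
    bernoulliGaussian θ = unitInterval.toNNReal θ • gaussianReal 0 1
      + unitInterval.toNNReal (unitInterval.symm θ) • Measure.dirac (0 : ℝ) := by
  have hm : Measurable (fun p : ℝ × ℝ => p.1 * p.2) := by fun_prop
  rw [bernoulliGaussian, bernoulliMeasure_def, Measure.add_prod, Measure.prod_smul_left,
    Measure.prod_smul_left, Measure.map_add _ _ hm, Measure.map_smul, Measure.map_smul,
    Measure.dirac_prod, Measure.dirac_prod, Measure.map_map hm (by fun_prop),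
    Measure.map_map hm (by fun_prop)]
  congr 2
  · have : ((fun p : ℝ × ℝ => p.1 * p.2) ∘ Prod.mk 1) = id := by ext; simp
    rw [this, Measure.map_id]
  · have : ((fun p : ℝ × ℝ => p.1 * p.2) ∘ Prod.mk 0) = fun _ => (0 : ℝ) := by ext; simp
    rw [this, Measure.map_const]
    simp

instance isProbabilityMeasure_bernoulliGaussian (θ : unitInterval) :
    IsProbabilityMeasure (bernoulliGaussian θ) := by
  unfold bernoulliGaussian
  exact Measure.isProbabilityMeasure_map (by fun_prop)

lemma integrable_bernoulliGaussian {θ : unitInterval} {f : ℝ → ℝ}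
    (hf : Integrable f (gaussianReal 0 1)) : Integrable f (bernoulliGaussian θ) := by
  rw [bernoulliGaussian_eq]
  refine Integrable.add_measure (hf.smul_measure_nnreal) ?_
  exact (integrable_dirac (by simp)).smul_measure_nnreal

lemma integral_bernoulliGaussian {θ : unitInterval} {f : ℝ → ℝ}
    (hf : Integrable f (gaussianReal 0 1)) :
    ∫ x, f x ∂bernoulliGaussian θ = θ * ∫ x, f x ∂gaussianReal 0 1 + (1 - θ) * f 0 := by
  rw [bernoulliGaussian_eq, integral_add_measure (hf.smul_measure_nnreal)
    ((integrable_dirac (by simp)).smul_measure_nnreal), integral_smul_nnreal_measure,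
    integral_smul_nnreal_measure, integral_dirac]
  rfl

lemma integrable_pow_gaussianReal (n : ℕ) :
    Integrable (fun x : ℝ => x ^ n) (gaussianReal 0 1) :=
  integrable_pow_of_mem_interior_integrableExpSet (X := fun x => x) (by simp) n

lemma integrable_abs_pow_gaussianReal (n : ℕ) :
    Integrable (fun x : ℝ => |x| ^ n) (gaussianReal 0 1) := by
  simpa [abs_pow] using (integrable_pow_gaussianReal n).abs

lemma integral_odd_pow_gaussianReal {n : ℕ} (hn : Odd n) :
    ∫ x : ℝ, x ^ n ∂gaussianReal 0 1 = 0 := by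
  have h : ∫ x : ℝ, x ^ n ∂gaussianReal 0 1 = ∫ x : ℝ, (-x) ^ n ∂gaussianReal 0 1 := by
    conv_lhs => rw [show gaussianReal 0 1 = (gaussianReal 0 1).map (fun x => -x) by
      rw [gaussianReal_map_neg]; simp]
    rw [integral_map (by fun_prop) (by fun_prop)]
  simp only [hn.neg_pow, integral_neg] at h
  linarith

lemma integral_sq_gaussianReal : ∫ x : ℝ, x ^ 2 ∂gaussianReal 0 1 = 1 := by
  have h := variance_fun_id_gaussianReal (μ := 0) (v := 1)
  rw [variance_eq_integral (by fun_prop)] at h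
  simpa using h

lemma integral_pow_four_gaussianReal : ∫ x : ℝ, x ^ 4 ∂gaussianReal 0 1 = 3 := by
  have h := iteratedDeriv_mgf_zero (X := fun x : ℝ => x) (μ := gaussianReal 0 1) (by simp) 4
  have h' : ∫ x : ℝ, x ^ 4 ∂gaussianReal 0 1
      = iteratedDeriv 4 (mgf (fun x => x) (gaussianReal 0 1)) 0 := by
    rw [h]; rfl
  rw [h', mgf_fun_id_gaussianReal]
  set e := fun t : ℝ => Real.exp (0 * t + ((1 : NNReal) : ℝ) * t ^ 2 / 2) with hedef
  have hp2 (t : ℝ) : HasDerivAt (fun t : ℝ => t ^ 2) (2 * t) t := by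
    simpa using hasDerivAt_pow 2 t
  have hp3 (t : ℝ) : HasDerivAt (fun t : ℝ => t ^ 3) (3 * t ^ 2) t := by
    simpa using hasDerivAt_pow 3 t
  have he (t : ℝ) : HasDerivAt e (e t * t) t := by
    have h2 : HasDerivAt (fun t : ℝ => 0 * t + ((1 : NNReal) : ℝ) * t ^ 2 / 2) t t := by
      have := (hp2 t).div_const 2
      refine (this.congr_deriv (by norm_num)).congr_of_eventuallyEq (.of_forall fun t => ?_)
      simp
    exact h2.exp
  -- Every derivative of `exp (t² / 2)` is that function times a polynomial; the fourth polynomial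
  -- takes the value `3` at `0`.
  have hmul (p p' : ℝ → ℝ) (h : ∀ t, HasDerivAt p (p' t) t) :
      deriv (fun t => e t * p t) = fun t => e t * (t * p t + p' t) := by
    ext t
    have := ((he t).mul (h t)).deriv
    refine this.trans ?_
    ring
  have d1 : deriv e = fun t => e t * t := by ext t; exact (he t).deriv
  have d2 : deriv (fun t => e t * t) = fun t => e t * (1 + t ^ 2) := by
    rw [hmul _ _ (fun t => hasDerivAt_id' t)]; ext t; ring
  have d3 : deriv (fun t => e t * (1 + t ^ 2)) = fun t => e t * (3 * t + t ^ 3) := by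
    rw [hmul _ _ (fun t => (hp2 t).const_add 1)]; ext t; ring
  have d4 : deriv (fun t => e t * (3 * t + t ^ 3)) = fun t => e t * (3 + 6 * t ^ 2 + t ^ 4) := by
    rw [hmul (fun t => 3 * t + t ^ 3) _ (fun t => ((hasDerivAt_id' t).const_mul 3).add (hp3 t))]; ext t; ring
  rw [iteratedDeriv_succ, iteratedDeriv_succ, iteratedDeriv_succ, iteratedDeriv_one, d1, d2, d3, d4]
  simp [hedef]

variable (θ : unitInterval)

lemma integrable_abs_pow_bernoulliGaussian (n : ℕ) :
    Integrable (fun x : ℝ => |x| ^ n) (bernoulliGaussian θ) :=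
  integrable_bernoulliGaussian (integrable_abs_pow_gaussianReal n)

lemma integral_odd_pow_bernoulliGaussian {n : ℕ} (hn : Odd n) :
    ∫ x : ℝ, x ^ n ∂bernoulliGaussian θ = 0 := by
  rw [integral_bernoulliGaussian (integrable_pow_gaussianReal n),
    integral_odd_pow_gaussianReal hn, zero_pow hn.pos.ne']
  simp

lemma integral_sq_bernoulliGaussian : ∫ x : ℝ, x ^ 2 ∂bernoulliGaussian θ = θ := by
  rw [integral_bernoulliGaussian (integrable_pow_gaussianReal 2), integral_sq_gaussianReal]
  simp

lemma integral_pow_four_bernoulliGaussian : ∫ x : ℝ, x ^ 4 ∂bernoulliGaussian θ = 3 * θ := by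
  rw [integral_bernoulliGaussian (integrable_pow_gaussianReal 4), integral_pow_four_gaussianReal]
  simp; ring

lemma integral_abs_pow_bernoulliGaussian {n : ℕ} (hn : n ≠ 0) :
    ∫ x : ℝ, |x| ^ n ∂bernoulliGaussian θ = θ * ∫ x : ℝ, |x| ^ n ∂gaussianReal 0 1 := by
  rw [integral_bernoulliGaussian (integrable_abs_pow_gaussianReal n)]
  simp [hn]

/-- The Bernoulli-Gaussian law is sub-Gaussian with variance proxy `1`. -/
lemma lintegral_exp_bernoulliGaussian_le (s : ℝ) :
    ∫⁻ x, ENNReal.ofReal (Real.exp (x * s - s ^ 2 / 2)) ∂bernoulliGaussian θ ≤ 1 := by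
  have hi : Integrable (fun x : ℝ => Real.exp (x * s - s ^ 2 / 2)) (gaussianReal 0 1) := by
    simp_rw [Real.exp_sub, mul_comm _ s]
    exact (integrable_exp_mul_gaussianReal s).div_const _
  rw [← ofReal_integral_eq_lintegral_ofReal (integrable_bernoulliGaussian hi)
    (ae_of_all _ fun _ => (Real.exp_pos _).le), integral_bernoulliGaussian hi]
  refine ENNReal.ofReal_le_one.2 ?_
  have h1 : ∫ x : ℝ, Real.exp (x * s - s ^ 2 / 2) ∂gaussianReal 0 1 = 1 := by
    have := congrFun (mgf_fun_id_gaussianReal (μ := 0) (v := 1)) s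
    simp only [mgf, zero_mul, NNReal.coe_one, one_mul, zero_add] at this
    simp_rw [Real.exp_sub, mul_comm _ s]
    rw [integral_div, this, div_self (Real.exp_pos _).ne']
  rw [h1]
  have h2 : Real.exp (0 * s - s ^ 2 / 2) ≤ 1 := by
    rw [Real.exp_le_one_iff]; nlinarith [sq_nonneg s]
  have := θ.2.1
  have := θ.2.2
  nlinarith

end BernoulliGaussian

/-! ### Independence of functions of disjoint sets of coordinates. -/

section Independence

lemma indepFun_of_dependsOn {ι : Type*} [Fintype ι] {μ : Measure ℝ} [IsProbabilityMeasure μ]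
    {f g : (ι → ℝ) → ℝ} (hf : Measurable f) (hg : Measurable g) {S T : Finset ι}
    (hfS : DependsOn f (S : Set ι)) (hgT : DependsOn g (T : Set ι)) (hST : Disjoint S T) :
    IndepFun f g (Measure.pi fun _ : ι => μ) := by
  classical
  have key : ∀ (U : Finset ι) (h : (ι → ℝ) → ℝ), Measurable h → DependsOn h (U : Set ι) →
      ∃ h' : (U → ℝ) → ℝ, Measurable h' ∧ h = h' ∘ fun x i => x i := by
    intro U h hm hd
    -- A function depending only on `U` factors through the restriction to `U`; the filler `0`
    -- outside `U` is arbitrary.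
    refine ⟨fun y => h fun i => if hi : i ∈ U then y ⟨i, hi⟩ else 0, hm.comp ?_, ?_⟩
    · refine measurable_pi_lambda _ fun i => ?_
      by_cases hi : i ∈ U <;> simp only [hi, dite_true, dite_false] <;> fun_prop
    · ext x
      refine hd fun i hi => ?_
      simp [Finset.mem_coe.1 hi]
  obtain ⟨f', hf', rfl⟩ := key S f hf hfS
  obtain ⟨g', hg', rfl⟩ := key T g hg hgT
  have := (iIndepFun_pi (μ := fun _ : ι => μ) (X := fun _ x => x)
    fun _ => aemeasurable_id).indepFun_finset S T hST fun i => measurable_pi_apply i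
  exact this.comp hf' hg'

end Independence

/-! ### A Rosenthal type moment inequality. -/

section SumMoments

variable {Ω κ : Type*} [MeasurableSpace Ω] {μ : Measure Ω} [IsProbabilityMeasure μ]

lemma memLp_natCast_le {f : Ω → ℝ} (hf : ∀ r : ℕ, MemLp f r μ) (r : ℕ) :
    Integrable (fun ω => |f ω| ^ r) μ := by
  simpa using (hf r).integrable_norm_pow'

lemma integrable_pow_of_memLp {f : Ω → ℝ} (hf : ∀ r : ℕ, MemLp f r μ) (r : ℕ) :
    Integrable (fun ω => f ω ^ r) μ := by
  refine (memLp_natCast_le hf r).mono ((hf 1).1.pow r) (ae_of_all _ fun ω => ?_)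
  simp

/-- Comparing `|y / s|` with `1` bounds all lower moments of a partial sum by the top even one. -/
lemma abs_pow_le_of_le {s y : ℝ} (hs : 0 < s) {r p : ℕ} (hr : r ≤ 2 * p) :
    |y| ^ r ≤ s ^ r * (1 + (y / s) ^ (2 * p)) := by
  have h1 : |y| ^ r = s ^ r * |y / s| ^ r := by
    rw [← mul_pow, abs_div, abs_of_pos hs, mul_div_cancel₀ _ hs.ne']
  rw [h1]
  refine mul_le_mul_of_nonneg_left ?_ (by positivity)
  have h2 : (y / s) ^ (2 * p) = |y / s| ^ (2 * p) := by
    rw [pow_mul, pow_mul, sq_abs]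
  rw [h2]
  rcases le_total |y / s| 1 with h | h
  · have := pow_le_one₀ (n := r) (abs_nonneg _) h
    have := pow_nonneg (abs_nonneg (y / s)) (2 * p)
    linarith
  · have := pow_le_pow_right₀ h hr
    linarith

variable (μ) in
/-- A family whose partial sums over subfamilies of `T` are independent of the remaining terms,
that is centered and has finite moments. -/
structure CenteredIndepFamily (W : κ → Ω → ℝ) (T : Finset κ) : Prop where
  memLp : ∀ i ∈ T, ∀ r : ℕ, MemLp (W i) r μ
  mean : ∀ i ∈ T, ∫ ω, W i ω ∂μ = 0
  indep : ∀ T' ⊆ T, ∀ i ∈ T, i ∉ T' → IndepFun (fun ω => ∑ j ∈ T', W j ω) (W i) μ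

omit [IsProbabilityMeasure μ] in
lemma CenteredIndepFamily.subset {W : κ → Ω → ℝ} {T T' : Finset κ}
    (h : CenteredIndepFamily μ W T) (hT : T' ⊆ T) : CenteredIndepFamily μ W T' :=
  ⟨fun i hi => h.memLp i (hT hi), fun i hi => h.mean i (hT hi),
    fun S hS i hi hiS => h.indep S (hS.trans hT) i (hT hi) hiS⟩

omit [IsProbabilityMeasure μ] in
lemma CenteredIndepFamily.memLp_sum {W : κ → Ω → ℝ} {T : Finset κ}
    (h : CenteredIndepFamily μ W T) (r : ℕ) : MemLp (fun ω => ∑ j ∈ T, W j ω) r μ :=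
  memLp_finsetSum T fun i hi => h.memLp i hi r

/-- One step of the moment recursion for sums of independent centered variables. -/
lemma integral_add_pow_le {S X : Ω → ℝ} (hS : ∀ r : ℕ, MemLp S r μ) (hX : ∀ r : ℕ, MemLp X r μ)
    (hind : IndepFun S X μ) (hX0 : ∫ ω, X ω ∂μ = 0) {p : ℕ} {K τ s C : ℝ} (hK : 0 ≤ K * τ)
    (hXK : ∀ r, 2 ≤ r → r ≤ 2 * (p + 1) → ∫ ω, |X ω| ^ r ∂μ ≤ K * τ) (hs : 1 ≤ s)
    (hSC : ∫ ω, S ω ^ (2 * p) ∂μ ≤ C * s ^ (2 * p)) :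
    ∫ ω, (S ω + X ω) ^ (2 * (p + 1)) ∂μ ≤ ∫ ω, S ω ^ (2 * (p + 1)) ∂μ
      + 2 ^ (2 * (p + 1)) * (K * τ * (s ^ (2 * p) * (1 + C))) := by
  have hs0 : 0 < s := by linarith
  have hSi := integrable_pow_of_memLp hS
  have hXi := integrable_pow_of_memLp hX
  set n := 2 * (p + 1) with hn
  have hprod : ∀ a b : ℕ, Integrable (fun ω => S ω ^ a * X ω ^ b) μ ∧
      ∫ ω, S ω ^ a * X ω ^ b ∂μ = (∫ ω, S ω ^ a ∂μ) * ∫ ω, X ω ^ b ∂μ := by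
    intro a b
    have hi : IndepFun (fun ω => S ω ^ a) (fun ω => X ω ^ b) μ :=
      hind.comp (φ := fun x => x ^ a) (ψ := fun x => x ^ b) (by fun_prop) (by fun_prop)
    exact ⟨hi.integrable_mul (hSi a) (hXi b),
      hi.integral_fun_mul_eq_mul_integral (hSi a).1 (hXi b).1⟩
  have hexp : ∫ ω, (S ω + X ω) ^ n ∂μ
      = ∑ a ∈ Finset.range (n + 1),
          ((∫ ω, S ω ^ a ∂μ) * ∫ ω, X ω ^ (n - a) ∂μ) * (n.choose a) := by
    simp_rw [add_pow]
    rw [integral_finsetSum _ fun a _ => (hprod a (n - a)).1.mul_const _]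
    refine Finset.sum_congr rfl fun a _ => ?_
    rw [integral_mul_const, (hprod a (n - a)).2]
  have hC : 0 ≤ 1 + C := by
    have h0 : 0 ≤ ∫ ω, S ω ^ (2 * p) ∂μ := integral_nonneg fun ω => by
      change 0 ≤ S ω ^ (2 * p)
      rw [pow_mul]; positivity
    have : 0 ≤ C * s ^ (2 * p) := h0.trans hSC
    have := nonneg_of_mul_nonneg_left this (by positivity)
    linarith
  have hB : 0 ≤ K * τ * (s ^ (2 * p) * (1 + C)) := by positivity
  have hterm : ∀ a ∈ Finset.range n,
      ((∫ ω, S ω ^ a ∂μ) * ∫ ω, X ω ^ (n - a) ∂μ) * (n.choose a)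
        ≤ K * τ * (s ^ (2 * p) * (1 + C)) * (n.choose a) := by
    intro a ha
    rw [Finset.mem_range] at ha
    refine mul_le_mul_of_nonneg_right ?_ (by positivity)
    -- The term `a = n - 1` vanishes since `X` is centered. In all others `X` has exponent at least
    -- `2` and `S` at most `2p`, so the hypotheses on both apply.
    rcases Nat.lt_or_ge a (n - 1) with h | h
    · have hr2 : 2 ≤ n - a := by omega
      have h1 : |∫ ω, X ω ^ (n - a) ∂μ| ≤ K * τ := by
        refine (abs_integral_le_integral_abs).trans ?_
        simp_rw [abs_pow]
        exact hXK _ hr2 (by omega)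
      have h2 : |∫ ω, S ω ^ a ∂μ| ≤ s ^ (2 * p) * (1 + C) := by
        refine (abs_integral_le_integral_abs).trans ?_
        simp_rw [abs_pow]
        have ha' : a ≤ 2 * p := by omega
        calc ∫ ω, |S ω| ^ a ∂μ ≤ ∫ ω, s ^ a * (1 + (S ω / s) ^ (2 * p)) ∂μ := by
              refine integral_mono (memLp_natCast_le hS a) ?_ fun ω => abs_pow_le_of_le hs0 ha'
              simp_rw [div_pow]
              exact ((integrable_const _).add ((hSi _).div_const _)).const_mul _
          _ = s ^ a * (1 + (∫ ω, S ω ^ (2 * p) ∂μ) / s ^ (2 * p)) := by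
              simp_rw [div_pow]
              rw [integral_const_mul, integral_add (integrable_const _) ((hSi _).div_const _),
                integral_div]
              simp
          _ ≤ s ^ (2 * p) * (1 + C) := by
              have h3 : (∫ ω, S ω ^ (2 * p) ∂μ) / s ^ (2 * p) ≤ C := by
                rw [div_le_iff₀ (by positivity)]; exact hSC
              refine mul_le_mul (pow_le_pow_right₀ hs ha') (by linarith) ?_ (by positivity)
              have : 0 ≤ (∫ ω, S ω ^ (2 * p) ∂μ) / s ^ (2 * p) := by
                refine div_nonneg (integral_nonneg fun ω => ?_) (by positivity)
                change 0 ≤ S ω ^ (2 * p)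
                rw [pow_mul]; positivity
              linarith
      calc (∫ ω, S ω ^ a ∂μ) * ∫ ω, X ω ^ (n - a) ∂μ
          ≤ |∫ ω, S ω ^ a ∂μ| * |∫ ω, X ω ^ (n - a) ∂μ| := by
            rw [← abs_mul]; exact le_abs_self _
        _ ≤ (s ^ (2 * p) * (1 + C)) * (K * τ) :=
            mul_le_mul h2 h1 (abs_nonneg _) (by positivity)
        _ = _ := by ring
    · have : n - a = 1 := by omega
      rw [this]
      simp only [pow_one, hX0, mul_zero]
      exact hB
  rw [hexp, Finset.sum_range_succ]
  simp only [Nat.sub_self, pow_zero, integral_const, Nat.choose_self, Nat.cast_one, mul_one]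
  have hlast : (∫ ω, S ω ^ n ∂μ) * (μ.real Set.univ • (1 : ℝ)) = ∫ ω, S ω ^ n ∂μ := by simp
  rw [hlast, add_comm]
  refine add_le_add le_rfl ((Finset.sum_le_sum hterm).trans ?_)
  rw [← Finset.mul_sum, mul_comm]
  refine mul_le_mul_of_nonneg_right ?_ hB
  have h := Nat.sum_range_choose n
  rw [Finset.sum_range_succ] at h
  have h' : (∑ a ∈ Finset.range n, n.choose a) ≤ 2 ^ n := by omega
  exact_mod_cast h'

/-- Moment bound of Rosenthal type for sums of independent centered variables. -/
theorem exists_moment_sum_le (p : ℕ) (K : ℝ) (hK : 0 ≤ K) : ∃ C : ℝ, 0 ≤ C ∧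
    ∀ {Ω κ : Type} [MeasurableSpace Ω] (μ : Measure Ω) [IsProbabilityMeasure μ]
      (W : κ → Ω → ℝ) (T : Finset κ) (τ s : ℝ), CenteredIndepFamily μ W T → 0 ≤ τ → 1 ≤ s →
      T.card * τ ≤ s ^ 2 →
      (∀ i ∈ T, ∀ r, 2 ≤ r → r ≤ 2 * p → ∫ ω, |W i ω| ^ r ∂μ ≤ K * τ) →
      ∫ ω, (∑ i ∈ T, W i ω) ^ (2 * p) ∂μ ≤ C * s ^ (2 * p) := by
  classical
  induction p with
  | zero => exact ⟨1, zero_le_one, fun {Ω κ} _ μ _ W T τ s _ _ _ _ _ => by simp⟩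
  | succ p ih =>
    obtain ⟨C, hC0, hC⟩ := ih
    set D := 2 ^ (2 * (p + 1)) * (K * (1 + C)) with hD
    refine ⟨D, by positivity, ?_⟩
    intro Ω κ _ μ _ W T τ s hW hτ hs hT hWK
    have hs0 : 0 < s := by linarith
    -- Each added variable raises the moment by at most `D τ s^(2p)`; as `card T * τ ≤ s²`, the
    -- total stays below `D s^(2p+2)`.
    have main : ∀ T' ⊆ T, ∫ ω, (∑ i ∈ T', W i ω) ^ (2 * (p + 1)) ∂μ
        ≤ T'.card * (D * τ * s ^ (2 * p)) := by
      intro T'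
      induction T' using Finset.induction_on with
      | empty => intro _; simp
      | insert i T' hi ihT =>
        intro hsub
        have hT' : T' ⊆ T := (Finset.subset_insert _ _).trans hsub
        have hiT : i ∈ T := hsub (Finset.mem_insert_self _ _)
        have hWT' := hW.subset hT'
        have hcard : (T'.card : ℝ) ≤ T.card := by exact_mod_cast Finset.card_le_card hT'
        have hS := hC μ W T' τ s hWT' hτ hs
          ((mul_le_mul_of_nonneg_right hcard hτ).trans hT)
          fun j hj r h2 hr => hWK j (hT' hj) r h2 (by omega)
        have step := integral_add_pow_le (p := p) (K := K) (τ := τ) (s := s) (C := C)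
          hWT'.memLp_sum (hW.memLp i hiT) (hW.indep T' hT' i hiT hi)
          (hW.mean i hiT) (by positivity) (hWK i hiT) hs hS
        have : ∫ ω, (∑ j ∈ insert i T', W j ω) ^ (2 * (p + 1)) ∂μ
            = ∫ ω, (∑ j ∈ T', W j ω + W i ω) ^ (2 * (p + 1)) ∂μ := by
          simp_rw [Finset.sum_insert hi, add_comm]
        rw [this, Finset.card_insert_of_notMem hi]
        have h3 := ihT hT'
        push_cast
        calc _ ≤ _ := step
          _ ≤ T'.card * (D * τ * s ^ (2 * p))
              + 2 ^ (2 * (p + 1)) * (K * τ * (s ^ (2 * p) * (1 + C))) := by gcongr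
          _ = _ := by rw [hD]; ring
    refine (main T subset_rfl).trans ?_
    calc (T.card : ℝ) * (D * τ * s ^ (2 * p)) = (T.card * τ) * (D * s ^ (2 * p)) := by ring
      _ ≤ s ^ 2 * (D * s ^ (2 * p)) := by gcongr
      _ = D * s ^ (2 * (p + 1)) := by ring

end SumMoments

/-! ### Greedy colouring of conflict graphs. -/

section Colouring

/-- Greedy colouring: a conflict relation with at most `D` conflicts per vertex admits a proper
colouring with `D + 1` colours. -/
lemma exists_colouring {V : Type*} [Fintype V] [DecidableEq V] (R : V → V → Prop)
    [∀ u, DecidablePred (R u)] (hR : ∀ u v, R u v → R v u) (D : ℕ)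
    (hD : ∀ u, (Finset.univ.filter (R u)).card ≤ D) :
    ∃ c : V → Fin (D + 1), ∀ u v, u ≠ v → R u v → c u ≠ c v := by
  suffices h : ∀ T : Finset V, ∃ c : V → Fin (D + 1),
      ∀ u ∈ T, ∀ v ∈ T, u ≠ v → R u v → c u ≠ c v by
    obtain ⟨c, hc⟩ := h Finset.univ
    exact ⟨c, fun u v => hc u (Finset.mem_univ _) v (Finset.mem_univ _)⟩
  intro T
  induction T using Finset.induction_on with
  | empty => exact ⟨fun _ => 0, by simp⟩
  | insert w T hw ih =>
    obtain ⟨c, hc⟩ := ih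
    have hcard : ((Finset.univ.filter (R w)).image c).card < Fintype.card (Fin (D + 1)) := by
      rw [Fintype.card_fin]
      exact Nat.lt_succ_of_le (Finset.card_image_le.trans (hD w))
    obtain ⟨col, hcol⟩ : ∃ col, col ∉ (Finset.univ.filter (R w)).image c := by
      by_contra! hall
      rw [Finset.eq_univ_iff_forall.2 hall, Finset.card_univ] at hcard
      exact lt_irrefl _ hcard
    have hcol' : ∀ v, R w v → c v ≠ col := fun v hv h =>
      hcol (Finset.mem_image.2 ⟨v, by simpa using hv, h⟩)
    refine ⟨Function.update c w col, ?_⟩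
    intro u hu v hv huv hRuv
    rw [Finset.mem_insert] at hu hv
    by_cases h1 : u = w
    · subst h1
      rw [Function.update_self, Function.update_of_ne (Ne.symm huv)]
      exact (hcol' v hRuv).symm
    · by_cases h2 : v = w
      · subst h2
        rw [Function.update_self, Function.update_of_ne h1]
        exact hcol' u (hR _ _ hRuv)
      · rw [Function.update_of_ne h1, Function.update_of_ne h2]
        exact hc u (hu.resolve_left h1) v (hv.resolve_left h2) huv hRuv

end Colouring

/-! ### Monomials in shifted entries of the signal and their moments. -/

section Monomials

variable {m r : ℕ}

/-- The law of a signal with i.i.d. Bernoulli-Gaussian entries. -/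
noncomputable abbrev signalLaw (m : ℕ) [NeZero m] (θ : unitInterval) : Measure (ZMod m → ℝ) :=
  Measure.pi fun _ => bernoulliGaussian θ

/-- The monomial `∏ₐ x(i + Jₐ)`. -/
def shiftMonomial (J : Fin r → ℕ) (i : ZMod m) (x : ZMod m → ℝ) : ℝ :=
  ∏ a, x (i + (J a : ZMod m))

/-- The multiplicity of the coordinate `n` in `shiftMonomial J i`. -/
def multiplicity (J : Fin r → ℕ) (i n : ZMod m) : ℕ :=
  (Finset.univ.filter fun a => i + (J a : ZMod m) = n).card

lemma shiftMonomial_eq_prod [NeZero m] (J : Fin r → ℕ) (i : ZMod m) (x : ZMod m → ℝ) :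
    shiftMonomial J i x = ∏ n, x n ^ multiplicity J i n := by
  classical
  rw [shiftMonomial, ← Finset.prod_fiberwise (s := Finset.univ) (g := fun a => i + (J a : ZMod m))]
  refine Finset.prod_congr rfl fun n _ => ?_
  rw [multiplicity, ← Finset.prod_const]
  refine Finset.prod_congr rfl fun a ha => ?_
  rw [(Finset.mem_filter.1 ha).2]

lemma measurable_shiftMonomial (J : Fin r → ℕ) (i : ZMod m) :
    Measurable (shiftMonomial (m := m) J i) := by
  unfold shiftMonomial; fun_prop

lemma multiplicity_le (J : Fin r → ℕ) (i n : ZMod m) : multiplicity J i n ≤ r := by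
  unfold multiplicity
  exact (Finset.card_filter_le _ _).trans (by simp)

lemma multiplicity_ne_zero_iff (J : Fin r → ℕ) (i n : ZMod m) :
    multiplicity J i n ≠ 0 ↔ n ∈ Finset.univ.image fun a => i + (J a : ZMod m) := by
  unfold multiplicity
  rw [Finset.card_ne_zero, Finset.filter_nonempty_iff]
  simp

lemma natCast_zmod_injOn {N : ℕ} (hN : N ≤ m) {a b : ℕ} (ha : a < N) (hb : b < N)
    (h : (a : ZMod m) = b) : a = b := by
  rw [ZMod.natCast_eq_natCast_iff] at h
  exact Nat.ModEq.eq_of_lt_of_lt h (by omega) (by omega)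

lemma card_image_shift {N : ℕ} (hN : N ≤ m) {J : Fin r → ℕ} (hJ : ∀ a, J a < N) (i : ZMod m) :
    (Finset.univ.image fun a => i + (J a : ZMod m)).card = (Finset.univ.image J).card := by
  have : (Finset.univ.image fun a => i + (J a : ZMod m))
      = (Finset.univ.image J).image fun n : ℕ => i + (n : ZMod m) := by
    rw [Finset.image_image]; rfl
  rw [this, Finset.card_image_of_injOn]
  intro a ha b hb hab
  simp only [Finset.coe_image, Finset.coe_univ, Set.image_univ, Set.mem_range] at ha hb
  obtain ⟨a, rfl⟩ := ha
  obtain ⟨b, rfl⟩ := hb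
  exact natCast_zmod_injOn hN (hJ a) (hJ b) (add_left_cancel hab)

variable [NeZero m] (θ : unitInterval)

lemma integral_shiftMonomial (J : Fin r → ℕ) (i : ZMod m) :
    ∫ x, shiftMonomial J i x ∂signalLaw m θ
      = ∏ n, ∫ y, y ^ multiplicity J i n ∂bernoulliGaussian θ := by
  simp_rw [shiftMonomial_eq_prod]
  exact integral_fintype_prod_eq_prod (fun n y => y ^ multiplicity J i n)

lemma integral_shiftMonomial_eq_zero {J : Fin r → ℕ} {i n : ZMod m}
    (h : Odd (multiplicity J i n)) : ∫ x, shiftMonomial J i x ∂signalLaw m θ = 0 := by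
  rw [integral_shiftMonomial]
  exact Finset.prod_eq_zero (Finset.mem_univ n) (integral_odd_pow_bernoulliGaussian θ h)

lemma integrable_abs_shiftMonomial_pow (J : Fin r → ℕ) (i : ZMod m) (q : ℕ) :
    Integrable (fun x => |shiftMonomial J i x| ^ q) (signalLaw m θ) := by
  simp_rw [shiftMonomial_eq_prod, Finset.abs_prod, abs_pow, ← Finset.prod_pow, ← pow_mul]
  exact Integrable.fintype_prod fun n => integrable_abs_pow_bernoulliGaussian θ _

lemma memLp_shiftMonomial (J : Fin r → ℕ) (i : ZMod m) (q : ℕ) :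
    MemLp (shiftMonomial J i) q (signalLaw m θ) := by
  rcases Nat.eq_zero_or_pos q with rfl | hq
  · simpa using (measurable_shiftMonomial J i).aestronglyMeasurable
  · rw [← integrable_norm_rpow_iff (measurable_shiftMonomial J i).aestronglyMeasurable
      (by simpa using hq.ne') (by simp)]
    simpa using integrable_abs_shiftMonomial_pow θ J i q

/-- A common bound for the first absolute moments of the standard normal law. -/
noncomputable def gaussMomentBound (n : ℕ) : ℝ := 1 + ∑ c ∈ Finset.range (n + 1), ∫ x : ℝ, |x| ^ c ∂gaussianReal 0 1

lemma one_le_gaussMomentBound (n : ℕ) : 1 ≤ gaussMomentBound n := by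
  have : 0 ≤ ∑ c ∈ Finset.range (n + 1), ∫ x : ℝ, |x| ^ c ∂gaussianReal 0 1 :=
    Finset.sum_nonneg fun c _ => integral_nonneg fun x => by positivity
  unfold gaussMomentBound; linarith

lemma integral_abs_pow_gaussianReal_le {c n : ℕ} (h : c ≤ n) :
    ∫ x : ℝ, |x| ^ c ∂gaussianReal 0 1 ≤ gaussMomentBound n := by
  have := Finset.single_le_sum (f := fun c : ℕ => ∫ x : ℝ, |x| ^ c ∂gaussianReal 0 1)
    (fun c _ => integral_nonneg fun x => by positivity) (Finset.mem_range_succ_iff.2 h)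
  unfold gaussMomentBound; linarith

/-- Each distinct coordinate contributes one factor: a positive power of an entry has absolute
moment `θ` times a Gaussian moment. So the exponent of `θ` counts distinct positions, whatever the
multiplicities; `N ≤ m` keeps positions distinct modulo `m`. -/
lemma integral_abs_shiftMonomial_pow_le {N : ℕ} (hN : N ≤ m) {J : Fin r → ℕ} (hJ : ∀ a, J a < N)
    (i : ZMod m) {q Q : ℕ} (hq : q ≠ 0) (hqQ : q ≤ Q) :
    ∫ x, |shiftMonomial J i x| ^ q ∂signalLaw m θ
      ≤ gaussMomentBound (r * Q) ^ r * (θ : ℝ) ^ (Finset.univ.image J).card := by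
  classical
  simp_rw [shiftMonomial_eq_prod, Finset.abs_prod, abs_pow, ← Finset.prod_pow, ← pow_mul]
  rw [integral_fintype_prod_eq_prod (fun n y => |y| ^ (multiplicity J i n * q))]
  set S := Finset.univ.image fun a => i + (J a : ZMod m) with hS
  set G := gaussMomentBound (r * Q) with hG
  have hG1 : 1 ≤ G := one_le_gaussMomentBound _
  have hθ := θ.2.1
  rw [← Finset.prod_subset (Finset.subset_univ S)]
  · calc ∏ n ∈ S, ∫ y, |y| ^ (multiplicity J i n * q) ∂bernoulliGaussian θ
        ≤ ∏ _n ∈ S, (G * θ) := by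
          refine Finset.prod_le_prod (fun n _ => integral_nonneg fun x => by positivity) ?_
          intro n hn
          have hne := (multiplicity_ne_zero_iff J i n).2 hn
          rw [integral_abs_pow_bernoulliGaussian θ (mul_ne_zero hne hq), mul_comm]
          refine mul_le_mul_of_nonneg_right (integral_abs_pow_gaussianReal_le ?_) hθ
          exact Nat.mul_le_mul (multiplicity_le J i n) hqQ
      _ = G ^ (Finset.univ.image J).card * (θ : ℝ) ^ (Finset.univ.image J).card := by
          rw [Finset.prod_const, hS, card_image_shift hN hJ, mul_pow]
      _ ≤ G ^ r * (θ : ℝ) ^ (Finset.univ.image J).card := by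
          refine mul_le_mul_of_nonneg_right (pow_le_pow_right₀ hG1 ?_) (by positivity)
          exact Finset.card_image_le.trans (by simp)
  · intro n _ hn
    have : multiplicity J i n = 0 := by
      by_contra h
      exact hn ((multiplicity_ne_zero_iff J i n).1 h)
    simp [this]

omit [NeZero m] in
lemma dependsOn_shiftMonomial (J : Fin r → ℕ) (i : ZMod m) :
    DependsOn (shiftMonomial J i)
      ((Finset.univ.image fun a => i + (J a : ZMod m) : Finset (ZMod m)) : Set (ZMod m)) := by
  intro x y h
  refine Finset.prod_congr rfl fun a _ => h _ ?_
  simp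

/-- The centered monomial. -/
noncomputable def centeredMonomial (J : Fin r → ℕ) (i : ZMod m) (x : ZMod m → ℝ) : ℝ :=
  shiftMonomial J i x - ∫ y, shiftMonomial J i y ∂signalLaw m θ

lemma measurable_centeredMonomial (J : Fin r → ℕ) (i : ZMod m) :
    Measurable (centeredMonomial θ J i) :=
  (measurable_shiftMonomial J i).sub_const _

lemma memLp_centeredMonomial (J : Fin r → ℕ) (i : ZMod m) (q : ℕ) :
    MemLp (centeredMonomial θ J i) q (signalLaw m θ) :=
  (memLp_shiftMonomial θ J i q).sub (memLp_const _)

lemma integrable_shiftMonomial (J : Fin r → ℕ) (i : ZMod m) :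
    Integrable (shiftMonomial J i) (signalLaw m θ) := by
  simpa [memLp_one_iff_integrable] using memLp_shiftMonomial θ J i 1

lemma centeredIndepFamily_centeredMonomial (J : Fin r → ℕ) (T : Finset (ZMod m))
    (hT : ∀ i ∈ T, ∀ j ∈ T, i ≠ j → Disjoint (Finset.univ.image fun a => i + (J a : ZMod m))
      (Finset.univ.image fun a => j + (J a : ZMod m))) :
    CenteredIndepFamily (signalLaw m θ) (centeredMonomial θ J) T where
  memLp i _ q := memLp_centeredMonomial θ J i q
  mean i _ := by
    unfold centeredMonomial
    rw [integral_sub (integrable_shiftMonomial θ J i) (integrable_const _)]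
    simp
  indep T' hT' i hi hiT' := by
    classical
    refine indepFun_of_dependsOn (S := T'.biUnion fun j => Finset.univ.image fun a =>
        j + (J a : ZMod m)) (T := Finset.univ.image fun a => i + (J a : ZMod m)) ?_
        (measurable_centeredMonomial θ J i) ?_ ?_ ?_
    · exact Finset.measurable_fun_sum _ fun j _ => measurable_centeredMonomial θ J j
    · intro x y h
      refine Finset.sum_congr rfl fun j hj => ?_
      unfold centeredMonomial
      congr 1
      refine dependsOn_shiftMonomial J j fun n hn => h n ?_
      simp only [Finset.coe_biUnion, Set.mem_iUnion]
      exact ⟨j, hj, hn⟩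
    · intro x y h
      unfold centeredMonomial
      rw [dependsOn_shiftMonomial J i h]
    · rw [Finset.disjoint_biUnion_left]
      intro j hj
      exact hT j (hT' hj) i hi (fun h => hiT' (h ▸ hj))

lemma integral_abs_centeredMonomial_pow_le {N : ℕ} (hN : N ≤ m) {J : Fin r → ℕ}
    (hJ : ∀ a, J a < N) (i : ZMod m) {q Q : ℕ} (hq : q ≠ 0) (hqQ : q ≤ Q) :
    ∫ x, |centeredMonomial θ J i x| ^ q ∂signalLaw m θ
      ≤ 2 ^ Q * (2 * (gaussMomentBound (r * Q) ^ r) ^ Q)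
          * (θ : ℝ) ^ (Finset.univ.image J).card := by
  set d := (Finset.univ.image J).card
  set G := gaussMomentBound (r * Q) ^ r with hG
  have hG1 : 1 ≤ G := one_le_pow₀ (one_le_gaussMomentBound _)
  have hθ := θ.2.1
  have hθd : (θ : ℝ) ^ d ≤ 1 := pow_le_one₀ hθ θ.2.2
  have hθd0 : 0 ≤ (θ : ℝ) ^ d := by positivity
  set e := ∫ y, shiftMonomial J i y ∂signalLaw m θ with he
  have hG0 : G ≤ G ^ Q := le_self_pow₀ hG1 (by omega)
  have he1 : |e| ≤ G * (θ : ℝ) ^ d := by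
    refine (abs_integral_le_integral_abs).trans ?_
    have := integral_abs_shiftMonomial_pow_le θ hN hJ i one_ne_zero (show 1 ≤ Q by omega)
    simpa using this
  have he2 : |e| ^ q ≤ G ^ Q * (θ : ℝ) ^ d := by
    calc |e| ^ q ≤ (G * (θ : ℝ) ^ d) ^ q := by gcongr
      _ = G ^ q * ((θ : ℝ) ^ d) ^ q := mul_pow _ _ _
      _ ≤ G ^ Q * (θ : ℝ) ^ d := by
        refine mul_le_mul (pow_le_pow_right₀ hG1 hqQ) ?_ (by positivity) (by positivity)
        exact pow_le_of_le_one hθd0 hθd hq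
  have hpt : ∀ x, |centeredMonomial θ J i x| ^ q
      ≤ 2 ^ Q * (|shiftMonomial J i x| ^ q + |e| ^ q) := by
    intro x
    have h1 : |centeredMonomial θ J i x| ≤ |shiftMonomial J i x| + |e| := abs_sub _ _
    calc |centeredMonomial θ J i x| ^ q ≤ (|shiftMonomial J i x| + |e|) ^ q := by gcongr
      _ ≤ 2 ^ (q - 1) * (|shiftMonomial J i x| ^ q + |e| ^ q) :=
        add_pow_le (abs_nonneg _) (abs_nonneg _) q
      _ ≤ 2 ^ Q * (|shiftMonomial J i x| ^ q + |e| ^ q) := by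
        refine mul_le_mul_of_nonneg_right (pow_le_pow_right₀ one_le_two (by omega)) (by positivity)
  have hi := integrable_abs_shiftMonomial_pow θ J i q
  calc ∫ x, |centeredMonomial θ J i x| ^ q ∂signalLaw m θ
      ≤ ∫ x, 2 ^ Q * (|shiftMonomial J i x| ^ q + |e| ^ q) ∂signalLaw m θ :=
        integral_mono (memLp_natCast_le (memLp_centeredMonomial θ J i) q)
          ((hi.add (integrable_const _)).const_mul _) hpt
    _ = 2 ^ Q * ((∫ x, |shiftMonomial J i x| ^ q ∂signalLaw m θ) + |e| ^ q) := by
        rw [integral_const_mul, integral_add hi (integrable_const _)]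
        simp
    _ ≤ 2 ^ Q * (G ^ Q * (θ : ℝ) ^ d + G ^ Q * (θ : ℝ) ^ d) := by
        gcongr
        exact (integral_abs_shiftMonomial_pow_le θ hN hJ i hq hqQ).trans
          (mul_le_mul_of_nonneg_right hG0 hθd0)
    _ = _ := by ring

end Monomials

/-! ### Tail bounds for shift-averaged monomials. -/

section EntryTail

lemma sum_pow_even_le {ι : Type*} (T : Finset ι) (f : ι → ℝ) (p : ℕ) (hp : p ≠ 0) :
    (∑ i ∈ T, f i) ^ (2 * p) ≤ (T.card : ℝ) ^ (2 * p) * ∑ i ∈ T, f i ^ (2 * p) := by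
  have hnn : ∀ y : ℝ, 0 ≤ y ^ (2 * p) := fun y => by rw [pow_mul]; positivity
  rcases T.eq_empty_or_nonempty with rfl | hT
  · simp [hp]
  · obtain ⟨j, hj, hmax⟩ := T.exists_max_image (fun i => |f i|) hT
    have h1 : |∑ i ∈ T, f i| ≤ T.card * |f j| := by
      refine (Finset.abs_sum_le_sum_abs _ _).trans ?_
      rw [← nsmul_eq_mul]
      exact Finset.sum_le_card_nsmul _ _ _ hmax
    calc (∑ i ∈ T, f i) ^ (2 * p) = |∑ i ∈ T, f i| ^ (2 * p) := by
          rw [pow_mul, pow_mul, sq_abs]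
      _ ≤ (T.card * |f j|) ^ (2 * p) := by gcongr
      _ = (T.card : ℝ) ^ (2 * p) * f j ^ (2 * p) := by
          rw [mul_pow]; congr 1; rw [pow_mul, pow_mul, sq_abs]
      _ ≤ _ := by
          gcongr
          exact Finset.single_le_sum (f := fun i => f i ^ (2 * p)) (fun i _ => hnn _) hj

/-- Two shifts conflict when `i + J a = j + J b` for some `a`, `b`. The pair `(a, b)` and `i`
determine `j`, so there are at most `r²` conflicts and the number of colours does not depend on `m`.
-/
lemma exists_disjoint_colouring {m r : ℕ} [NeZero m] (J : Fin r → ℕ) :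
    ∃ c : ZMod m → Fin (r * r + 1), ∀ i j, i ≠ j → c i = c j →
      Disjoint (Finset.univ.image fun a => i + (J a : ZMod m))
        (Finset.univ.image fun a => j + (J a : ZMod m)) := by
  classical
  obtain ⟨c, hc⟩ := exists_colouring (V := ZMod m)
    (fun i j => ∃ a b, i + (J a : ZMod m) = j + (J b : ZMod m))
    (fun i j ⟨a, b, h⟩ => ⟨b, a, h.symm⟩) (r * r) (fun i => by
      have : (Finset.univ.filter fun j : ZMod m => ∃ a b, i + (J a : ZMod m) = j + (J b : ZMod m))
          ⊆ (Finset.univ : Finset (Fin r × Fin r)).image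
            fun q => i + (J q.1 : ZMod m) - (J q.2 : ZMod m) := by
        intro j hj
        obtain ⟨a, b, h⟩ := (Finset.mem_filter.1 hj).2
        exact Finset.mem_image.2 ⟨(a, b), Finset.mem_univ _, by simp [h]⟩
      refine (Finset.card_le_card this).trans (Finset.card_image_le.trans ?_)
      simp)
  refine ⟨c, fun i j hij hcij => ?_⟩
  rw [Finset.disjoint_left]
  intro n hn hn'
  obtain ⟨a, _, rfl⟩ := Finset.mem_image.1 hn
  obtain ⟨b, _, hb⟩ := Finset.mem_image.1 hn'
  exact hc i j hij ⟨a, b, hb.symm⟩ hcij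

/-- Within one colour class the terms are independent; recombining the `r² + 1` classes costs a
constant depending only on `r` and `p`. -/
theorem exists_moment_sum_centeredMonomial_le (r p : ℕ) (hp : p ≠ 0) : ∃ C : ℝ, 0 ≤ C ∧
    ∀ (m : ℕ) [NeZero m] (θ : unitInterval) (N : ℕ) (J : Fin r → ℕ) (I : Finset (ZMod m)) (s : ℝ),
      N ≤ m → (∀ a, J a < N) → 1 ≤ s → I.card * (θ : ℝ) ^ (Finset.univ.image J).card ≤ s ^ 2 →
      ∫ x, (∑ i ∈ I, centeredMonomial θ J i x) ^ (2 * p) ∂signalLaw m θ ≤ C * s ^ (2 * p) := by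
  classical
  set K := 2 ^ (2 * p) * (2 * (gaussMomentBound (r * (2 * p)) ^ r) ^ (2 * p)) with hK
  have hK0 : 0 ≤ K := by
    have := one_le_gaussMomentBound (r * (2 * p))
    positivity
  obtain ⟨C, hC0, hC⟩ := exists_moment_sum_le p K hK0
  set D := r * r + 1
  refine ⟨(D : ℝ) ^ (2 * p) * (D * C), by positivity, ?_⟩
  intro m _ θ N J I s hN hJ hs hI
  obtain ⟨c, hc⟩ := exists_disjoint_colouring (m := m) J
  have hτ : 0 ≤ (θ : ℝ) ^ (Finset.univ.image J).card := pow_nonneg θ.2.1 _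
  have hclass : ∀ col : Fin D, ∫ x, (∑ i ∈ I.filter (fun i => c i = col),
      centeredMonomial θ J i x) ^ (2 * p) ∂signalLaw m θ ≤ C * s ^ (2 * p) := by
    intro col
    refine hC _ _ _ _ s (centeredIndepFamily_centeredMonomial θ J _ ?_) hτ hs ?_ ?_
    · intro i hi j hj hij
      exact hc i j hij ((Finset.mem_filter.1 hi).2.trans (Finset.mem_filter.1 hj).2.symm)
    · refine le_trans ?_ hI
      refine mul_le_mul_of_nonneg_right ?_ hτ
      exact_mod_cast Finset.card_filter_le _ _
    · intro i _ q h2 hq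
      exact integral_abs_centeredMonomial_pow_le θ hN hJ i (by omega) hq
  have hint : ∀ col : Fin D, Integrable (fun x => (∑ i ∈ I.filter (fun i => c i = col),
      centeredMonomial θ J i x) ^ (2 * p)) (signalLaw m θ) := fun col =>
    integrable_pow_of_memLp (fun q => memLp_finsetSum _ fun i _ => memLp_centeredMonomial θ J i q) _
  have hint' : Integrable (fun x => (∑ i ∈ I, centeredMonomial θ J i x) ^ (2 * p))
      (signalLaw m θ) :=
    integrable_pow_of_memLp (fun q => memLp_finsetSum _ fun i _ => memLp_centeredMonomial θ J i q) _
  calc ∫ x, (∑ i ∈ I, centeredMonomial θ J i x) ^ (2 * p) ∂signalLaw m θ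
      ≤ ∫ x, (D : ℝ) ^ (2 * p) * ∑ col : Fin D, (∑ i ∈ I.filter (fun i => c i = col),
          centeredMonomial θ J i x) ^ (2 * p) ∂signalLaw m θ := by
        refine integral_mono hint' ((integrable_finsetSum _ fun col _ => hint col).const_mul _) ?_
        intro x
        have h := sum_pow_even_le (Finset.univ : Finset (Fin D))
          (fun col => ∑ i ∈ I.filter (fun i => c i = col), centeredMonomial θ J i x) p hp
        rw [Finset.sum_fiberwise] at h
        simpa using h
    _ = (D : ℝ) ^ (2 * p) * ∑ col : Fin D, ∫ x, (∑ i ∈ I.filter (fun i => c i = col),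
          centeredMonomial θ J i x) ^ (2 * p) ∂signalLaw m θ := by
        rw [integral_const_mul, integral_finsetSum _ fun col _ => hint col]
    _ ≤ (D : ℝ) ^ (2 * p) * ∑ _col : Fin D, C * s ^ (2 * p) := by
        gcongr with col
        exact hclass col
    _ = _ := by simp; ring

/-- The slack factor `k^(1/16)`. -/
noncomputable def slack (k : ℕ) : ℝ := (k : ℝ) ^ (1 / 16 : ℝ)

lemma slack_pow (k : ℕ) : slack k ^ 16 = k := by
  rw [slack, ← Real.rpow_natCast, ← Real.rpow_mul (by positivity)]
  norm_num

lemma one_le_slack {k : ℕ} (hk : 1 ≤ k) : 1 ≤ slack k :=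
  Real.one_le_rpow (by exact_mod_cast hk) (by norm_num)

theorem exists_tail_sum_centeredMonomial_le (r : ℕ) : ∃ A : ℝ, 1 ≤ A ∧
    ∀ (m : ℕ) [NeZero m] (θ : unitInterval) (k N : ℕ) (J : Fin r → ℕ) (I : Finset (ZMod m)) (s : ℝ),
      1 ≤ k → N ≤ m → (∀ a, J a < N) → 1 ≤ s →
      I.card * (θ : ℝ) ^ (Finset.univ.image J).card ≤ s ^ 2 →
      (signalLaw m θ).real {x | A * slack k * s < |∑ i ∈ I, centeredMonomial θ J i x|}
        ≤ ((k : ℝ) ^ 20)⁻¹ := by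
  -- Markov's inequality at order `2p = 320` turns the factor `slack k` into `slack k ^ 320 = k ^
  -- 20`.
  obtain ⟨p, hp⟩ : ∃ p : ℕ, p = 160 := ⟨_, rfl⟩
  obtain ⟨C, hC0, hC⟩ := exists_moment_sum_centeredMonomial_le r p (by omega)
  refine ⟨C + 1, by linarith, ?_⟩
  intro m _ θ k N J I s hk hN hJ hs hI
  have hk0 : (0 : ℝ) < k := by exact_mod_cast hk
  have hsl := one_le_slack hk
  have hM := hC m θ N J I s hN hJ hs hI
  set Z := fun x : ZMod m → ℝ => ∑ i ∈ I, centeredMonomial θ J i x with hZ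
  set lam := (C + 1) * slack k * s with hlam
  have hlam0 : 0 < lam := by positivity
  have hint : Integrable (fun x => Z x ^ (2 * p)) (signalLaw m θ) :=
    integrable_pow_of_memLp (fun q => memLp_finsetSum _ fun i _ => memLp_centeredMonomial θ J i q) _
  have hmk := mul_meas_ge_le_integral_of_nonneg (μ := signalLaw m θ)
    (f := fun x => Z x ^ (2 * p)) (ae_of_all _ fun x => by
      change 0 ≤ Z x ^ (2 * p); rw [pow_mul]; positivity) hint (lam ^ (2 * p))
  have hsub : (signalLaw m θ).real {x | lam < |Z x|}
      ≤ (signalLaw m θ).real {x | lam ^ (2 * p) ≤ Z x ^ (2 * p)} := by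
    refine measureReal_mono fun x hx => ?_
    have hx' : lam < |Z x| := hx
    have : lam ^ (2 * p) ≤ |Z x| ^ (2 * p) := by gcongr
    change lam ^ (2 * p) ≤ Z x ^ (2 * p)
    rwa [pow_mul |Z x|, sq_abs, ← pow_mul] at this
  refine hsub.trans ?_
  have hA : C ≤ (C + 1) ^ (2 * p) := by
    have : C + 1 ≤ (C + 1) ^ (2 * p) := le_self_pow₀ (by linarith) (by omega)
    linarith
  have hsl320 : slack k ^ (2 * p) = (k : ℝ) ^ 20 := by
    rw [← slack_pow k, ← pow_mul, hp]
  have hle : lam ^ (2 * p) * (signalLaw m θ).real {x | lam ^ (2 * p) ≤ Z x ^ (2 * p)}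
      ≤ (C + 1) ^ (2 * p) * s ^ (2 * p) := by
    refine hmk.trans (hM.trans ?_)
    gcongr
  generalize (signalLaw m θ).real {x | lam ^ (2 * p) ≤ Z x ^ (2 * p)} = pr at hle ⊢
  rw [hlam, mul_pow, mul_pow, hsl320] at hle
  have hpos1 : 0 < (C + 1) ^ (2 * p) := by positivity
  have hpos2 : 0 < s ^ (2 * p) := by positivity
  generalize (C + 1) ^ (2 * p) = a at hle hpos1
  generalize s ^ (2 * p) = b at hle hpos2
  rw [← one_div, le_div_iff₀ (by positivity)]
  refine le_of_mul_le_mul_left ?_ (mul_pos hpos1 hpos2)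
  calc a * b * (pr * (k : ℝ) ^ 20) = a * (k : ℝ) ^ 20 * b * pr := by ring
    _ ≤ a * b * 1 := by rw [mul_one]; exact hle

end EntryTail

/-! ### Exponential supermartingale and Freedman's inequality. -/

section Supermartingale

/-- Extension of a finite sequence by zero. -/
def extendZero {m : ℕ} (x : Fin m → ℝ) (n : ℕ) : ℝ := if h : n < m then x ⟨n, h⟩ else 0

lemma measurable_extendZero {m : ℕ} : Measurable (extendZero (m := m)) := by
  refine measurable_pi_lambda _ fun n => ?_
  unfold extendZero
  by_cases h : n < m <;> simp only [h, dite_true, dite_false] <;> fun_prop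

/-- The exponential supermartingale inequality for predictable linear combinations of
independent variables that are sub-Gaussian with variance proxy `1`. -/
lemma lintegral_exp_predictable_le_one {μ : Measure ℝ} [IsProbabilityMeasure μ]
    (hμ : ∀ s : ℝ, ∫⁻ x, ENNReal.ofReal (Real.exp (x * s - s ^ 2 / 2)) ∂μ ≤ 1)
    {D : ℕ → (ℕ → ℝ) → ℝ} (hDm : ∀ n, Measurable (D n))
    (hD : ∀ n y y', (∀ j < n, y j = y' j) → D n y = D n y') (m : ℕ) :
    ∫⁻ x : Fin m → ℝ, ENNReal.ofReal (Real.exp (∑ n ∈ Finset.range m,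
      (extendZero x n * D n (extendZero x) - D n (extendZero x) ^ 2 / 2)))
        ∂Measure.pi (fun _ => μ) ≤ 1 := by
  induction m with
  | zero => simp
  | succ m ih =>
    have hmp := (measurePreserving_piFinSuccAbove (fun _ : Fin (m + 1) => μ) (Fin.last m)).symm
    have hmeas : ∀ m : ℕ, Measurable fun x : Fin m → ℝ =>
        ENNReal.ofReal (Real.exp (∑ n ∈ Finset.range m,
          (extendZero x n * D n (extendZero x) - D n (extendZero x) ^ 2 / 2))) := by
      intro m
      refine ENNReal.measurable_ofReal.comp (Real.measurable_exp.comp ?_)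
      refine Finset.measurable_fun_sum _ fun n _ => ?_
      have h1 : Measurable fun x : Fin m → ℝ => extendZero x n :=
        (measurable_pi_apply n).comp measurable_extendZero
      have h2 : Measurable fun x : Fin m → ℝ => D n (extendZero x) :=
        (hDm n).comp measurable_extendZero
      exact (h1.mul h2).sub ((h2.pow_const 2).div_const 2)
    rw [← hmp.lintegral_comp (hmeas (m + 1))]
    refine (le_of_eq (lintegral_prod_symm _
      ((hmeas (m + 1)).comp hmp.measurable).aemeasurable)).trans ?_
    -- With the earlier coordinates fixed, the coefficient of the last one is a constant `s`, so its
    -- inner integral is at most `1` by `hμ`.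
    refine le_trans (lintegral_mono fun x' => ?_) ih
    set e := (MeasurableEquiv.piFinSuccAbove (fun _ : Fin (m + 1) => ℝ) (Fin.last m)).symm
    have hlt : ∀ (t : ℝ) (j : ℕ), j < m → extendZero (e (t, x')) j = extendZero x' j := by
      intro t j hj
      simp only [extendZero, hj, hj.trans (Nat.lt_succ_self m), dite_true, e]
      simp [MeasurableEquiv.piFinSuccAbove_symm_apply, Fin.insertNthEquiv, Fin.snoc, hj]
    have hlast : ∀ t : ℝ, extendZero (e (t, x')) m = t := by
      intro t
      have : (⟨m, Nat.lt_succ_self m⟩ : Fin (m + 1)) = Fin.last m := rfl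
      simp only [extendZero, Nat.lt_succ_self, dite_true, this, e]
      simp [MeasurableEquiv.piFinSuccAbove_symm_apply, Fin.insertNthEquiv]
    have hDlt : ∀ (t : ℝ) (n : ℕ), n ≤ m →
        D n (extendZero (e (t, x'))) = D n (extendZero x') := fun t n hn =>
      hD n _ _ fun j hj => hlt t j (hj.trans_le hn)
    set s := D m (extendZero x')
    set A := ∑ n ∈ Finset.range m,
      (extendZero x' n * D n (extendZero x') - D n (extendZero x') ^ 2 / 2)
    have hpt : ∀ t : ℝ, ENNReal.ofReal (Real.exp (∑ n ∈ Finset.range (m + 1),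
        (extendZero (e (t, x')) n * D n (extendZero (e (t, x')))
          - D n (extendZero (e (t, x'))) ^ 2 / 2)))
        = ENNReal.ofReal (Real.exp A) * ENNReal.ofReal (Real.exp (t * s - s ^ 2 / 2)) := by
      intro t
      rw [← ENNReal.ofReal_mul (Real.exp_pos _).le, ← Real.exp_add, Finset.sum_range_succ,
        hlast, hDlt t m le_rfl]
      congr 3
      refine Finset.sum_congr rfl fun n hn => ?_
      have hn' := Finset.mem_range.1 hn
      rw [hlt t n hn', hDlt t n hn'.le]
    refine (le_of_eq (lintegral_congr hpt)).trans ?_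
    rw [lintegral_const_mul _ (by fun_prop)]
    exact mul_le_of_le_one_right (by simp) (hμ s)

lemma lintegral_exp_predictable_signal_le_one {m : ℕ} [NeZero m] (θ : unitInterval)
    {D : ℕ → (ℕ → ℝ) → ℝ} (hDm : ∀ n, Measurable (D n))
    (hD : ∀ n y y', (∀ j < n, y j = y' j) → D n y = D n y') :
    ∫⁻ x, ENNReal.ofReal (Real.exp (∑ n ∈ Finset.range m,
      (x n * D n (fun j => x j) - D n (fun j => x j) ^ 2 / 2))) ∂signalLaw m θ ≤ 1 := by
  obtain ⟨m, rfl⟩ := Nat.exists_eq_succ_of_ne_zero (NeZero.ne m)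
  have h := lintegral_exp_predictable_le_one (lintegral_exp_bernoulliGaussian_le θ) hDm hD (m + 1)
  refine le_trans (le_of_eq ?_) h
  -- `ZMod (m + 1)` is by definition `Fin (m + 1)`.
  change ∫⁻ x : Fin (m + 1) → ℝ, _ ∂Measure.pi (fun _ => bernoulliGaussian θ) = _
  refine lintegral_congr fun x => ?_
  have hx : ∀ n < m + 1, extendZero x n = x ((n : ℕ) : ZMod (m + 1)) := by
    intro n hn
    simp only [extendZero, hn, dite_true]
    congr 1
    exact Fin.ext (ZMod.val_natCast_of_lt hn).symm
  congr 2
  refine Finset.sum_congr rfl fun n hn => ?_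
  have hn' := Finset.mem_range.1 hn
  rw [hx n hn', hD n (extendZero x) (fun j => x ((j : ℕ) : ZMod (m + 1)))
    fun j hj => hx j (hj.trans hn')]

/-- A Freedman type tail bound for predictable linear combinations of the signal entries. -/
lemma measure_abs_predictable_sum_le {m : ℕ} [NeZero m] (θ : unitInterval)
    {D : ℕ → (ℕ → ℝ) → ℝ} (hDm : ∀ n, Measurable (D n))
    (hD : ∀ n y y', (∀ j < n, y j = y' j) → D n y = D n y') {s v : ℝ} (hs : 0 < s) (hv : 0 < v) :
    (signalLaw m θ).real {x | s < |∑ n ∈ Finset.range m, x n * D n (fun j => x j)| ∧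
        ∑ n ∈ Finset.range m, D n (fun j => x j) ^ 2 ≤ v}
      ≤ 2 * Real.exp (-(s ^ 2 / (2 * v))) := by
  have hm : Measurable fun x : ZMod m → ℝ => fun j : ℕ => x (j : ZMod m) :=
    measurable_pi_lambda _ fun j => measurable_pi_apply _
  have one : ∀ c : ℝ, c ^ 2 = 1 → (signalLaw m θ).real {x |
      s ≤ c * ∑ n ∈ Finset.range m, x n * D n (fun j => x j) ∧
        ∑ n ∈ Finset.range m, D n (fun j => x j) ^ 2 ≤ v} ≤ Real.exp (-(s ^ 2 / (2 * v))) := by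
    intro c hc
    -- The value `s / v` maximises `λ s - λ² v / 2`, with maximum `s² / (2v)`; the sign `c` selects
    -- the tail.
    set lam := c * (s / v) with hlam
    have h := lintegral_exp_predictable_signal_le_one (m := m) θ (D := fun n y => lam * D n y)
      (fun n => (hDm n).const_mul _) (fun n y y' hy => by rw [hD n y y' hy])
    set f := fun x : ZMod m → ℝ => ENNReal.ofReal (Real.exp (∑ n ∈ Finset.range m,
      (x n * (lam * D n (fun j => x j)) - (lam * D n (fun j => x j)) ^ 2 / 2))) with hf
    have hfm : Measurable f := by
      refine ENNReal.measurable_ofReal.comp (Real.measurable_exp.comp ?_)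
      refine Finset.measurable_fun_sum _ fun n _ => ?_
      have h2 : Measurable fun x : ZMod m → ℝ => lam * D n (fun j => x j) :=
        ((hDm n).comp hm).const_mul _
      exact ((measurable_pi_apply _).mul h2).sub ((h2.pow_const 2).div_const 2)
    have hmk := mul_meas_ge_le_lintegral₀ (μ := signalLaw m θ) hfm.aemeasurable
      (ENNReal.ofReal (Real.exp (s ^ 2 / (2 * v))))
    have hsub : {x : ZMod m → ℝ | s ≤ c * ∑ n ∈ Finset.range m, x n * D n (fun j => x j) ∧
        ∑ n ∈ Finset.range m, D n (fun j => x j) ^ 2 ≤ v}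
        ⊆ {x | ENNReal.ofReal (Real.exp (s ^ 2 / (2 * v))) ≤ f x} := by
      intro x hx
      obtain ⟨h1, h2⟩ := hx
      refine ENNReal.ofReal_le_ofReal (Real.exp_le_exp.2 ?_)
      set F := ∑ n ∈ Finset.range m, x n * D n (fun j => x j) with hF
      set V := ∑ n ∈ Finset.range m, D n (fun j => x j) ^ 2 with hV
      have e1 : ∑ n ∈ Finset.range m, (x n * (lam * D n (fun j => x j))
          - (lam * D n (fun j => x j)) ^ 2 / 2) = lam * F - lam ^ 2 * V / 2 := by
        rw [Finset.sum_sub_distrib, hF, hV, Finset.mul_sum, Finset.mul_sum, Finset.sum_div]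
        congr 1 <;> refine Finset.sum_congr rfl fun n _ => by ring
      rw [e1]
      have hlam2 : lam ^ 2 = (s / v) ^ 2 := by rw [hlam, mul_pow, hc, one_mul]
      have h3 : (s / v) * s ≤ lam * F := by
        calc (s / v) * s ≤ (s / v) * (c * F) := by gcongr
          _ = lam * F := by rw [hlam]; ring
      have h4 : lam ^ 2 * V / 2 ≤ (s / v) ^ 2 * v / 2 := by rw [hlam2]; gcongr
      have h5 : (s / v) * s - (s / v) ^ 2 * v / 2 = s ^ 2 / (2 * v) := by field_simp; ring
      linarith
    have hle : ENNReal.ofReal (Real.exp (s ^ 2 / (2 * v))) * signalLaw m θ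
        {x | s ≤ c * ∑ n ∈ Finset.range m, x n * D n (fun j => x j) ∧
        ∑ n ∈ Finset.range m, D n (fun j => x j) ^ 2 ≤ v} ≤ 1 := by
      refine le_trans ?_ (hmk.trans h)
      gcongr
    have := ENNReal.toReal_mono ENNReal.one_ne_top hle
    rw [ENNReal.toReal_mul, ENNReal.toReal_ofReal (Real.exp_pos _).le, ENNReal.toReal_one] at this
    rw [Real.exp_neg, ← one_div, le_div_iff₀ (Real.exp_pos _), mul_comm]
    exact this
  have hsub : {x : ZMod m → ℝ | s < |∑ n ∈ Finset.range m, x n * D n (fun j => x j)| ∧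
        ∑ n ∈ Finset.range m, D n (fun j => x j) ^ 2 ≤ v}
      ⊆ {x | s ≤ 1 * ∑ n ∈ Finset.range m, x n * D n (fun j => x j) ∧
        ∑ n ∈ Finset.range m, D n (fun j => x j) ^ 2 ≤ v} ∪
      {x | s ≤ (-1) * ∑ n ∈ Finset.range m, x n * D n (fun j => x j) ∧
        ∑ n ∈ Finset.range m, D n (fun j => x j) ^ 2 ≤ v} := by
    rintro x ⟨h1, h2⟩
    rcases lt_abs.1 h1 with h | h
    · exact Or.inl ⟨by linarith, h2⟩
    · exact Or.inr ⟨by linarith, h2⟩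
  refine (measureReal_mono hsub).trans ((measureReal_union_le _ _).trans ?_)
  have h1 := one 1 (by norm_num)
  have h2 := one (-1) (by norm_num)
  linarith

end Supermartingale

/-! ### Simultaneous control of all averaged monomials. -/

section EntryControl

variable {m : ℕ} [NeZero m]

/-- All centered shift-averaged monomials of degree `r` with positions below `N` are bounded by
`A k^(1/16) σ(d)`, where `d` is the number of distinct positions. -/
def EntryControl (θ : unitInterval) (A : ℝ) (k N r : ℕ) (I : Finset (ZMod m)) (σ : ℕ → ℝ)
    (x : ZMod m → ℝ) : Prop :=
  ∀ J : Fin r → ℕ, (∀ a, J a < N) →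
    |∑ i ∈ I, centeredMonomial θ J i x| ≤ A * slack k * σ (Finset.univ.image J).card

-- A union bound over the `N ^ r` position tuples, each failing with probability at most `k⁻²⁰`.
omit [NeZero m] in
theorem exists_measure_not_entryControl_le (r : ℕ) : ∃ A₀ : ℝ, 1 ≤ A₀ ∧
    ∀ A, A₀ ≤ A → ∀ (m : ℕ) [NeZero m] (θ : unitInterval) (k N : ℕ) (I : Finset (ZMod m))
      (σ : ℕ → ℝ), 1 ≤ k → N ≤ m → (∀ d ≤ r, 1 ≤ σ d) →
      (∀ d ≤ r, I.card * (θ : ℝ) ^ d ≤ σ d ^ 2) →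
      (signalLaw m θ).real {x | ¬ EntryControl θ A k N r I σ x} ≤ N ^ r * ((k : ℝ) ^ 20)⁻¹ := by
  obtain ⟨A₀, hA₀, h⟩ := exists_tail_sum_centeredMonomial_le r
  refine ⟨A₀, hA₀, ?_⟩
  intro A hA m _ θ k N I σ hk hN hσ1 hσ
  have hd : ∀ J : Fin r → ℕ, (Finset.univ.image J).card ≤ r := fun J =>
    Finset.card_image_le.trans (by simp)
  have hsub : {x : ZMod m → ℝ | ¬ EntryControl θ A k N r I σ x}
      ⊆ ⋃ J ∈ Fintype.piFinset (fun _ : Fin r => Finset.range N),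
        {x | A₀ * slack k * σ (Finset.univ.image J).card
          < |∑ i ∈ I, centeredMonomial θ J i x|} := by
    intro x hx
    simp only [EntryControl, Set.mem_ofPred_eq, not_forall, not_le] at hx
    obtain ⟨J, hJ, hlt⟩ := hx
    simp only [Set.mem_iUnion]
    refine ⟨J, Fintype.mem_piFinset.2 fun a => Finset.mem_range.2 (hJ a), lt_of_le_of_lt ?_ hlt⟩
    have := one_le_slack hk
    have := hσ1 _ (hd J)
    gcongr
  refine (measureReal_mono hsub (measure_ne_top _ _)).trans ((measureReal_biUnion_finset_le _ _).trans ?_)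
  refine (Finset.sum_le_card_nsmul _ _ ((k : ℝ) ^ 20)⁻¹ fun J hJ => ?_).trans ?_
  · exact h m θ k N J I _ hk hN (fun a => Finset.mem_range.1 (Fintype.mem_piFinset.1 hJ a))
      (hσ1 _ (hd J)) (hσ _ (hd J))
  · rw [Fintype.card_piFinset_const, nsmul_eq_mul]
    simp

/-- The scale of the centered monomials with `d` distinct positions in the full average. -/
noncomputable def fullScale (m : ℕ) (θ : unitInterval) (d : ℕ) : ℝ := √(m * (θ : ℝ) ^ min d 4)

/-- The windows that wrap around. -/
def wrapSet (m N : ℕ) : Finset (ZMod m) := (Finset.Ico (m - N + 1) m).image fun n : ℕ => (n : ZMod m)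

lemma card_wrapSet_le (m N : ℕ) : (wrapSet m N).card ≤ N := by
  refine Finset.card_image_le.trans ?_
  rw [Nat.card_Ico]; omega

lemma sum_zmod_eq_sum_range (f : ZMod m → ℝ) : ∑ i, f i = ∑ n ∈ Finset.range m, f n := by
  symm
  refine Finset.sum_bij (fun n _ => (n : ZMod m)) (fun _ _ => Finset.mem_univ _) ?_ ?_
    (fun _ _ => rfl)
  · intro a ha b hb hab
    exact natCast_zmod_injOn le_rfl (Finset.mem_range.1 ha) (Finset.mem_range.1 hb) hab
  · intro b _
    exact ⟨b.val, Finset.mem_range.2 (ZMod.val_lt b), ZMod.natCast_rightInverse b⟩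

/-- The starts `0, …, m - N` give windows whose entries come in increasing order; predictability is
only available for those. -/
lemma sum_zmod_eq_add_wrapSet {N : ℕ} (hN1 : 1 ≤ N) (hN : N ≤ m) (f : ZMod m → ℝ) :
    ∑ i, f i = ∑ n ∈ Finset.range (m - N + 1), f n + ∑ i ∈ wrapSet m N, f i := by
  rw [sum_zmod_eq_sum_range, wrapSet, Finset.sum_image,
    Finset.sum_range_add_sum_Ico _ (by omega)]
  intro a ha b hb hab
  rw [Finset.mem_coe, Finset.mem_Ico] at ha hb
  exact natCast_zmod_injOn le_rfl ha.2 hb.2 hab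

variable {θ : unitInterval} {A : ℝ} {k N : ℕ} {x : ZMod m → ℝ}

lemma exists_enum {r : ℕ} {S : Finset ℕ} (hS : S.card = r) :
    ∃ J : Fin r → ℕ, Function.Injective J ∧ Finset.univ.image J = S :=
  ⟨S.orderEmbOfFin hS, (S.orderEmbOfFin hS).injective, by simp⟩

omit [NeZero m] in
lemma shiftMonomial_eq_prod_image {r : ℕ} {J : Fin r → ℕ} (hJ : Function.Injective J) (i : ZMod m)
    (x : ZMod m → ℝ) :
    shiftMonomial J i x = ∏ j ∈ Finset.univ.image J, x (i + (j : ZMod m)) := by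
  rw [Finset.prod_image fun a _ b _ h => hJ h]; rfl

lemma centeredMonomial_eq_of_odd {r : ℕ} {J : Fin r → ℕ} {i n : ZMod m}
    (h : Odd (multiplicity J i n)) (x : ZMod m → ℝ) :
    centeredMonomial θ J i x = shiftMonomial J i x := by
  rw [centeredMonomial, integral_shiftMonomial_eq_zero θ h, sub_zero]

omit [NeZero m] in
lemma multiplicity_eq_sum {r : ℕ} (J : Fin r → ℕ) (i n : ZMod m) :
    multiplicity J i n = ∑ a, if i + (J a : ZMod m) = n then 1 else 0 := by
  rw [multiplicity, Finset.card_filter]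

omit [NeZero m] in
lemma multiplicity_of_injective (hN : N ≤ m) {r : ℕ} {J : Fin r → ℕ} (hJ : Function.Injective J)
    (hJN : ∀ a, J a < N) (i : ZMod m) {n : ℕ} (hn : n < N) :
    multiplicity J i (i + (n : ZMod m)) = if n ∈ Finset.univ.image J then 1 else 0 := by
  have h : ∀ a, (i + (J a : ZMod m) = i + (n : ZMod m)) ↔ J a = n := fun a =>
    ⟨fun h => natCast_zmod_injOn hN (hJN a) hn (add_left_cancel h), fun h => by rw [h]⟩
  rw [multiplicity_eq_sum]
  simp_rw [h]
  rw [← Finset.sum_image (M := ℕ) (f := fun j : ℕ => if j = n then (1 : ℕ) else 0) fun a _ b _ h => hJ h,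
    Finset.sum_ite_eq']

/-- The averages of square-free quartic monomials. -/
lemma abs_sum_prod_four_le (hN : N ≤ m) {I : Finset (ZMod m)} {σ : ℕ → ℝ}
    (h : EntryControl θ A k N 4 I σ x)
    {S : Finset ℕ} (hS : S ∈ Finset.powersetCard 4 (Finset.range N)) :
    |∑ i ∈ I, ∏ j ∈ S, x (i + (j : ZMod m))| ≤ A * slack k * σ 4 := by
  rw [Finset.mem_powersetCard] at hS
  obtain ⟨J, hJ, hJS⟩ := exists_enum hS.2
  have hJN : ∀ a, J a < N := fun a => Finset.mem_range.1 (hS.1 (hJS ▸ Finset.mem_image_of_mem J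
    (Finset.mem_univ a)))
  have := h J hJN
  rw [hJS, hS.2] at this
  refine (le_of_eq (congrArg _ (Finset.sum_congr rfl fun i _ => ?_))).trans this
  -- Every position occurs exactly once, so the monomial has mean zero and needs no centering.
  rw [centeredMonomial_eq_of_odd (n := i + (J 0 : ZMod m)), shiftMonomial_eq_prod_image hJ, hJS]
  rw [multiplicity_of_injective hN hJ hJN i (hJN 0)]
  simp

/-- The averages of products of two square-free cubic monomials. -/
lemma abs_sum_prod_three_mul_le (hN : N ≤ m) (h : EntryControl θ A k N 6 Finset.univ (fullScale m θ) x)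
    (hA : 0 ≤ A * slack k)
    {S S' : Finset ℕ} (hS : S ∈ Finset.powersetCard 3 (Finset.range N))
    (hS' : S' ∈ Finset.powersetCard 3 (Finset.range N)) :
    |∑ i, (∏ j ∈ S, x (i + (j : ZMod m))) * ∏ j ∈ S', x (i + (j : ZMod m))|
      ≤ A * slack k * √(m * (θ : ℝ) ^ 4) + if S = S' then
        A * slack k * √(m * (θ : ℝ) ^ 3) + m * (gaussMomentBound 6 ^ 6 * (θ : ℝ) ^ 3) else 0 := by
  rw [Finset.mem_powersetCard] at hS hS'
  obtain ⟨J, hJ, hJS⟩ := exists_enum hS.2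
  obtain ⟨J', hJ', hJS'⟩ := exists_enum hS'.2
  have hJN : ∀ a, J a < N := fun a => Finset.mem_range.1 (hS.1 (hJS ▸ Finset.mem_image_of_mem J
    (Finset.mem_univ a)))
  have hJN' : ∀ a, J' a < N := fun a => Finset.mem_range.1 (hS'.1 (hJS' ▸
    Finset.mem_image_of_mem J' (Finset.mem_univ a)))
  set L : Fin 6 → ℕ := Fin.append (m := 3) (n := 3) J J' with hL
  have hLN : ∀ a, L a < N := by
    intro a
    refine Fin.addCases (m := 3) (n := 3) (motive := fun a => L a < N) (fun a => ?_) (fun a => ?_) a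
    · rw [hL, Fin.append_left]; exact hJN a
    · rw [hL, Fin.append_right]; exact hJN' a
  have himg : Finset.univ.image L = S ∪ S' := by
    ext n
    simp only [Finset.mem_image, Finset.mem_univ, true_and, Finset.mem_union, ← hJS, ← hJS']
    constructor
    · rintro ⟨a, rfl⟩
      refine Fin.addCases (m := 3) (n := 3)
        (motive := fun a => (∃ b, J b = L a) ∨ ∃ b, J' b = L a) (fun a => ?_) (fun a => ?_) a
      · exact Or.inl ⟨a, by rw [hL, Fin.append_left]⟩
      · exact Or.inr ⟨a, by rw [hL, Fin.append_right]⟩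
    · rintro (⟨a, rfl⟩ | ⟨a, rfl⟩)
      · exact ⟨Fin.castAdd 3 a, by rw [hL, Fin.append_left]⟩
      · exact ⟨Fin.natAdd 3 a, by rw [hL, Fin.append_right]⟩
  have hmono : ∀ i : ZMod m, shiftMonomial L i x
      = (∏ j ∈ S, x (i + (j : ZMod m))) * ∏ j ∈ S', x (i + (j : ZMod m)) := by
    intro i
    rw [← hJS, ← hJS', ← shiftMonomial_eq_prod_image hJ, ← shiftMonomial_eq_prod_image hJ']
    unfold shiftMonomial
    rw [show (∏ a : Fin 6, x (i + (L a : ZMod m))) = ∏ a : Fin (3 + 3), x (i + (L a : ZMod m))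
      from rfl, Fin.prod_univ_add]
    simp only [hL, Fin.append_left, Fin.append_right]
  have hmult : ∀ i n : ZMod m, multiplicity L i n = multiplicity J i n + multiplicity J' i n := by
    intro i n
    simp only [multiplicity_eq_sum]
    rw [show (∑ a : Fin 6, if i + (L a : ZMod m) = n then 1 else 0)
      = ∑ a : Fin (3 + 3), if i + (L a : ZMod m) = n then 1 else 0 from rfl, Fin.sum_univ_add]
    simp only [hL, Fin.append_left, Fin.append_right]
  have hc := h L hLN
  rw [himg] at hc
  simp_rw [← hmono]
  have hnn : 0 ≤ A * slack k * √(m * (θ : ℝ) ^ 4) := by positivity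
  by_cases hSS : S = S'
  · rw [if_pos hSS]
    have hcard : (S ∪ S').card = 3 := by rw [← hSS, Finset.union_self, hS.2]
    rw [hcard] at hc
    have hE : ∀ i : ZMod m, |∫ y, shiftMonomial L i y ∂signalLaw m θ|
        ≤ gaussMomentBound 6 ^ 6 * (θ : ℝ) ^ 3 := by
      intro i
      refine (abs_integral_le_integral_abs).trans ?_
      have := integral_abs_shiftMonomial_pow_le θ hN hLN i one_ne_zero (le_refl 1)
      rw [himg, hcard] at this
      simpa using this
    have hdecomp : ∑ i, shiftMonomial L i x = ∑ i, centeredMonomial θ L i x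
        + ∑ i : ZMod m, ∫ y, shiftMonomial L i y ∂signalLaw m θ := by
      rw [← Finset.sum_add_distrib]
      exact Finset.sum_congr rfl fun i _ => by rw [centeredMonomial]; ring
    rw [hdecomp]
    have hE' : |∑ i : ZMod m, ∫ y, shiftMonomial L i y ∂signalLaw m θ|
        ≤ m * (gaussMomentBound 6 ^ 6 * (θ : ℝ) ^ 3) := by
      refine (Finset.abs_sum_le_sum_abs _ _).trans ?_
      refine (Finset.sum_le_card_nsmul _ _ _ fun i _ => hE i).trans (le_of_eq ?_)
      rw [nsmul_eq_mul, Finset.card_univ, ZMod.card]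
    have hc' : |∑ i, centeredMonomial θ L i x| ≤ A * slack k * √(m * (θ : ℝ) ^ 3) := hc
    have := abs_add_le (∑ i, centeredMonomial θ L i x)
      (∑ i : ZMod m, ∫ y, shiftMonomial L i y ∂signalLaw m θ)
    linarith
  · rw [if_neg hSS, add_zero]
    -- A position in only one of the two sets has multiplicity one, so the product has mean zero; it
    -- also makes at least four distinct positions. Only the diagonal `S = S'` keeps a mean.
    obtain ⟨n, hnS, hnS'⟩ : ∃ n ∈ S, n ∉ S' := by
      by_contra! hall
      exact hSS (Finset.eq_of_subset_of_card_le hall (by rw [hS.2, hS'.2]))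
    have hnN : n < N := Finset.mem_range.1 (hS.1 hnS)
    have hcard : 4 ≤ (S ∪ S').card := by
      have h1 : insert n S' ⊆ S ∪ S' := Finset.insert_subset
        (Finset.mem_union_left _ hnS) Finset.subset_union_right
      have := Finset.card_le_card h1
      rwa [Finset.card_insert_of_notMem hnS', hS'.2] at this
    have hodd : ∀ i : ZMod m, Odd (multiplicity L i (i + (n : ZMod m))) := by
      intro i
      rw [hmult, multiplicity_of_injective hN hJ hJN i hnN,
        multiplicity_of_injective hN hJ' hJN' i hnN, hJS, hJS', if_pos hnS, if_neg hnS']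
      simp
    have hcong : ∑ i, shiftMonomial L i x = ∑ i, centeredMonomial θ L i x :=
      Finset.sum_congr rfl fun i _ => (centeredMonomial_eq_of_odd (hodd i) x).symm
    rw [hcong]
    simpa [fullScale, min_eq_right hcard] using hc

end EntryControl

/-! ### Elementary symmetric polynomials and the square-free part of a fourth power. -/

section ElementarySymmetric

/-- The elementary symmetric polynomial of degree `r` in `w 0, …, w (n - 1)`. -/
def elemSym (r : ℕ) (w : ℕ → ℝ) (n : ℕ) : ℝ :=
  ∑ S ∈ Finset.powersetCard r (Finset.range n), ∏ j ∈ S, w j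

lemma elemSym_zero (w : ℕ → ℝ) (n : ℕ) : elemSym 0 w n = 1 := by simp [elemSym]

lemma elemSym_succ_zero (r : ℕ) (w : ℕ → ℝ) : elemSym (r + 1) w 0 = 0 := by
  rw [elemSym, Finset.range_zero, Finset.powersetCard_eq_empty.2 (by simp), Finset.sum_empty]

lemma elemSym_succ_succ (r : ℕ) (w : ℕ → ℝ) (n : ℕ) :
    elemSym (r + 1) w (n + 1) = elemSym (r + 1) w n + w n * elemSym r w n := by
  have hn : n ∉ Finset.range n := by simp
  have hnS : ∀ S ∈ Finset.powersetCard r (Finset.range n), n ∉ S := fun S hS h =>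
    hn ((Finset.mem_powersetCard.1 hS).1 h)
  rw [elemSym, Finset.range_add_one, Finset.powersetCard_succ_insert hn, Finset.sum_union]
  · congr 1
    rw [elemSym, Finset.mul_sum, Finset.sum_image]
    · exact Finset.sum_congr rfl fun S hS => Finset.prod_insert (hnS S hS)
    · intro S hS S' hS' h
      rw [← Finset.erase_insert (hnS S hS), ← Finset.erase_insert (hnS S' hS'), h]
  · rw [Finset.disjoint_left]
    intro S hS hS'
    obtain ⟨S', _, rfl⟩ := Finset.mem_image.1 hS'
    exact hn ((Finset.mem_powersetCard.1 hS).1 (Finset.mem_insert_self _ _))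

/-- Sets are sorted by their largest element `q`. This is what makes the averaged `e₄` a martingale
transform. -/
lemma elemSym_succ_eq_sum (r : ℕ) (w : ℕ → ℝ) (n : ℕ) :
    elemSym (r + 1) w n = ∑ q ∈ Finset.range n, w q * elemSym r w q := by
  induction n with
  | zero => simp [elemSym_succ_zero]
  | succ n ih => rw [elemSym_succ_succ, Finset.sum_range_succ, ih]

lemma elemSym_congr {r : ℕ} {w w' : ℕ → ℝ} {n : ℕ} (h : ∀ j < n, w j = w' j) :
    elemSym r w n = elemSym r w' n := by
  refine Finset.sum_congr rfl fun S hS => Finset.prod_congr rfl fun j hj => h j ?_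
  exact Finset.mem_range.1 ((Finset.mem_powersetCard.1 hS).1 hj)

lemma elemSym_nonneg {r : ℕ} {w : ℕ → ℝ} {n : ℕ} (h : ∀ j, 0 ≤ w j) : 0 ≤ elemSym r w n :=
  Finset.sum_nonneg fun _ _ => Finset.prod_nonneg fun j _ => h j

lemma elemSym_le_sum_pow {w : ℕ → ℝ} (h : ∀ j, 0 ≤ w j) (r n : ℕ) :
    elemSym r w n ≤ (∑ j ∈ Finset.range n, w j) ^ r := by
  induction r generalizing n with
  | zero => simp [elemSym_zero]
  | succ r ih =>
    rw [elemSym_succ_eq_sum, pow_succ', Finset.sum_mul]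
    refine Finset.sum_le_sum fun q hq => mul_le_mul_of_nonneg_left ((ih q).trans ?_) (h q)
    refine pow_le_pow_left₀ (Finset.sum_nonneg fun j _ => h j) ?_ r
    exact Finset.sum_le_sum_of_subset_of_nonneg (Finset.range_subset_range.2
      (Finset.mem_range.1 hq).le) fun j _ _ => h j

lemma elemSym_mul (r : ℕ) (w ζ : ℕ → ℝ) (n : ℕ) :
    elemSym r (fun j => w j * ζ j) n
      = ∑ S ∈ Finset.powersetCard r (Finset.range n), (∏ j ∈ S, ζ j) * ∏ j ∈ S, w j := by
  refine Finset.sum_congr rfl fun S _ => ?_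
  rw [Finset.prod_mul_distrib, mul_comm]

/-- The coefficients of the non-square-free part of a fourth power. -/
def lowerCoeff (j l p q : ℕ) : ℝ :=
  (if p = q then 6 else 0) - (if p = q then if j = l then 3 else 0 else 0)
    - (if p = q then if l = p then 8 else 0 else 0)
    + (if p = q then if l = p then if j = l then 6 else 0 else 0 else 0)

lemma abs_lowerCoeff_le (j l p q : ℕ) : |lowerCoeff j l p q| ≤ if p = q then 23 else 0 := by
  unfold lowerCoeff
  split_ifs <;> norm_num

/-- The right side is `p₁⁴ - 24 e₄` in terms of power sums, by Newton's identities. Each of its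
terms has a repeated index, which can be placed in the last two slots; hence `lowerCoeff` is
supported on `p = q`. -/
lemma sum_lowerCoeff (w : ℕ → ℝ) (R : Finset ℕ) :
    ∑ j ∈ R, ∑ l ∈ R, ∑ p ∈ R, ∑ q ∈ R, lowerCoeff j l p q * (w j * w l * w p * w q)
      = 6 * (∑ j ∈ R, w j) ^ 2 * (∑ j ∈ R, w j ^ 2) - 3 * (∑ j ∈ R, w j ^ 2) ^ 2
        - 8 * (∑ j ∈ R, w j) * (∑ j ∈ R, w j ^ 3) + 6 * ∑ j ∈ R, w j ^ 4 := by
  have h : ∀ j ∈ R, ∀ l ∈ R, ∑ p ∈ R, ∑ q ∈ R, lowerCoeff j l p q * (w j * w l * w p * w q)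
      = 6 * (w j * w l) * (∑ p ∈ R, w p ^ 2)
        - (if j = l then 3 * (w j * w l) * ∑ p ∈ R, w p ^ 2 else 0)
        - 8 * (w j * w l ^ 3) + (if j = l then 6 * (w j * w l ^ 3) else 0) := by
    intro j hj l hl
    have h1 : ∀ p ∈ R, ∑ q ∈ R, lowerCoeff j l p q * (w j * w l * w p * w q)
        = 6 * (w j * w l) * w p ^ 2 - (if j = l then 3 * (w j * w l) * w p ^ 2 else 0)
          - (if l = p then 8 * (w j * w l * w p ^ 2) else 0)
          + (if l = p then if j = l then 6 * (w j * w l * w p ^ 2) else 0 else 0) := by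
      intro p hp
      rw [Finset.sum_eq_single p]
      · unfold lowerCoeff
        split_ifs <;> simp_all <;> ring
      · intro q _ hqp
        simp [lowerCoeff, Ne.symm hqp]
      · exact fun h => absurd hp h
    rw [Finset.sum_congr rfl h1, Finset.sum_add_distrib, Finset.sum_sub_distrib,
      Finset.sum_sub_distrib, ← Finset.mul_sum, Finset.sum_ite_eq, Finset.sum_ite_eq, if_pos hl,
      if_pos hl]
    by_cases hjl : j = l
    · simp only [hjl, if_true, ← Finset.mul_sum]; ring
    · simp only [hjl, if_false, Finset.sum_const_zero]; ring
  rw [Finset.sum_congr rfl fun j hj => Finset.sum_congr rfl fun l hl => h j hj l hl]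
  have h2 : ∀ j ∈ R, ∑ l ∈ R, (6 * (w j * w l) * (∑ p ∈ R, w p ^ 2)
        - (if j = l then 3 * (w j * w l) * ∑ p ∈ R, w p ^ 2 else 0)
        - 8 * (w j * w l ^ 3) + (if j = l then 6 * (w j * w l ^ 3) else 0))
      = w j * (6 * (∑ l ∈ R, w l) * ∑ p ∈ R, w p ^ 2) - w j ^ 2 * (3 * ∑ p ∈ R, w p ^ 2)
        - w j * (8 * ∑ l ∈ R, w l ^ 3) + w j ^ 4 * 6 := by
    intro j hj
    rw [Finset.sum_add_distrib, Finset.sum_sub_distrib, Finset.sum_sub_distrib, Finset.sum_ite_eq,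
      Finset.sum_ite_eq, if_pos hj, if_pos hj, ← Finset.sum_mul, ← Finset.mul_sum, ← Finset.mul_sum,
      ← Finset.mul_sum, ← Finset.mul_sum]
    ring
  rw [Finset.sum_congr rfl h2, Finset.sum_add_distrib, Finset.sum_sub_distrib,
    Finset.sum_sub_distrib, ← Finset.sum_mul, ← Finset.sum_mul, ← Finset.sum_mul, ← Finset.sum_mul]
  ring

lemma sum_pow_four_eq (w : ℕ → ℝ) (n : ℕ) :
    (∑ j ∈ Finset.range n, w j) ^ 4 = 24 * elemSym 4 w n
      + ∑ j ∈ Finset.range n, ∑ l ∈ Finset.range n, ∑ p ∈ Finset.range n, ∑ q ∈ Finset.range n,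
          lowerCoeff j l p q * (w j * w l * w p * w q) := by
  rw [sum_lowerCoeff]
  have e1 : ∀ n, elemSym 1 w n = ∑ j ∈ Finset.range n, w j := fun n => by
    rw [elemSym_succ_eq_sum]; simp [elemSym_zero]
  have e2 : ∀ n, 2 * elemSym 2 w n
      = (∑ j ∈ Finset.range n, w j) ^ 2 - ∑ j ∈ Finset.range n, w j ^ 2 := by
    intro n
    induction n with
    | zero => simp [elemSym_succ_zero]
    | succ n ih =>
      rw [elemSym_succ_succ, e1, Finset.sum_range_succ, Finset.sum_range_succ, mul_add, ih]; ring
  have e3 : ∀ n, 6 * elemSym 3 w n = (∑ j ∈ Finset.range n, w j) ^ 3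
      - 3 * (∑ j ∈ Finset.range n, w j) * (∑ j ∈ Finset.range n, w j ^ 2)
      + 2 * ∑ j ∈ Finset.range n, w j ^ 3 := by
    intro n
    induction n with
    | zero => simp [elemSym_succ_zero]
    | succ n ih =>
      have := e2 n
      rw [elemSym_succ_succ, Finset.sum_range_succ, Finset.sum_range_succ, Finset.sum_range_succ,
        mul_add, ih]
      linear_combination 3 * w n * this
  induction n with
  | zero => simp [elemSym_succ_zero]
  | succ n ih =>
    have := e3 n
    rw [elemSym_succ_succ, Finset.sum_range_succ, Finset.sum_range_succ, Finset.sum_range_succ,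
      Finset.sum_range_succ]
    linear_combination ih - 4 * w n * this

end ElementarySymmetric

/-! ### Exact second and fourth moments of a window. -/

section WindowMoments

variable {Ω : Type*} [MeasurableSpace Ω] {μ : Measure Ω} [IsProbabilityMeasure μ]

lemma integral_add_sq_of_indep {S X : Ω → ℝ} (hS : ∀ r : ℕ, MemLp S r μ) (hX : ∀ r : ℕ, MemLp X r μ)
    (hind : IndepFun S X μ) (hX1 : ∫ ω, X ω ∂μ = 0) :
    ∫ ω, (S ω + X ω) ^ 2 ∂μ = ∫ ω, S ω ^ 2 ∂μ + ∫ ω, X ω ^ 2 ∂μ := by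
  have hSi := integrable_pow_of_memLp hS
  have hXi := integrable_pow_of_memLp hX
  have hi1 : Integrable (fun ω => S ω * X ω) μ :=
    hind.integrable_mul (by simpa using hSi 1) (by simpa using hXi 1)
  have h1 : ∫ ω, S ω * X ω ∂μ = 0 := by
    rw [hind.integral_fun_mul_eq_mul_integral (hS 1).1 (hX 1).1, hX1, mul_zero]
  have : ∀ ω, (S ω + X ω) ^ 2 = S ω ^ 2 + 2 * (S ω * X ω) + X ω ^ 2 := fun ω => by ring
  simp_rw [this]
  have j1 : Integrable (fun ω => S ω ^ 2 + 2 * (S ω * X ω)) μ := (hSi 2).add (hi1.const_mul 2)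
  rw [integral_add j1 (hXi 2), integral_add (hSi 2) (hi1.const_mul 2), integral_const_mul, h1]
  ring

lemma integral_add_pow_four_of_indep {S X : Ω → ℝ} (hS : ∀ r : ℕ, MemLp S r μ)
    (hX : ∀ r : ℕ, MemLp X r μ) (hind : IndepFun S X μ) (hX1 : ∫ ω, X ω ∂μ = 0)
    (hX3 : ∫ ω, X ω ^ 3 ∂μ = 0) :
    ∫ ω, (S ω + X ω) ^ 4 ∂μ
      = ∫ ω, S ω ^ 4 ∂μ + 6 * ((∫ ω, S ω ^ 2 ∂μ) * ∫ ω, X ω ^ 2 ∂μ) + ∫ ω, X ω ^ 4 ∂μ := by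
  have hSi := integrable_pow_of_memLp hS
  have hXi := integrable_pow_of_memLp hX
  have hprod : ∀ a b : ℕ, Integrable (fun ω => S ω ^ a * X ω ^ b) μ ∧
      ∫ ω, S ω ^ a * X ω ^ b ∂μ = (∫ ω, S ω ^ a ∂μ) * ∫ ω, X ω ^ b ∂μ := by
    intro a b
    have hi : IndepFun (fun ω => S ω ^ a) (fun ω => X ω ^ b) μ :=
      hind.comp (φ := fun x => x ^ a) (ψ := fun x => x ^ b) (by fun_prop) (by fun_prop)
    exact ⟨hi.integrable_mul (hSi a) (hXi b),
      hi.integral_fun_mul_eq_mul_integral (hSi a).1 (hXi b).1⟩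
  have hX1' : ∫ ω, X ω ^ 1 ∂μ = 0 := by simpa using hX1
  have : ∀ ω, (S ω + X ω) ^ 4 = S ω ^ 4 + 4 * (S ω ^ 3 * X ω ^ 1) + 6 * (S ω ^ 2 * X ω ^ 2)
      + 4 * (S ω ^ 1 * X ω ^ 3) + X ω ^ 4 := fun ω => by ring
  simp_rw [this]
  have i1 := (hprod 3 1).1.const_mul 4
  have i2 := (hprod 2 2).1.const_mul 6
  have i3 := (hprod 1 3).1.const_mul 4
  have j1 : Integrable (fun ω => S ω ^ 4 + 4 * (S ω ^ 3 * X ω ^ 1)) μ := (hSi 4).add i1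
  have j2 : Integrable (fun ω => S ω ^ 4 + 4 * (S ω ^ 3 * X ω ^ 1) + 6 * (S ω ^ 2 * X ω ^ 2)) μ :=
    j1.add i2
  have j3 : Integrable (fun ω => S ω ^ 4 + 4 * (S ω ^ 3 * X ω ^ 1) + 6 * (S ω ^ 2 * X ω ^ 2)
      + 4 * (S ω ^ 1 * X ω ^ 3)) μ := j2.add i3
  rw [integral_add j3 (hXi 4), integral_add j2 i3, integral_add j1 i2,
    integral_add (hSi 4) i1, integral_const_mul, integral_const_mul, integral_const_mul,
    (hprod 3 1).2, (hprod 2 2).2, (hprod 1 3).2, hX1', hX3]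
  ring

variable {m : ℕ}

/-- The inner product of `ζ` with the window of length `N` of the signal starting at `i`. -/
def windowInner (N : ℕ) (ζ : ℕ → ℝ) (x : ZMod m → ℝ) (i : ZMod m) : ℝ :=
  ∑ j ∈ Finset.range N, x (i + (j : ZMod m)) * ζ j

/-- The population fourth moment of `windowInner`. -/
def fourthMoment (N : ℕ) (θ : ℝ) (ζ : ℕ → ℝ) : ℝ :=
  3 * θ * (1 - θ) * (∑ j ∈ Finset.range N, ζ j ^ 4)
    + 3 * θ ^ 2 * (∑ j ∈ Finset.range N, ζ j ^ 2) ^ 2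

variable [NeZero m] (θ : unitInterval)

lemma integral_eval_pow (n : ZMod m) (r : ℕ) :
    ∫ x, x n ^ r ∂signalLaw m θ = ∫ y, y ^ r ∂bernoulliGaussian θ :=
  integral_comp_eval (μ := fun _ : ZMod m => bernoulliGaussian θ) (i := n) (f := fun y => y ^ r)
    (by fun_prop)

lemma memLp_eval (n : ZMod m) (r : ℕ) : MemLp (fun x : ZMod m → ℝ => x n) r (signalLaw m θ) := by
  have h : shiftMonomial (r := 1) (fun _ => 0) n = fun x : ZMod m → ℝ => x n := by
    ext; simp [shiftMonomial]
  exact h ▸ memLp_shiftMonomial (m := m) θ (r := 1) (fun _ => 0) n r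

lemma memLp_windowInner (N : ℕ) (ζ : ℕ → ℝ) (i : ZMod m) (r : ℕ) :
    MemLp (fun x => windowInner N ζ x i) r (signalLaw m θ) :=
  memLp_finsetSum _ fun j _ => (memLp_eval θ _ r).mul_const (ζ j)

/-- As `N ≤ m`, the entries of one window are independent. They are added one at a time, and only
their vanishing first and third moments and the values `θ`, `3θ` enter. -/
lemma integral_windowInner_pow {N : ℕ} (hN : N ≤ m) (ζ : ℕ → ℝ) (i : ZMod m) :
    ∫ x, windowInner N ζ x i ^ 2 ∂signalLaw m θ = θ * ∑ j ∈ Finset.range N, ζ j ^ 2 ∧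
    ∫ x, windowInner N ζ x i ^ 4 ∂signalLaw m θ = fourthMoment N θ ζ := by
  induction N with
  | zero => simp [windowInner, fourthMoment]
  | succ N ih =>
    obtain ⟨ih2, ih4⟩ := ih (by omega)
    set X := fun x : ZMod m → ℝ => x (i + (N : ZMod m)) * ζ N with hXdef
    have hsplit : ∀ x, windowInner (N + 1) ζ x i = windowInner N ζ x i + X x := fun x => by
      rw [windowInner, Finset.sum_range_succ]; rfl
    have hX : ∀ r : ℕ, MemLp X r (signalLaw m θ) := fun r => (memLp_eval θ _ r).mul_const (ζ N)
    have hXpow : ∀ r : ℕ, ∫ x, X x ^ r ∂signalLaw m θ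
        = (∫ y, y ^ r ∂bernoulliGaussian θ) * ζ N ^ r := by
      intro r
      simp_rw [hXdef, mul_pow]
      rw [integral_mul_const, integral_eval_pow]
    have hX1 : ∫ x, X x ∂signalLaw m θ = 0 := by
      have := hXpow 1
      rw [integral_odd_pow_bernoulliGaussian θ odd_one] at this
      simpa using this
    have hX3 : ∫ x, X x ^ 3 ∂signalLaw m θ = 0 := by
      rw [hXpow, integral_odd_pow_bernoulliGaussian θ (by decide)]; simp
    have hind : IndepFun (fun x => windowInner N ζ x i) X (signalLaw m θ) := by
      refine indepFun_of_dependsOn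
        (S := (Finset.range N).image fun j : ℕ => i + (j : ZMod m)) (T := {i + (N : ZMod m)})
        ?_ ?_ ?_ ?_ ?_
      · unfold windowInner; fun_prop
      · fun_prop
      · intro x y h
        refine Finset.sum_congr rfl fun j hj => ?_
        rw [h]
        exact Finset.mem_coe.2 (Finset.mem_image_of_mem _ hj)
      · intro x y h
        simp only [hXdef]
        rw [h _ (by simp)]
      · rw [Finset.disjoint_singleton_right]
        intro h
        obtain ⟨j, hj, hjN⟩ := Finset.mem_image.1 h
        have hj' := Finset.mem_range.1 hj
        have := natCast_zmod_injOn hN (by omega) (by omega) (add_left_cancel hjN)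
        omega
    have hS := memLp_windowInner (m := m) θ N ζ i
    simp_rw [hsplit]
    constructor
    · rw [integral_add_sq_of_indep hS hX hind hX1, ih2, hXpow, integral_sq_bernoulliGaussian,
        Finset.sum_range_succ]
      ring
    · rw [integral_add_pow_four_of_indep hS hX hind hX1 hX3, ih2, ih4, hXpow, hXpow,
        integral_sq_bernoulliGaussian, integral_pow_four_bernoulliGaussian, fourthMoment,
        fourthMoment, Finset.sum_range_succ, Finset.sum_range_succ]
      ring

end WindowMoments

/-! ### Uniform deviation bounds outside the square-free quartic part. -/

section WindowBounds

variable {m : ℕ} [NeZero m] {θ : unitInterval} {A : ℝ} {k N : ℕ} {x : ZMod m → ℝ} {ζ : ℕ → ℝ}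

lemma sub_integral_sum_shiftMonomial {τ : Type*} (Q : Finset τ) {r : ℕ} (a : τ → ℝ)
    (J : τ → Fin r → ℕ) (i : ZMod m) (x : ZMod m → ℝ) :
    (∑ t ∈ Q, a t * shiftMonomial (J t) i x)
      - ∫ y, (∑ t ∈ Q, a t * shiftMonomial (J t) i y) ∂signalLaw m θ
      = ∑ t ∈ Q, a t * centeredMonomial θ (J t) i x := by
  rw [integral_finsetSum _ fun t _ => (integrable_shiftMonomial θ (J t) i).const_mul _,
    ← Finset.sum_sub_distrib]
  refine Finset.sum_congr rfl fun t _ => ?_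
  rw [integral_const_mul, centeredMonomial, mul_sub]

lemma sum_abs_sq_le (hN : N ≤ 2 * k) (hζ : ∑ j ∈ Finset.range N, ζ j ^ 2 ≤ 1) :
    (∑ j ∈ Finset.range N, |ζ j|) ^ 2 ≤ 2 * k := by
  have h := sq_sum_le_card_mul_sum_sq (s := Finset.range N) (f := fun j => |ζ j|)
  simp only [Finset.card_range, sq_abs] at h
  have hN' : (N : ℝ) ≤ 2 * k := by exact_mod_cast hN
  have : (0 : ℝ) ≤ N := by positivity
  nlinarith

omit [NeZero m] in
lemma fullScale_le (d : ℕ) : fullScale m θ d ≤ √m := by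
  refine Real.sqrt_le_sqrt ?_
  have := pow_le_one₀ (n := min d 4) θ.2.1 θ.2.2
  have : (0 : ℝ) ≤ m := by positivity
  nlinarith

omit [NeZero m] in
lemma fullScale_le_of_two_le {d : ℕ} (hd : 2 ≤ d) : fullScale m θ d ≤ √m * θ := by
  have h0 := θ.2.1
  rw [← Real.sqrt_sq h0, ← Real.sqrt_mul (by positivity)]
  refine Real.sqrt_le_sqrt ?_
  have := pow_le_pow_of_le_one h0 θ.2.2 (show 2 ≤ min d 4 by omega)
  gcongr

/-- The proposition `p` stands for all positions being equal. Otherwise two distinct positions gain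
a factor `θ` in the scale. -/
lemma abs_sum_centeredMonomial_le {r : ℕ} (h : EntryControl θ A k N r Finset.univ (fullScale m θ) x)
    (hA : 0 ≤ A * slack k) {J : Fin r → ℕ} (hJ : ∀ a, J a < N) (p : Prop) [Decidable p]
    (hp : ¬ p → ∃ a b, J a ≠ J b) :
    |∑ i, centeredMonomial θ J i x| ≤ A * slack k * √m * (θ + if p then 1 else 0) := by
  refine (h J hJ).trans ?_
  have h0 := θ.2.1
  rw [mul_assoc (A * slack k)]
  refine mul_le_mul_of_nonneg_left ?_ hA
  by_cases hpp : p
  · rw [if_pos hpp]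
    refine (fullScale_le _).trans ?_
    have := Real.sqrt_nonneg (m : ℝ)
    nlinarith
  · rw [if_neg hpp, add_zero]
    obtain ⟨a, b, hab⟩ := hp hpp
    refine fullScale_le_of_two_le (Finset.one_lt_card.2 ⟨J a, ?_, J b, ?_, hab⟩) <;> simp

/-- Off-diagonal monomials cost `θ‖ζ‖₁² ≤ 2θk` and diagonal ones `‖ζ‖₂² ≤ 1 ≤ θk`, which gives the
constant `3`. -/
lemma abs_sum_windowInner_sq_sub_le (hN : N ≤ m) (hN2 : N ≤ 2 * k) (hθk : 1 ≤ θ * (k : ℝ))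
    (h : EntryControl θ A k N 2 Finset.univ (fullScale m θ) x) (hA : 0 ≤ A * slack k)
    (hζ : ∑ j ∈ Finset.range N, ζ j ^ 2 ≤ 1) :
    |∑ i, windowInner N ζ x i ^ 2 - m * (θ * ∑ j ∈ Finset.range N, ζ j ^ 2)|
      ≤ A * slack k * √m * (3 * (θ * k)) := by
  set R := Finset.range N
  have hexp : ∀ (y : ZMod m → ℝ) (i : ZMod m), windowInner N ζ y i ^ 2
      = ∑ t ∈ R ×ˢ R, (ζ t.1 * ζ t.2) * shiftMonomial ![t.1, t.2] i y := by
    intro y i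
    rw [sq, windowInner, Finset.sum_mul_sum, Finset.sum_product]
    refine Finset.sum_congr rfl fun j _ => Finset.sum_congr rfl fun l _ => ?_
    simp [shiftMonomial, Fin.prod_univ_two]; ring
  have hcen : ∀ i, windowInner N ζ x i ^ 2 - θ * ∑ j ∈ R, ζ j ^ 2
      = ∑ t ∈ R ×ˢ R, (ζ t.1 * ζ t.2) * centeredMonomial θ ![t.1, t.2] i x := by
    intro i
    rw [← (integral_windowInner_pow θ hN ζ i).1, ← sub_integral_sum_shiftMonomial]
    simp_rw [hexp]
  have hsum : ∑ i, windowInner N ζ x i ^ 2 - m * (θ * ∑ j ∈ R, ζ j ^ 2)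
      = ∑ t ∈ R ×ˢ R, (ζ t.1 * ζ t.2) * ∑ i, centeredMonomial θ ![t.1, t.2] i x := by
    simp_rw [Finset.mul_sum (s := Finset.univ)]
    rw [Finset.sum_comm]
    simp_rw [← hcen]
    rw [Finset.sum_sub_distrib, Finset.sum_const, Finset.card_univ, ZMod.card, nsmul_eq_mul]
  rw [hsum]
  set b := A * slack k * √m with hb
  have hb0 : 0 ≤ b := by positivity
  have hent : ∀ t ∈ R ×ˢ R, |(ζ t.1 * ζ t.2) * ∑ i, centeredMonomial θ ![t.1, t.2] i x|
      ≤ (|ζ t.1| * |ζ t.2|) * (b * θ) + if t.1 = t.2 then b * ζ t.1 ^ 2 else 0 := by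
    rintro ⟨j, l⟩ ht
    obtain ⟨hj, hl⟩ := Finset.mem_product.1 ht
    have hJ : ∀ a, (![j, l] : Fin 2 → ℕ) a < N := by
      intro a; fin_cases a
      · exact Finset.mem_range.1 hj
      · exact Finset.mem_range.1 hl
    have := abs_sum_centeredMonomial_le h hA hJ (j = l) fun hne => ⟨0, 1, hne⟩
    rw [abs_mul, abs_mul]
    refine (mul_le_mul_of_nonneg_left this (by positivity)).trans (le_of_eq ?_)
    dsimp only
    split_ifs with hjl
    · subst hjl; rw [← sq_abs]; ring
    · ring
  refine (Finset.abs_sum_le_sum_abs _ _).trans ((Finset.sum_le_sum hent).trans ?_)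
  rw [Finset.sum_add_distrib, ← Finset.sum_mul, Finset.sum_product, Finset.sum_product]
  simp only [Finset.sum_ite_eq, ← Finset.mul_sum, ← Finset.sum_mul]
  have h1 : ∑ j ∈ R, (if j ∈ R then b * ζ j ^ 2 else 0) ≤ b := by
    rw [Finset.sum_congr rfl fun j hj => if_pos hj, ← Finset.mul_sum]
    exact mul_le_of_le_one_right hb0 hζ
  have h2 := sum_abs_sq_le hN2 hζ
  rw [← sq]
  have hθ0 := θ.2.1
  have h3 : (∑ j ∈ R, |ζ j|) ^ 2 * (b * θ) ≤ 2 * k * (b * θ) := by gcongr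
  have h4 : b ≤ b * (θ * k) := le_mul_of_one_le_right hb0 hθk
  nlinarith

omit [NeZero m] in
lemma sum_elemSym_windows (I : Finset (ZMod m)) (r n : ℕ) :
    ∑ i ∈ I, elemSym r (fun j => x (i + (j : ZMod m)) * ζ j) n
      = ∑ S ∈ Finset.powersetCard r (Finset.range n),
          (∏ j ∈ S, ζ j) * ∑ i ∈ I, ∏ j ∈ S, x (i + (j : ZMod m)) := by
  simp_rw [elemSym_mul, Finset.mul_sum]
  rw [Finset.sum_comm]

-- The entrywise bound, paying `‖ζ‖₁ ^ r`. It is affordable only for the few windows that wrap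
-- around.
omit [NeZero m] in
lemma abs_sum_elemSym_windows_le (I : Finset (ZMod m)) {r n : ℕ} {B : ℝ} (hB0 : 0 ≤ B)
    (hB : ∀ S ∈ Finset.powersetCard r (Finset.range n),
      |∑ i ∈ I, ∏ j ∈ S, x (i + (j : ZMod m))| ≤ B) :
    |∑ i ∈ I, elemSym r (fun j => x (i + (j : ZMod m)) * ζ j) n|
      ≤ B * (∑ j ∈ Finset.range n, |ζ j|) ^ r := by
  rw [sum_elemSym_windows]
  refine (Finset.abs_sum_le_sum_abs _ _).trans ?_
  calc ∑ S ∈ Finset.powersetCard r (Finset.range n),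
        |(∏ j ∈ S, ζ j) * ∑ i ∈ I, ∏ j ∈ S, x (i + (j : ZMod m))|
      ≤ ∑ S ∈ Finset.powersetCard r (Finset.range n), (∏ j ∈ S, |ζ j|) * B := by
        refine Finset.sum_le_sum fun S hS => ?_
        rw [abs_mul, Finset.abs_prod]
        exact mul_le_mul_of_nonneg_left (hB S hS) (by positivity)
    _ = B * elemSym r (fun j => |ζ j|) n := by rw [← Finset.sum_mul, mul_comm]; rfl
    _ ≤ _ := mul_le_mul_of_nonneg_left (elemSym_le_sum_pow (fun j => abs_nonneg _) r n) hB0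

lemma integral_elemSym_window (hN : N ≤ m) (i : ZMod m) :
    Integrable (fun y : ZMod m → ℝ => elemSym 4 (fun j => y (i + (j : ZMod m)) * ζ j) N)
      (signalLaw m θ) ∧
    ∫ y, elemSym 4 (fun j => y (i + (j : ZMod m)) * ζ j) N ∂signalLaw m θ = 0 := by
  have key : ∀ S ∈ Finset.powersetCard 4 (Finset.range N),
      Integrable (fun y : ZMod m → ℝ => ∏ j ∈ S, y (i + (j : ZMod m))) (signalLaw m θ) ∧
      ∫ y, (∏ j ∈ S, y (i + (j : ZMod m))) ∂signalLaw m θ = 0 := by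
    intro S hS
    rw [Finset.mem_powersetCard] at hS
    obtain ⟨J, hJ, hJS⟩ := exists_enum hS.2
    have hJN : ∀ a, J a < N := fun a => Finset.mem_range.1 (hS.1 (hJS ▸
      Finset.mem_image_of_mem J (Finset.mem_univ a)))
    have he : (fun y : ZMod m → ℝ => ∏ j ∈ S, y (i + (j : ZMod m))) = shiftMonomial J i := by
      ext y; rw [shiftMonomial_eq_prod_image hJ, hJS]
    rw [he]
    refine ⟨integrable_shiftMonomial θ J i,
      integral_shiftMonomial_eq_zero θ (n := i + (J 0 : ZMod m)) ?_⟩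
    rw [multiplicity_of_injective hN hJ hJN i (hJN 0)]
    simp
  simp_rw [elemSym_mul]
  constructor
  · exact integrable_finsetSum _ fun S hS => (key S hS).1.const_mul _
  · rw [integral_finsetSum _ fun S hS => (key S hS).1.const_mul _]
    refine Finset.sum_eq_zero fun S hS => ?_
    rw [integral_const_mul, (key S hS).2, mul_zero]

/-- Outside `e₄` two indices coincide, so only `‖ζ‖₁² ≤ 2k` appears instead of `‖ζ‖₁⁴`. The constant
is `23 * (2 + 1)`, with `23` bounding `lowerCoeff`. -/
lemma abs_sum_windowInner_pow_four_sub_le (hN : N ≤ m) (hN2 : N ≤ 2 * k) (hθk : 1 ≤ θ * (k : ℝ))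
    (h : EntryControl θ A k N 4 Finset.univ (fullScale m θ) x) (hA : 0 ≤ A * slack k)
    (hζ : ∑ j ∈ Finset.range N, ζ j ^ 2 ≤ 1) :
    |∑ i, windowInner N ζ x i ^ 4 - m * fourthMoment N θ ζ
        - 24 * ∑ i, elemSym 4 (fun j => x (i + (j : ZMod m)) * ζ j) N|
      ≤ A * slack k * √m * (69 * (θ * k)) := by
  set R := Finset.range N
  set Q := R ×ˢ R ×ˢ R ×ˢ R
  set J : ℕ × ℕ × ℕ × ℕ → Fin 4 → ℕ := fun t => ![t.1, t.2.1, t.2.2.1, t.2.2.2]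
  set a : ℕ × ℕ × ℕ × ℕ → ℝ := fun t => lowerCoeff t.1 t.2.1 t.2.2.1 t.2.2.2
    * (ζ t.1 * ζ t.2.1 * ζ t.2.2.1 * ζ t.2.2.2)
  have hexp : ∀ (y : ZMod m → ℝ) (i : ZMod m), windowInner N ζ y i ^ 4
      = 24 * elemSym 4 (fun j => y (i + (j : ZMod m)) * ζ j) N
        + ∑ t ∈ Q, a t * shiftMonomial (J t) i y := by
    intro y i
    rw [windowInner, sum_pow_four_eq, Finset.sum_product]
    congr 1
    refine Finset.sum_congr rfl fun j _ => ?_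
    rw [Finset.sum_product]
    refine Finset.sum_congr rfl fun l _ => ?_
    rw [Finset.sum_product]
    refine Finset.sum_congr rfl fun p _ => Finset.sum_congr rfl fun q _ => ?_
    simp only [a, J, shiftMonomial, Fin.prod_univ_four, Matrix.cons_val]
    ring
  have hcen : ∀ i, windowInner N ζ x i ^ 4 - fourthMoment N θ ζ
      - 24 * elemSym 4 (fun j => x (i + (j : ZMod m)) * ζ j) N
      = ∑ t ∈ Q, a t * centeredMonomial θ (J t) i x := by
    intro i
    obtain ⟨hint, hzero⟩ := integral_elemSym_window (θ := θ) (ζ := ζ) hN i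
    have hQ : Integrable (fun y : ZMod m → ℝ => ∑ t ∈ Q, a t * shiftMonomial (J t) i y)
        (signalLaw m θ) :=
      integrable_finsetSum _ fun t _ => (integrable_shiftMonomial θ (J t) i).const_mul _
    rw [← (integral_windowInner_pow θ hN ζ i).2, ← sub_integral_sum_shiftMonomial]
    simp_rw [hexp]
    rw [integral_add (hint.const_mul 24) hQ, integral_const_mul, hzero]
    ring
  have hsum : ∑ i, windowInner N ζ x i ^ 4 - m * fourthMoment N θ ζ
      - 24 * ∑ i, elemSym 4 (fun j => x (i + (j : ZMod m)) * ζ j) N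
      = ∑ t ∈ Q, a t * ∑ i, centeredMonomial θ (J t) i x := by
    simp_rw [Finset.mul_sum (s := Finset.univ)]
    rw [Finset.sum_comm]
    simp_rw [← hcen]
    rw [Finset.sum_sub_distrib, Finset.sum_sub_distrib, Finset.sum_const, Finset.card_univ,
      ZMod.card, nsmul_eq_mul]
  rw [hsum]
  set b := A * slack k * √m with hb
  have hb0 : 0 ≤ b := by positivity
  have hθ0 := θ.2.1
  have hent : ∀ t ∈ Q, |a t * ∑ i, centeredMonomial θ (J t) i x|
      ≤ 23 * (b * θ) * (|ζ t.1| * |ζ t.2.1| * (if t.2.2.1 = t.2.2.2 then ζ t.2.2.1 ^ 2 else 0))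
        + 23 * b * (if t.2.2.1 = t.2.2.2 then if t.2.1 = t.2.2.1 then if t.1 = t.2.1 then
            ζ t.1 ^ 4 else 0 else 0 else 0) := by
    rintro ⟨j, l, p, q⟩ ht
    simp only [Q, Finset.mem_product] at ht
    obtain ⟨hj, hl, hp, hq⟩ := ht
    have hJ : ∀ c, J (j, l, p, q) c < N := by
      intro c; fin_cases c
      · exact Finset.mem_range.1 hj
      · exact Finset.mem_range.1 hl
      · exact Finset.mem_range.1 hp
      · exact Finset.mem_range.1 hq
    have hbd := abs_sum_centeredMonomial_le h hA hJ (p = q ∧ l = p ∧ j = l) (by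
      intro hne
      by_contra! hall
      exact hne ⟨hall 2 3, hall 1 2, hall 0 1⟩)
    have hco := abs_lowerCoeff_le j l p q
    rw [abs_mul]
    simp only [a, abs_mul]
    by_cases hpq : p = q
    · subst hpq
      rw [if_pos rfl] at hco
      have h1 : |lowerCoeff j l p p| * (|ζ j| * |ζ l| * |ζ p| * |ζ p|)
          * |∑ i, centeredMonomial θ (J (j, l, p, p)) i x|
          ≤ 23 * (|ζ j| * |ζ l| * |ζ p| * |ζ p|)
            * (b * (θ + if p = p ∧ l = p ∧ j = l then 1 else 0)) := by
        gcongr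
      refine h1.trans (le_of_eq ?_)
      simp only [true_and, if_true]
      by_cases hlp : l = p
      · by_cases hjl : j = l
        · subst hlp; subst hjl
          simp only [and_self, if_true, ← sq_abs (ζ j)]
          rw [show ζ j ^ 4 = |ζ j| ^ 4 by rw [← abs_pow, abs_of_nonneg (by positivity)]]
          ring
        · subst hlp
          simp only [hjl, and_false, if_true, if_false]
          rw [← sq_abs (ζ l)]
          ring
      · simp only [hlp, false_and, if_false]
        rw [← sq_abs (ζ p)]; ring
    · rw [if_neg hpq] at hco
      have : |lowerCoeff j l p q| = 0 := le_antisymm hco (abs_nonneg _)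
      rw [this]
      simp [hpq]
  refine (Finset.abs_sum_le_sum_abs _ _).trans ((Finset.sum_le_sum hent).trans ?_)
  rw [Finset.sum_add_distrib, ← Finset.mul_sum, ← Finset.mul_sum]
  have s1 : ∑ t ∈ Q, |ζ t.1| * |ζ t.2.1| * (if t.2.2.1 = t.2.2.2 then ζ t.2.2.1 ^ 2 else 0)
      ≤ 2 * k := by
    have e : ∑ t ∈ Q, |ζ t.1| * |ζ t.2.1| * (if t.2.2.1 = t.2.2.2 then ζ t.2.2.1 ^ 2 else 0)
        = (∑ j ∈ R, |ζ j|) ^ 2 * ∑ p ∈ R, ζ p ^ 2 := by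
      simp only [Q, Finset.sum_product, ← Finset.mul_sum, Finset.sum_ite_eq, ← Finset.sum_mul]
      rw [Finset.sum_congr rfl fun p (hp : p ∈ R) => if_pos hp, sq]
    rw [e]
    have hz : 0 ≤ ∑ p ∈ R, ζ p ^ 2 := Finset.sum_nonneg fun _ _ => sq_nonneg _
    calc _ ≤ (2 * k : ℝ) * 1 := mul_le_mul (sum_abs_sq_le hN2 hζ) hζ hz (by positivity)
      _ = _ := by ring
  have s2 : ∑ t ∈ Q, (if t.2.2.1 = t.2.2.2 then if t.2.1 = t.2.2.1 then if t.1 = t.2.1 then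
            ζ t.1 ^ 4 else 0 else 0 else 0) ≤ 1 := by
    have e : ∑ t ∈ Q, (if t.2.2.1 = t.2.2.2 then if t.2.1 = t.2.2.1 then if t.1 = t.2.1 then
            ζ t.1 ^ 4 else 0 else 0 else 0) = ∑ j ∈ R, ζ j ^ 4 := by
      simp only [Q, Finset.sum_product, Finset.sum_ite_eq]
      refine Finset.sum_congr rfl fun j hj => ?_
      rw [Finset.sum_congr rfl fun l (hl : l ∈ R) => Finset.sum_congr rfl fun p (hp : p ∈ R) =>
        if_pos hp]
      simp only [Finset.sum_ite_eq]
      rw [Finset.sum_congr rfl fun l (hl : l ∈ R) => if_pos hl]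
      simp only [Finset.sum_ite_eq, if_pos hj]
    rw [e]
    refine le_trans (Finset.sum_le_sum fun j hj => ?_) hζ
    have : ζ j ^ 2 ≤ 1 := (Finset.single_le_sum (f := fun j => ζ j ^ 2)
      (fun _ _ => sq_nonneg _) hj).trans hζ
    nlinarith [sq_nonneg (ζ j)]
  have h4 : b ≤ b * (θ * k) := le_mul_of_one_le_right hb0 hθk
  have t1 := mul_le_mul_of_nonneg_left s1 (show 0 ≤ 23 * (b * θ) by positivity)
  have t2 := mul_le_mul_of_nonneg_left s2 (show 0 ≤ 23 * b by positivity)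
  linarith

end WindowBounds

/-! ### The quartic chaos as a martingale transform and its quadratic variation. -/

lemma sum_range_diagonal {m N : ℕ} (hN : N ≤ m) (f : ℕ → ℕ → ℝ) :
    ∑ n ∈ Finset.range m, ∑ q ∈ Finset.range N,
        (if q ≤ n ∧ n - q ≤ m - N then f q (n - q) else 0)
      = ∑ q ∈ Finset.range N, ∑ i ∈ Finset.range (m - N + 1), f q i := by
  rw [Finset.sum_comm]
  refine Finset.sum_congr rfl fun q hq => ?_
  rw [← Finset.sum_filter]
  have hq := Finset.mem_range.1 hq
  refine Finset.sum_bij' (fun n _ => n - q) (fun i _ => i + q) (fun n hn => ?_) (fun i hi => ?_)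
    (fun n hn => ?_) (fun i hi => ?_) fun n hn => rfl
  · simp only [Finset.mem_filter, Finset.mem_range] at hn ⊢; omega
  · simp only [Finset.mem_filter, Finset.mem_range] at hi ⊢; omega
  · simp only [Finset.mem_filter, Finset.mem_range] at hn ⊢; omega
  · simp only [Nat.add_sub_cancel]

/-- The predictable coefficient of `y n` in the sum of the elementary symmetric polynomials of
degree `4` over the windows that do not wrap around. -/
noncomputable def predictableCoeff (m N : ℕ) (ζ : ℕ → ℝ) (n : ℕ) (y : ℕ → ℝ) : ℝ :=
  ∑ q ∈ Finset.range N, if q ≤ n ∧ n - q ≤ m - N then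
    ζ q * elemSym 3 (fun j => y (n - q + j) * ζ j) q else 0

lemma measurable_predictableCoeff (m N : ℕ) (ζ : ℕ → ℝ) (n : ℕ) :
    Measurable (predictableCoeff m N ζ n) := by
  unfold predictableCoeff elemSym
  refine Finset.measurable_fun_sum _ fun q _ => ?_
  split_ifs
  · fun_prop
  · exact measurable_const

/-- The entries used have index `n - q + j` with `j < q`, hence below `n`. -/
lemma predictableCoeff_congr {m N : ℕ} {ζ : ℕ → ℝ} {n : ℕ} {y y' : ℕ → ℝ}
    (h : ∀ j < n, y j = y' j) : predictableCoeff m N ζ n y = predictableCoeff m N ζ n y' := by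
  unfold predictableCoeff
  refine Finset.sum_congr rfl fun q _ => ?_
  split_ifs with hq
  · rw [elemSym_congr fun j hj => ?_]
    rw [h _ (by omega)]
  · rfl

variable {m : ℕ} [NeZero m] {θ : unitInterval} {A : ℝ} {k N : ℕ} {x : ZMod m → ℝ} {ζ : ℕ → ℝ}

-- A quadruple in the window starting at `i` with largest offset `q` is assigned to the entry `n = i
-- + q`.
omit [NeZero m] in
lemma sum_mul_predictableCoeff (hN : N ≤ m) (x : ZMod m → ℝ) (ζ : ℕ → ℝ) :
    ∑ n ∈ Finset.range m, x n * predictableCoeff m N ζ n (fun j => x j)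
      = ∑ n ∈ Finset.range (m - N + 1), elemSym 4 (fun j => x ((n : ZMod m) + (j : ZMod m)) * ζ j) N := by
  simp_rw [elemSym_succ_eq_sum 3]
  rw [Finset.sum_comm, ← sum_range_diagonal hN]
  refine Finset.sum_congr rfl fun n _ => ?_
  rw [predictableCoeff, Finset.mul_sum]
  refine Finset.sum_congr rfl fun q _ => ?_
  rw [mul_ite, mul_zero]
  refine if_ctx_congr Iff.rfl (fun h => ?_) fun _ => rfl
  have : (n : ZMod m) = ((n - q : ℕ) : ZMod m) + (q : ZMod m) := by
    rw [← Nat.cast_add, Nat.sub_add_cancel h.1]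
  rw [← this]
  push_cast
  ring

/-- Cauchy-Schwarz over the offset `q`, using `‖ζ‖₂ ≤ 1`. Adding the wrapped windows only increases
the bound and yields the full cyclic sums that `EntryControl` handles. -/
lemma sum_predictableCoeff_sq_le (hN : N ≤ m) (hζ : ∑ j ∈ Finset.range N, ζ j ^ 2 ≤ 1)
    (x : ZMod m → ℝ) :
    ∑ n ∈ Finset.range m, predictableCoeff m N ζ n (fun j => x j) ^ 2
      ≤ ∑ q ∈ Finset.range N, ∑ i, elemSym 3 (fun j => x (i + (j : ZMod m)) * ζ j) q ^ 2 := by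
  set g : ℕ → ℕ → ℝ := fun q i => elemSym 3 (fun j => x ((i : ZMod m) + (j : ZMod m)) * ζ j) q
  have h1 : ∀ n, predictableCoeff m N ζ n (fun j => x j) ^ 2
      ≤ ∑ q ∈ Finset.range N, if q ≤ n ∧ n - q ≤ m - N then g q (n - q) ^ 2 else 0 := by
    intro n
    have : predictableCoeff m N ζ n (fun j => x j) = ∑ q ∈ Finset.range N,
        ζ q * if q ≤ n ∧ n - q ≤ m - N then g q (n - q) else 0 := by
      refine Finset.sum_congr rfl fun q _ => ?_
      rw [mul_ite, mul_zero]
      refine if_congr Iff.rfl ?_ rfl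
      simp only [g]; push_cast; rfl
    rw [this]
    refine (Finset.sum_mul_sq_le_sq_mul_sq _ _ _).trans ?_
    refine (mul_le_of_le_one_left (Finset.sum_nonneg fun _ _ => sq_nonneg _) hζ).trans
      (le_of_eq (Finset.sum_congr rfl fun q _ => ?_))
    split_ifs <;> simp
  refine (Finset.sum_le_sum fun n _ => h1 n).trans ?_
  rw [sum_range_diagonal hN fun q i => g q i ^ 2]
  refine Finset.sum_le_sum fun q hq => ?_
  rw [sum_zmod_eq_add_wrapSet (N := N) (by have := Finset.mem_range.1 hq; omega) hN]
  exact le_add_of_nonneg_right (Finset.sum_nonneg fun _ _ => sq_nonneg _)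

/-- The square is a double sum over triples. Pairs of distinct triples have mean zero and cost
`‖ζ‖₁⁶ ≤ (2k)³` times the fluctuation scale. Equal triples carry a mean of order `mθ³`, but their
coefficients add up to at most `‖ζ‖₂⁶ ≤ 1`. -/
lemma sum_elemSym_three_sq_le (hN : N ≤ m) (hN2 : N ≤ 2 * k) (hθk : 1 ≤ θ * (k : ℝ))
    (h : EntryControl θ A k N 6 Finset.univ (fullScale m θ) x) (hA : 0 ≤ A * slack k)
    (hζ : ∑ j ∈ Finset.range N, ζ j ^ 2 ≤ 1) {q : ℕ} (hq : q ≤ N) :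
    ∑ i, elemSym 3 (fun j => x (i + (j : ZMod m)) * ζ j) q ^ 2
      ≤ 9 * (A * slack k) * √m * θ ^ 2 * k ^ 3 + gaussMomentBound 6 ^ 6 * m * θ ^ 2 := by
  have hθ0 := θ.2.1
  have hθ1 := θ.2.2
  set Q := Finset.powersetCard 3 (Finset.range q)
  have hQ : ∀ S ∈ Q, S ∈ Finset.powersetCard 3 (Finset.range N) := fun S hS =>
    Finset.powersetCard_mono (Finset.range_subset_range.2 hq) hS
  set X := A * slack k * √(m * (θ : ℝ) ^ 4) with hX
  set Y := A * slack k * √(m * (θ : ℝ) ^ 3) + m * (gaussMomentBound 6 ^ 6 * (θ : ℝ) ^ 3) with hY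
  have hG := one_le_gaussMomentBound 6
  have hX0 : 0 ≤ X := by positivity
  have hY0 : 0 ≤ Y := by positivity
  have hexp : ∑ i, elemSym 3 (fun j => x (i + (j : ZMod m)) * ζ j) q ^ 2
      = ∑ S ∈ Q, ∑ S' ∈ Q, ((∏ j ∈ S, ζ j) * ∏ j ∈ S', ζ j) *
        ∑ i, (∏ j ∈ S, x (i + (j : ZMod m))) * ∏ j ∈ S', x (i + (j : ZMod m)) := by
    simp_rw [elemSym_mul, sq, Finset.sum_mul_sum, Finset.mul_sum]
    rw [Finset.sum_comm]
    refine Finset.sum_congr rfl fun S _ => ?_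
    rw [Finset.sum_comm]
    refine Finset.sum_congr rfl fun S' _ => Finset.sum_congr rfl fun i _ => ?_
    ring
  have hent : ∀ S ∈ Q, ∀ S' ∈ Q, ((∏ j ∈ S, ζ j) * ∏ j ∈ S', ζ j) *
        ∑ i, (∏ j ∈ S, x (i + (j : ZMod m))) * ∏ j ∈ S', x (i + (j : ZMod m))
      ≤ (∏ j ∈ S, |ζ j|) * (∏ j ∈ S', |ζ j|) * X + if S = S' then Y * ∏ j ∈ S, ζ j ^ 2 else 0 := by
    intro S hS S' hS'
    refine (le_abs_self _).trans ?_
    rw [abs_mul, abs_mul, Finset.abs_prod, Finset.abs_prod]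
    refine (mul_le_mul_of_nonneg_left (abs_sum_prod_three_mul_le hN h hA (hQ S hS) (hQ S' hS'))
      (by positivity)).trans (le_of_eq ?_)
    split_ifs with hSS
    · subst hSS
      rw [mul_add, ← Finset.prod_mul_distrib]
      simp only [← sq, sq_abs]
      ring
    · ring
  have hs1 : (∑ S ∈ Q, ∏ j ∈ S, |ζ j|) ^ 2 ≤ (2 * k) ^ 3 := by
    have e : (∑ S ∈ Q, ∏ j ∈ S, |ζ j|) ≤ (∑ j ∈ Finset.range N, |ζ j|) ^ 3 :=
      (elemSym_le_sum_pow (fun j => abs_nonneg (ζ j)) 3 q).trans (pow_le_pow_left₀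
        (Finset.sum_nonneg fun _ _ => abs_nonneg _) (Finset.sum_le_sum_of_subset_of_nonneg
          (Finset.range_subset_range.2 hq) fun _ _ _ => abs_nonneg _) 3)
    have e0 : 0 ≤ ∑ S ∈ Q, ∏ j ∈ S, |ζ j| := elemSym_nonneg fun j => abs_nonneg (ζ j)
    calc _ ≤ ((∑ j ∈ Finset.range N, |ζ j|) ^ 3) ^ 2 := pow_le_pow_left₀ e0 e 2
      _ = ((∑ j ∈ Finset.range N, |ζ j|) ^ 2) ^ 3 := by ring
      _ ≤ _ := pow_le_pow_left₀ (sq_nonneg _) (sum_abs_sq_le hN2 hζ) 3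
  have hs2 : ∑ S ∈ Q, ∏ j ∈ S, ζ j ^ 2 ≤ 1 := by
    refine (elemSym_le_sum_pow (fun j => sq_nonneg (ζ j)) 3 q).trans
      (pow_le_one₀ (Finset.sum_nonneg fun _ _ => sq_nonneg _) (le_trans
        (Finset.sum_le_sum_of_subset_of_nonneg (Finset.range_subset_range.2 hq)
          fun _ _ _ => sq_nonneg _) hζ))
  have hsum : ∑ i, elemSym 3 (fun j => x (i + (j : ZMod m)) * ζ j) q ^ 2
      ≤ (2 * k) ^ 3 * X + Y := by
    rw [hexp]
    refine (Finset.sum_le_sum fun S hS => Finset.sum_le_sum fun S' hS' => hent S hS S' hS').trans ?_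
    simp only [Finset.sum_add_distrib, Finset.sum_ite_eq, ← Finset.sum_mul, ← Finset.mul_sum]
    rw [Finset.sum_congr rfl fun S (hS : S ∈ Q) => if_pos hS, ← Finset.mul_sum, ← sq]
    exact add_le_add (mul_le_mul_of_nonneg_right hs1 hX0) (mul_le_of_le_one_right hY0 hs2)
  refine hsum.trans ?_
  have hX1 : X = A * slack k * √m * θ ^ 2 := by
    rw [hX, Real.sqrt_mul (by positivity), show (θ : ℝ) ^ 4 = (θ ^ 2) ^ 2 by ring,
      Real.sqrt_sq (by positivity)]
    ring
  have hk1 : (1 : ℝ) ≤ k := by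
    have : (θ : ℝ) * k ≤ 1 * k := by gcongr
    linarith
  have hY1 : √(m * (θ : ℝ) ^ 3) ≤ √m * θ ^ 2 * k ^ 3 := by
    rw [Real.sqrt_mul (by positivity), mul_assoc]
    refine mul_le_mul_of_nonneg_left ?_ (by positivity)
    refine Real.sqrt_le_iff.2 ⟨by positivity, ?_⟩
    have e1 : (1 : ℝ) ≤ θ * k ^ 6 := by
      calc (1 : ℝ) ≤ θ * k := hθk
        _ ≤ _ := by gcongr; exact le_self_pow₀ hk1 (by norm_num)
    calc (θ : ℝ) ^ 3 ≤ θ ^ 3 * (θ * k ^ 6) := le_mul_of_one_le_right (by positivity) e1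
      _ = _ := by ring
  have hY2 : m * (gaussMomentBound 6 ^ 6 * (θ : ℝ) ^ 3) ≤ gaussMomentBound 6 ^ 6 * m * θ ^ 2 := by
    rw [show m * (gaussMomentBound 6 ^ 6 * (θ : ℝ) ^ 3)
      = gaussMomentBound 6 ^ 6 * m * θ ^ 2 * θ by ring]
    exact mul_le_of_le_one_right (by positivity) hθ1
  have hY3 : A * slack k * √(m * (θ : ℝ) ^ 3) ≤ A * slack k * (√m * θ ^ 2 * k ^ 3) := by gcongr
  rw [hX1, hY]
  nlinarith

/-- The sum of the elementary symmetric polynomials of degree `4` over the windows that do not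
wrap around. -/
noncomputable def innerChaos (N : ℕ) (ζ : ℕ → ℝ) (x : ZMod m → ℝ) : ℝ :=
  ∑ n ∈ Finset.range (m - N + 1), elemSym 4 (fun j => x ((n : ZMod m) + (j : ZMod m)) * ζ j) N

/-- The bound on the quadratic variation of `innerChaos`. -/
noncomputable def chaosVariance (m : ℕ) (θ A : ℝ) (k : ℕ) : ℝ :=
  2 * k * (9 * (A * slack k) * √m * θ ^ 2 * k ^ 3 + gaussMomentBound 6 ^ 6 * m * θ ^ 2)

/-- The degree six control sits inside the event because it is what bounds the quadratic variation
by `chaosVariance`; the sum over the at most `2k` offsets supplies the leading factor there. -/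
lemma measure_innerChaos_le (hN : N ≤ m) (hN2 : N ≤ 2 * k) (hθk : 1 ≤ θ * (k : ℝ))
    (hA : 0 ≤ A * slack k) (hζ : ∑ j ∈ Finset.range N, ζ j ^ 2 ≤ 1) {u : ℝ} (hu : 0 < u) :
    (signalLaw m θ).real {x | √(2 * chaosVariance m θ A k * u) < |innerChaos N ζ x| ∧
        EntryControl θ A k N 6 Finset.univ (fullScale m θ) x} ≤ 2 * Real.exp (-u) := by
  have hG := one_le_gaussMomentBound 6
  have hm : (0 : ℝ) < m := Nat.cast_pos.2 (NeZero.pos m)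
  have hθ0 : (0 : ℝ) < θ := by
    rcases θ.2.1.lt_or_eq with h | h
    · exact h
    · rw [← h] at hθk; norm_num at hθk
  have hk : (0 : ℝ) < k := by nlinarith
  have hv : 0 < chaosVariance m θ A k := by unfold chaosVariance; positivity
  refine le_trans ?_ ((measure_abs_predictable_sum_le (m := m) θ (measurable_predictableCoeff m N ζ)
    (fun n y y' h => predictableCoeff_congr h) (s := √(2 * chaosVariance m θ A k * u))
    (by positivity) hv).trans (le_of_eq ?_))
  · refine measureReal_mono (fun x hx => ?_)
    obtain ⟨hx, hE⟩ := hx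
    refine ⟨by rwa [sum_mul_predictableCoeff hN], ?_⟩
    refine (sum_predictableCoeff_sq_le hN hζ x).trans ?_
    refine (Finset.sum_le_sum fun q hq => sum_elemSym_three_sq_le hN hN2 hθk hE hA hζ
      (Finset.mem_range.1 hq).le).trans ?_
    rw [Finset.sum_const, Finset.card_range, nsmul_eq_mul, chaosVariance]
    have : (N : ℝ) ≤ 2 * k := by exact_mod_cast hN2
    gcongr
  · rw [Real.sq_sqrt (by positivity)]
    congr 3
    field_simp

/-! ### A net for the coefficient vectors and a union bound over it. -/

/-- Rounding of `z` towards zero to a multiple of `1 / K`, multiplied by `K`. -/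
noncomputable def roundToZero (K : ℕ) (z : ℝ) : ℤ := if 0 ≤ z then ⌊z * K⌋ else ⌈z * K⌉

/-- The first inequality is the reason to round towards zero: the rounded vector stays in the unit
ball. -/
lemma abs_roundToZero_div_le {K : ℕ} (hK : 0 < K) (z : ℝ) :
    |(roundToZero K z : ℝ) / K| ≤ |z| ∧ |z - roundToZero K z / K| ≤ 1 / K := by
  have hK' : (0 : ℝ) < K := Nat.cast_pos.2 hK
  have e : z - roundToZero K z / K = (z * K - roundToZero K z) / K := by field_simp
  have key : |(roundToZero K z : ℝ)| ≤ |z| * K ∧ |z * K - roundToZero K z| ≤ 1 := by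
    unfold roundToZero
    split_ifs with h
    · have h1 := Int.floor_le (z * K)
      have h2 := Int.lt_floor_add_one (z * K)
      have h3 : (0 : ℝ) ≤ ⌊z * K⌋ := by exact_mod_cast Int.floor_nonneg.2 (by positivity)
      rw [abs_of_nonneg h, abs_of_nonneg h3]
      exact ⟨h1, abs_le.2 ⟨by linarith, by linarith⟩⟩
    · push Not at h
      have h1 := Int.le_ceil (z * K)
      have h2 := Int.ceil_lt_add_one (z * K)
      have h3 : ((⌈z * K⌉ : ℤ) : ℝ) ≤ 0 := by
        exact_mod_cast Int.ceil_nonpos.2 (mul_nonpos_of_nonpos_of_nonneg h.le hK'.le)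
      rw [abs_of_neg h, abs_of_nonpos h3]
      exact ⟨by linarith, abs_le.2 ⟨by linarith, by linarith⟩⟩
  rw [e, abs_div, abs_div, abs_of_pos hK']
  exact ⟨(div_le_iff₀ hK').2 key.1, div_le_div_of_nonneg_right key.2 hK'.le⟩

/-- The point with coordinates `p j / K` for `j < N`. -/
noncomputable def gridPoint {N : ℕ} (K : ℕ) (p : Fin N → ℤ) (j : ℕ) : ℝ :=
  if h : j < N then (p ⟨j, h⟩ : ℝ) / K else 0

lemma exists_gridPoint {N K : ℕ} (hK : 0 < K) {ζ : ℕ → ℝ}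
    (hζ : ∑ j ∈ Finset.range N, ζ j ^ 2 ≤ 1) :
    ∃ p ∈ Fintype.piFinset fun _ : Fin N => Finset.Icc (-(K : ℤ)) K,
      (∑ j ∈ Finset.range N, gridPoint K p j ^ 2 ≤ 1) ∧
        ∀ j < N, |gridPoint K p j| ≤ 1 ∧ |ζ j - gridPoint K p j| ≤ 1 / K := by
  have hK' : (0 : ℝ) < K := Nat.cast_pos.2 hK
  have h1 : ∀ j < N, |ζ j| ≤ 1 := fun j hj => by
    rw [← sq_le_one_iff_abs_le_one]
    exact (Finset.single_le_sum (f := fun j => ζ j ^ 2) (fun _ _ => sq_nonneg _)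
      (Finset.mem_range.2 hj)).trans hζ
  refine ⟨fun j => roundToZero K (ζ j), ?_, ?_, fun j hj => ?_⟩
  · refine Fintype.mem_piFinset.2 fun j => ?_
    have h2 := (abs_roundToZero_div_le hK (ζ j)).1.trans (h1 j j.2)
    rw [abs_div, abs_of_pos hK', div_le_one hK', abs_le] at h2
    exact Finset.mem_Icc.2 ⟨by exact_mod_cast h2.1, by exact_mod_cast h2.2⟩
  · refine (Finset.sum_le_sum fun j hj => ?_).trans hζ
    rw [gridPoint, dif_pos (Finset.mem_range.1 hj)]
    exact sq_le_sq.2 (abs_roundToZero_div_le hK (ζ j)).1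
  · rw [gridPoint, dif_pos hj]
    exact ⟨(abs_roundToZero_div_le hK (ζ j)).1.trans (h1 j hj), (abs_roundToZero_div_le hK (ζ j)).2⟩

lemma abs_prod_sub_prod_le {ι : Type*} (S : Finset ι) {f g : ι → ℝ} {ε : ℝ}
    (hf : ∀ j ∈ S, |f j| ≤ 1) (hg : ∀ j ∈ S, |g j| ≤ 1) (hfg : ∀ j ∈ S, |f j - g j| ≤ ε) :
    |∏ j ∈ S, f j - ∏ j ∈ S, g j| ≤ S.card * ε := by
  classical
  induction S using Finset.induction_on with
  | empty => simp
  | insert a S ha ih =>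
    have ih := ih (fun j hj => hf j (Finset.mem_insert_of_mem hj))
      (fun j hj => hg j (Finset.mem_insert_of_mem hj))
      fun j hj => hfg j (Finset.mem_insert_of_mem hj)
    rw [Finset.prod_insert ha, Finset.prod_insert ha, Finset.card_insert_of_notMem ha]
    have e : f a * ∏ j ∈ S, f j - g a * ∏ j ∈ S, g j
        = f a * (∏ j ∈ S, f j - ∏ j ∈ S, g j) + (f a - g a) * ∏ j ∈ S, g j := by ring
    rw [e]
    refine (abs_add_le _ _).trans ?_
    rw [abs_mul, abs_mul, Finset.abs_prod]
    have h1 : ∏ j ∈ S, |g j| ≤ 1 := Finset.prod_le_one (fun _ _ => abs_nonneg _)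
      fun j hj => hg j (Finset.mem_insert_of_mem hj)
    have h2 := mul_le_of_le_one_left (abs_nonneg (∏ j ∈ S, f j - ∏ j ∈ S, g j))
      (hf a (Finset.mem_insert_self _ _))
    have h3 := mul_le_of_le_one_right (abs_nonneg (f a - g a)) h1
    have h4 := hfg a (Finset.mem_insert_self _ _)
    push_cast
    linarith

variable {m : ℕ} [NeZero m] {θ : unitInterval} {A : ℝ} {k N : ℕ} {x : ZMod m → ℝ} {ζ : ℕ → ℝ}

/-- Each coefficient is a full cyclic average minus a wrapped one, and both are covered by an
`EntryControl`. -/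
lemma innerChaos_eq (hN1 : 1 ≤ N) (hN : N ≤ m) (ζ : ℕ → ℝ) (x : ZMod m → ℝ) :
    innerChaos N ζ x = ∑ S ∈ Finset.powersetCard 4 (Finset.range N), (∏ j ∈ S, ζ j) *
      (∑ i, ∏ j ∈ S, x (i + (j : ZMod m)) - ∑ i ∈ wrapSet m N, ∏ j ∈ S, x (i + (j : ZMod m))) := by
  have h := sum_zmod_eq_add_wrapSet hN1 hN
    fun i => elemSym 4 (fun j => x (i + (j : ZMod m)) * ζ j) N
  rw [innerChaos, eq_sub_of_add_eq h.symm, sum_elemSym_windows, sum_elemSym_windows,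
    ← Finset.sum_sub_distrib]
  simp_rw [mul_sub]

/-- `innerChaos` is Lipschitz on the unit cube. -/
lemma abs_innerChaos_sub_le (hN1 : 1 ≤ N) (hN : N ≤ m) (hN2 : N ≤ 2 * k)
    (h : EntryControl θ A k N 4 Finset.univ (fullScale m θ) x)
    (hw : EntryControl θ A k N 4 (wrapSet m N) (fun _ => √(2 * k)) x) (hA : 0 ≤ A * slack k)
    {ζ ζ' : ℕ → ℝ} {ε : ℝ} (hε : 0 ≤ ε) (hf : ∀ j < N, |ζ j| ≤ 1) (hg : ∀ j < N, |ζ' j| ≤ 1)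
    (hfg : ∀ j < N, |ζ j - ζ' j| ≤ ε) :
    |innerChaos N ζ x - innerChaos N ζ' x|
      ≤ A * slack k * (√m * θ ^ 2 + √(2 * k)) * (64 * k ^ 4 * ε) := by
  have hθ0 := θ.2.1
  rw [innerChaos_eq hN1 hN, innerChaos_eq hN1 hN, ← Finset.sum_sub_distrib]
  have hfull : fullScale m θ 4 = √m * θ ^ 2 := by
    rw [fullScale, min_self, Real.sqrt_mul (by positivity),
      show (θ : ℝ) ^ 4 = (θ ^ 2) ^ 2 by ring, Real.sqrt_sq (by positivity)]
  have hent : ∀ S ∈ Finset.powersetCard 4 (Finset.range N),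
      |(∏ j ∈ S, ζ j) * (∑ i, ∏ j ∈ S, x (i + (j : ZMod m))
          - ∑ i ∈ wrapSet m N, ∏ j ∈ S, x (i + (j : ZMod m)))
        - (∏ j ∈ S, ζ' j) * (∑ i, ∏ j ∈ S, x (i + (j : ZMod m))
          - ∑ i ∈ wrapSet m N, ∏ j ∈ S, x (i + (j : ZMod m)))|
      ≤ 4 * ε * (A * slack k * (√m * θ ^ 2 + √(2 * k))) := by
    intro S hS
    have hS' := Finset.mem_powersetCard.1 hS
    have hlt : ∀ j ∈ S, j < N := fun j hj => Finset.mem_range.1 (hS'.1 hj)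
    rw [← sub_mul, abs_mul]
    have h1 := abs_prod_sub_prod_le S (fun j hj => hf j (hlt j hj)) (fun j hj => hg j (hlt j hj))
      (fun j hj => hfg j (hlt j hj))
    rw [hS'.2] at h1
    have h2 := abs_sum_prod_four_le hN h hS
    have h3 := abs_sum_prod_four_le hN hw hS
    rw [hfull] at h2
    refine mul_le_mul h1 ((abs_sub _ _).trans ?_) (abs_nonneg _) (by positivity)
    rw [mul_add]
    exact add_le_add h2 h3
  refine (Finset.abs_sum_le_sum_abs _ _).trans ((Finset.sum_le_sum hent).trans ?_)
  rw [Finset.sum_const, nsmul_eq_mul, Finset.card_powersetCard, Finset.card_range]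
  have hc : (N.choose 4 : ℝ) ≤ 16 * k ^ 4 := by
    have : N.choose 4 ≤ (2 * k) ^ 4 := (Nat.choose_le_pow N 4).trans (Nat.pow_le_pow_left hN2 4)
    calc (N.choose 4 : ℝ) ≤ ((2 * k) ^ 4 : ℕ) := by exact_mod_cast this
      _ = _ := by push_cast; ring
  calc (N.choose 4 : ℝ) * (4 * ε * (A * slack k * (√m * θ ^ 2 + √(2 * k))))
      ≤ 16 * k ^ 4 * (4 * ε * (A * slack k * (√m * θ ^ 2 + √(2 * k)))) := by gcongr
    _ = _ := by ring

/-- The deviation of `innerChaos` on the grid. -/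
noncomputable def chaosDeviation (m : ℕ) (θ A : ℝ) (k : ℕ) : ℝ :=
  √(2 * chaosVariance m θ A k * (448 * k * slack k))

/-- The uniform bound of `innerChaos` on the grid of spacing `1 / k ^ 3`. -/
def ChaosControl (θ A : ℝ) (k N : ℕ) (x : ZMod m → ℝ) : Prop :=
  ∀ p ∈ Fintype.piFinset fun _ : Fin N => Finset.Icc (-((k ^ 3 : ℕ) : ℤ)) ((k ^ 3 : ℕ) : ℤ),
    ∑ j ∈ Finset.range N, gridPoint (k ^ 3) p j ^ 2 ≤ 1 →
      |innerChaos N (gridPoint (k ^ 3) p) x| ≤ chaosDeviation m θ A k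

lemma log_natCast_le_slack (hk : 1 ≤ k) : Real.log k ≤ 16 * slack k := by
  have h1 := one_le_slack hk
  rw [← slack_pow k, Real.log_pow]
  push_cast
  have := Real.log_le_self (x := slack k) (by linarith)
  linarith

/-- The grid has at most `(2k³ + 1)^N ≤ k^(8k)` points, the step `2k³ + 1 ≤ k⁴` using `k ≥ 3`. The
exponent in the Freedman bound is chosen to beat this entropy. -/
lemma measure_not_chaosControl_le (hk : 3 ≤ k) (hN : N ≤ m) (hN2 : N ≤ 2 * k)
    (hθk : 1 ≤ θ * (k : ℝ)) (hA : 0 ≤ A * slack k) :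
    (signalLaw m θ).real {x : ZMod m → ℝ | ¬ ChaosControl θ A k N x ∧
      EntryControl θ A k N 6 Finset.univ (fullScale m θ) x} ≤ 2 * ((k : ℝ) ^ 20)⁻¹ := by
  classical
  set G := Fintype.piFinset fun _ : Fin N => Finset.Icc (-((k ^ 3 : ℕ) : ℤ)) ((k ^ 3 : ℕ) : ℤ)
  -- Here `448 = 28 * 16`: `8k log k` pays for the grid, `20 log k` for the probability `k⁻²⁰`, and
  -- `log k ≤ 16 * slack k`.
  set u : ℝ := 448 * k * slack k with hu
  have hsl := one_le_slack (show 1 ≤ k by omega)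
  have hk3 : (3 : ℝ) ≤ k := by exact_mod_cast hk
  have hu0 : 0 < u := by positivity
  have hsub : {x : ZMod m → ℝ | ¬ ChaosControl θ A k N x ∧ EntryControl θ A k N 6 Finset.univ (fullScale m θ) x}
      ⊆ ⋃ p ∈ G, {x : ZMod m → ℝ | (∑ j ∈ Finset.range N, gridPoint (k ^ 3) p j ^ 2 ≤ 1) ∧
        chaosDeviation m θ A k < |innerChaos N (gridPoint (k ^ 3) p) x| ∧
        EntryControl θ A k N 6 Finset.univ (fullScale m θ) x} := by
    intro x hx
    obtain ⟨h1, h2⟩ := hx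
    unfold ChaosControl at h1
    push Not at h1
    obtain ⟨p, hp, hp1, hp2⟩ := h1
    exact Set.mem_biUnion hp ⟨hp1, hp2, h2⟩
  have hcard : (G.card : ℝ) ≤ Real.exp (8 * k * Real.log k) := by
    have e : G.card = (2 * k ^ 3 + 1) ^ N := by
      simp only [G, Fintype.card_piFinset, Int.card_Icc, Finset.prod_const, Finset.card_univ,
        Fintype.card_fin]
      congr 1
      omega
    have h1 : (2 * k ^ 3 + 1) ^ N ≤ (k ^ 4) ^ (2 * k) := by
      have : 2 * k ^ 3 + 1 ≤ k ^ 4 := by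
        have : 1 ≤ k ^ 3 := Nat.one_le_pow _ _ (by omega)
        calc 2 * k ^ 3 + 1 ≤ 3 * k ^ 3 := by omega
          _ ≤ k * k ^ 3 := by gcongr
          _ = k ^ 4 := by ring
      exact (Nat.pow_le_pow_left this N).trans
        (Nat.pow_le_pow_right (Nat.pow_pos (by omega)) hN2)
    calc (G.card : ℝ) ≤ (((k ^ 4) ^ (2 * k) : ℕ) : ℝ) := by rw [e]; exact_mod_cast h1
      _ = Real.exp (8 * k * Real.log k) := by
        have : (8 * k * Real.log k : ℝ) = ((4 * (2 * k) : ℕ) : ℝ) * Real.log k := by push_cast; ring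
        rw [this, Real.exp_nat_mul, Real.exp_log (by linarith), ← pow_mul]
        push_cast; rfl
  refine (measureReal_mono hsub (measure_ne_top _ _)).trans ((measureReal_biUnion_finset_le _ _).trans ?_)
  have hterm : ∀ p ∈ G, (signalLaw m θ).real
      {x : ZMod m → ℝ | (∑ j ∈ Finset.range N, gridPoint (k ^ 3) p j ^ 2 ≤ 1) ∧
        chaosDeviation m θ A k < |innerChaos N (gridPoint (k ^ 3) p) x| ∧
        EntryControl θ A k N 6 Finset.univ (fullScale m θ) x} ≤ 2 * Real.exp (-u) := by
    intro p _
    by_cases hp : ∑ j ∈ Finset.range N, gridPoint (k ^ 3) p j ^ 2 ≤ 1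
    · simp only [hp, true_and]
      exact measure_innerChaos_le hN hN2 hθk hA hp hu0
    · simp only [hp, false_and, Set.ofPred_false, measureReal_empty]
      positivity
  refine (Finset.sum_le_sum hterm).trans ?_
  rw [Finset.sum_const, nsmul_eq_mul]
  have hlog := log_natCast_le_slack (show 1 ≤ k by omega)
  have hlog0 : 0 ≤ Real.log k := Real.log_nonneg (by linarith)
  calc (G.card : ℝ) * (2 * Real.exp (-u))
      ≤ Real.exp (8 * k * Real.log k) * (2 * Real.exp (-u)) := by gcongr
    _ = 2 * Real.exp (8 * k * Real.log k - u) := by rw [Real.exp_sub, Real.exp_neg]; ring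
    _ ≤ 2 * Real.exp (-(20 * Real.log k)) := by
      gcongr
      have : 28 * k * Real.log k ≤ 28 * k * (16 * slack k) := by gcongr
      have : 20 * Real.log k ≤ 20 * k * Real.log k := by
        have := mul_le_mul_of_nonneg_right (show (1 : ℝ) ≤ k by linarith) hlog0
        linarith
      rw [hu]; linarith
    _ = 2 * ((k : ℝ) ^ 20)⁻¹ := by
      rw [Real.exp_neg, show (20 : ℝ) * Real.log k = ((20 : ℕ) : ℝ) * Real.log k by norm_num,
        Real.exp_nat_mul, Real.exp_log (by linarith)]

/-! ### Uniform control of the second and fourth window moments. -/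

section

variable {m : ℕ} [NeZero m] {θ : unitInterval} {A : ℝ} {k N : ℕ} {x : ZMod m → ℝ} {ζ : ℕ → ℝ}

/-- The empirical second and fourth moments of the windows are within `B` of their means,
uniformly over all coefficient vectors. -/
def WindowMomentControl (N : ℕ) (θ B : ℝ) (x : ZMod m → ℝ) : Prop :=
  ∀ ζ : ℕ → ℝ,
    |∑ i, windowInner N ζ x i ^ 2 - m * (θ * ∑ j ∈ Finset.range N, ζ j ^ 2)|
      ≤ B * ∑ j ∈ Finset.range N, ζ j ^ 2 ∧
    |∑ i, windowInner N ζ x i ^ 4 - m * fourthMoment N θ ζ|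
      ≤ B * (∑ j ∈ Finset.range N, ζ j ^ 2) ^ 2

omit [NeZero m] in
lemma windowInner_smul (c : ℝ) (ζ : ℕ → ℝ) (x : ZMod m → ℝ) (i : ZMod m) :
    windowInner N (fun j => c * ζ j) x i = c * windowInner N ζ x i := by
  simp only [windowInner, Finset.mul_sum]
  exact Finset.sum_congr rfl fun _ _ => by ring

/-- Both deviations are homogeneous in `ζ`, of degrees two and four; the zero vector is treated
apart since it cannot be normalised. -/
lemma windowMomentControl_of_unit {θ B : ℝ} {x : ZMod m → ℝ}
    (h : ∀ ζ : ℕ → ℝ, ∑ j ∈ Finset.range N, ζ j ^ 2 ≤ 1 →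
      |∑ i, windowInner N ζ x i ^ 2 - m * (θ * ∑ j ∈ Finset.range N, ζ j ^ 2)| ≤ B ∧
      |∑ i, windowInner N ζ x i ^ 4 - m * fourthMoment N θ ζ| ≤ B) :
    WindowMomentControl N θ B x := by
  intro ζ
  set s := ∑ j ∈ Finset.range N, ζ j ^ 2 with hs
  have hs0 : 0 ≤ s := Finset.sum_nonneg fun _ _ => sq_nonneg _
  rcases hs0.eq_or_lt with h0 | hpos
  · have hz : ∀ j ∈ Finset.range N, ζ j = 0 := fun j hj => by
      have := (Finset.sum_eq_zero_iff_of_nonneg fun _ _ => sq_nonneg _).1 (hs.symm.trans h0.symm) j hj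
      exact pow_eq_zero_iff (two_ne_zero) |>.1 this
    have hw : ∀ i, windowInner N ζ x i = 0 := fun i =>
      Finset.sum_eq_zero fun j hj => by rw [hz j hj, mul_zero]
    have h4 : ∑ j ∈ Finset.range N, ζ j ^ 4 = 0 :=
      Finset.sum_eq_zero fun j hj => by rw [hz j hj]; norm_num
    simp [hw, fourthMoment, h4, ← hs, ← h0]
  · set c := (√s)⁻¹ with hc
    have hc2 : c ^ 2 * s = 1 := by
      rw [hc, inv_pow, Real.sq_sqrt hs0, inv_mul_cancel₀ hpos.ne']
    have hcs : ∑ j ∈ Finset.range N, (c * ζ j) ^ 2 = c ^ 2 * s := by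
      simp only [mul_pow, ← Finset.mul_sum, hs]
    obtain ⟨h2, h4⟩ := h (fun j => c * ζ j) (by rw [hcs, hc2])
    simp only [windowInner_smul, fourthMoment, mul_pow, ← Finset.mul_sum] at h2 h4
    rw [← hs] at *
    have e2 : c ^ 2 * ∑ i, windowInner N ζ x i ^ 2 - m * (θ * (c ^ 2 * s))
        = c ^ 2 * (∑ i, windowInner N ζ x i ^ 2 - m * (θ * s)) := by ring
    have e4 : c ^ 4 * ∑ i, windowInner N ζ x i ^ 4
          - m * (3 * θ * (1 - θ) * (c ^ 4 * ∑ j ∈ Finset.range N, ζ j ^ 4)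
            + 3 * θ ^ 2 * ((c ^ 2) ^ 2 * s ^ 2))
        = c ^ 4 * (∑ i, windowInner N ζ x i ^ 4 - m * fourthMoment N θ ζ) := by
      rw [fourthMoment, ← hs]; ring
    rw [e2, abs_mul, abs_of_nonneg (sq_nonneg c)] at h2
    rw [e4, abs_mul, abs_of_nonneg (by positivity)] at h4
    constructor
    · calc _ = s * (c ^ 2 * |∑ i, windowInner N ζ x i ^ 2 - m * (θ * s)|) := by
            linear_combination (-|∑ i, windowInner N ζ x i ^ 2 - m * (θ * s)|) * hc2
        _ ≤ s * B := by gcongr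
        _ = _ := mul_comm _ _
    · calc _ = s ^ 2 * (c ^ 4 * |∑ i, windowInner N ζ x i ^ 4 - m * fourthMoment N θ ζ|) := by
            rw [← mul_assoc, show s ^ 2 * c ^ 4 = (c ^ 2 * s) ^ 2 by ring, hc2]; ring
        _ ≤ s ^ 2 * B := by gcongr
        _ = _ := mul_comm _ _

/-- The three terms are the value at a grid point, the Lipschitz error at spacing `1 / k³` (so `64
k⁴` becomes `64 k`), and the wrapped windows bounded entrywise with `‖ζ‖₁⁴ ≤ 4k²`. -/
lemma abs_sum_elemSym_four_le (hk : 1 ≤ k) (hN1 : 1 ≤ N) (hN : N ≤ m) (hN2 : N ≤ 2 * k)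
    (h : EntryControl θ A k N 4 Finset.univ (fullScale m θ) x)
    (hw : EntryControl θ A k N 4 (wrapSet m N) (fun _ => √(2 * k)) x)
    (hc : ChaosControl θ A k N x) (hA : 0 ≤ A * slack k)
    (hζ : ∑ j ∈ Finset.range N, ζ j ^ 2 ≤ 1) :
    |∑ i, elemSym 4 (fun j => x (i + (j : ZMod m)) * ζ j) N|
      ≤ chaosDeviation m θ A k + A * slack k * (√m * θ ^ 2 + √(2 * k)) * (64 * k)
        + A * slack k * √(2 * k) * (4 * k ^ 2) := by
  have hk0 : (0 : ℝ) < k := Nat.cast_pos.2 hk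
  obtain ⟨p, hp, hp1, hp2⟩ := exists_gridPoint (K := k ^ 3) (by positivity) hζ
  have h1 : ∀ j < N, |ζ j| ≤ 1 := fun j hj => by
    rw [← sq_le_one_iff_abs_le_one]
    exact (Finset.single_le_sum (f := fun j => ζ j ^ 2) (fun _ _ => sq_nonneg _)
      (Finset.mem_range.2 hj)).trans hζ
  have ha := hc p hp hp1
  have hb := abs_innerChaos_sub_le hN1 hN hN2 h hw hA (by positivity) h1
    (fun j hj => (hp2 j hj).1) fun j hj => (hp2 j hj).2
  have hd := abs_sum_elemSym_windows_le (ζ := ζ) (wrapSet m N) (r := 4) (n := N)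
    (by positivity) fun S hS => abs_sum_prod_four_le hN hw hS
  have he : (∑ j ∈ Finset.range N, |ζ j|) ^ 4 ≤ 4 * (k : ℝ) ^ 2 := by
    calc (∑ j ∈ Finset.range N, |ζ j|) ^ 4 = ((∑ j ∈ Finset.range N, |ζ j|) ^ 2) ^ 2 := by ring
      _ ≤ (2 * (k : ℝ)) ^ 2 := pow_le_pow_left₀ (sq_nonneg _) (sum_abs_sq_le hN2 hζ) 2
      _ = 4 * (k : ℝ) ^ 2 := by ring
  have hd' := hd.trans (mul_le_mul_of_nonneg_left he (by positivity))
  have hkk : (64 * (k : ℝ) ^ 4 * (1 / ((k ^ 3 : ℕ) : ℝ))) = 64 * k := by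
    push_cast; field_simp
  rw [hkk] at hb
  rw [sum_zmod_eq_add_wrapSet hN1 hN]
  change |innerChaos N ζ x + _| ≤ _
  refine (abs_add_le _ _).trans (add_le_add ?_ hd')
  calc |innerChaos N ζ x|
      = |innerChaos N (gridPoint (k ^ 3) p) x
        + (innerChaos N ζ x - innerChaos N (gridPoint (k ^ 3) p) x)| := by congr 1; ring
    _ ≤ _ := (abs_add_le _ _).trans (add_le_add ha hb)

/-- The relative deviation of the empirical fourth moments, up to constants and a factor
`√m * θ`. -/
noncomputable def deviationScale (m k : ℕ) : ℝ :=
  k * slack k ^ 2 + k ^ 2 * √k * slack k / √(√m)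

lemma chaosDeviation_le (hA : 1 ≤ A) (hk : 1 ≤ k) :
    chaosDeviation m θ A k
      ≤ (127 * A + 43 * gaussMomentBound 6 ^ 6) * (√m * θ) * deviationScale m k := by
  have hθ0 := θ.2.1
  have hm : (0 : ℝ) < m := Nat.cast_pos.2 (NeZero.pos m)
  have hk0 : (1 : ℝ) ≤ k := by exact_mod_cast hk
  have hsl := one_le_slack hk
  have hG := one_le_gaussMomentBound 6
  have hG6 : 1 ≤ gaussMomentBound 6 ^ 6 := one_le_pow₀ hG
  set r := √(√m) with hr
  have hr0 : 0 < r := by positivity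
  have hr2 : √m = r ^ 2 := (Real.sq_sqrt (by positivity)).symm
  have hm4 : (m : ℝ) = r ^ 4 := by
    rw [show r ^ 4 = (r ^ 2) ^ 2 by ring, ← hr2, Real.sq_sqrt hm.le]
  set κ := √(k : ℝ) with hκ
  have hκ2 : (k : ℝ) = κ ^ 2 := (Real.sq_sqrt (by positivity)).symm
  have hκ0 : 0 ≤ κ := by positivity
  set t := slack k
  set G := gaussMomentBound 6 ^ 6
  unfold chaosDeviation chaosVariance deviationScale
  rw [Real.sqrt_le_iff]
  refine ⟨by positivity, ?_⟩
  rw [← hr, ← hκ, hr2, hm4, hκ2]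
  have hAA : A ≤ A ^ 2 := le_self_pow₀ hA two_ne_zero
  have hGG : G ≤ G ^ 2 := le_self_pow₀ hG6 two_ne_zero
  have htt : t ≤ t ^ 4 := le_self_pow₀ hsl (by norm_num)
  have e : (127 * A + 43 * G) * (r ^ 2 * θ) * (κ ^ 2 * t ^ 2 + (κ ^ 2) ^ 2 * κ * t / r)
      = (127 * A + 43 * G) * (r ^ 2 * θ * κ ^ 2 * t ^ 2) + (127 * A + 43 * G) * (r * θ * κ ^ 5 * t) := by
    field_simp
  rw [e]
  have p1 : 0 ≤ r ^ 2 * θ * κ ^ 2 * t ^ 2 := by positivity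
  have p2 : 0 ≤ r * θ * κ ^ 5 * t := by positivity
  have q1 : (43 * G) * (r ^ 2 * θ * κ ^ 2 * t ^ 2) ≤ (127 * A + 43 * G) * (r ^ 2 * θ * κ ^ 2 * t ^ 2) := by
    gcongr; linarith
  have q2 : (127 * A) * (r * θ * κ ^ 5 * t) ≤ (127 * A + 43 * G) * (r * θ * κ ^ 5 * t) := by
    gcongr; linarith
  -- `16128 = 4 * 448 * 9 ≤ 127²` and `1792 = 4 * 448 ≤ 43²`. Here `r` is the fourth root of `m` and
  -- `κ` is `√k`.
  calc _ = 16128 * A * (r * θ * κ ^ 5 * t) ^ 2 + 1792 * G * (r ^ 2 * θ * κ ^ 2) ^ 2 * t := by ring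
    _ ≤ 16128 * A ^ 2 * (r * θ * κ ^ 5 * t) ^ 2 + 1792 * G ^ 2 * (r ^ 2 * θ * κ ^ 2) ^ 2 * t ^ 4 := by
      gcongr
    _ ≤ ((43 * G) * (r ^ 2 * θ * κ ^ 2 * t ^ 2)) ^ 2 + ((127 * A) * (r * θ * κ ^ 5 * t)) ^ 2 := by
      have a1 : 0 ≤ A ^ 2 * (r * θ * κ ^ 5 * t) ^ 2 := by positivity
      have a2 : 0 ≤ G ^ 2 * (r ^ 2 * θ * κ ^ 2) ^ 2 * t ^ 4 := by positivity
      linarith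
    _ ≤ _ := by
      refine le_trans ?_ (pow_le_pow_left₀ (by positivity) (add_le_add q1 q2) 2)
      have : 0 ≤ (43 * G) * (r ^ 2 * θ * κ ^ 2 * t ^ 2) * ((127 * A) * (r * θ * κ ^ 5 * t)) := by
        positivity
      linarith

lemma windowMomentControl_of_controls (hA : 1 ≤ A) (hk : 1 ≤ k) (hN1 : 1 ≤ N) (hN : N ≤ m)
    (hN2 : N ≤ 2 * k) (hθk : 1 ≤ θ * (k : ℝ)) (hkm : k ^ 4 ≤ m)
    (h2 : EntryControl θ A k N 2 Finset.univ (fullScale m θ) x)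
    (h4 : EntryControl θ A k N 4 Finset.univ (fullScale m θ) x)
    (hw : EntryControl θ A k N 4 (wrapSet m N) (fun _ => √(2 * k)) x)
    (hc : ChaosControl θ A k N x) :
    WindowMomentControl N θ
      ((10000 * A + 1032 * gaussMomentBound 6 ^ 6) * (√m * θ) * deviationScale m k) x := by
  have hθ0 := θ.2.1
  have hθ1 := θ.2.2
  have hm : (0 : ℝ) < m := Nat.cast_pos.2 (NeZero.pos m)
  have hk0 : (1 : ℝ) ≤ k := by exact_mod_cast hk
  have hsl := one_le_slack hk
  have hG6 : 1 ≤ gaussMomentBound 6 ^ 6 := one_le_pow₀ (one_le_gaussMomentBound 6)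
  have hA0 : 0 ≤ A * slack k := by positivity
  have hch := chaosDeviation_le (m := m) (θ := θ) hA hk
  set t := slack k
  set G := gaussMomentBound 6 ^ 6
  have hD : √m * θ * deviationScale m k
      = √m * θ * k * t ^ 2 + θ * √(√m) * (k ^ 2 * √k * t) := by
    have hr0 : 0 < √(√(m : ℝ)) := by positivity
    have hr2 : √(m : ℝ) = √(√m) ^ 2 := (Real.sq_sqrt (by positivity)).symm
    unfold deviationScale
    rw [mul_add, show √(m : ℝ) * θ * (k ^ 2 * √k * t / √(√m))
      = (√m / √(√m)) * θ * (k ^ 2 * √k * t) by ring]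
    have : √(m : ℝ) / √(√m) = √(√m) := by
      rw [div_eq_iff hr0.ne', ← sq, ← hr2]
    rw [this]
    ring
  -- From `k⁴ ≤ m` and `1 ≤ θk`; it absorbs the error terms that carry no power of `m`.
  have hr : 1 ≤ θ * √(√(m : ℝ)) := by
    have : (k : ℝ) ≤ √(√(m : ℝ)) := by
      refine Real.le_sqrt_of_sq_le (Real.le_sqrt_of_sq_le ?_)
      calc ((k : ℝ) ^ 2) ^ 2 = ((k ^ 4 : ℕ) : ℝ) := by push_cast; ring
        _ ≤ m := by exact_mod_cast hkm
    exact hθk.trans (mul_le_mul_of_nonneg_left this hθ0)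
  set P := √m * θ * k * t ^ 2 with hP
  set Q := θ * √(√m) * (k ^ 2 * √k * t) with hQ
  have hP0 : 0 ≤ P := by positivity
  have hQ0 : 0 ≤ Q := by positivity
  have t1 : t * (√m * θ * k) ≤ P := by
    have : t ≤ t ^ 2 := le_self_pow₀ hsl two_ne_zero
    calc t * (√m * θ * k) ≤ t ^ 2 * (√m * θ * k) := by gcongr
      _ = P := by rw [hP]; ring
  have t2 : t * (k ^ 2 * √k) ≤ Q := by
    calc t * (k ^ 2 * √k) ≤ (θ * √(√m)) * (t * (k ^ 2 * √k)) := le_mul_of_one_le_left (by positivity) hr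
      _ = Q := by rw [hQ]; ring
  have hs2 : √(2 * (k : ℝ)) ≤ 2 * √k := by
    refine Real.sqrt_le_iff.2 ⟨by positivity, ?_⟩
    rw [mul_pow, Real.sq_sqrt (by positivity)]; linarith
  refine windowMomentControl_of_unit fun ζ hζ => ⟨?_, ?_⟩
  · refine (abs_sum_windowInner_sq_sub_le hN hN2 hθk h2 hA0 hζ).trans ?_
    rw [mul_assoc (10000 * A + 1032 * G), hD]
    calc A * t * √m * (3 * (θ * k)) = 3 * A * (t * (√m * θ * k)) := by ring
      _ ≤ 3 * A * P := by gcongr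
      _ ≤ (10000 * A + 1032 * G) * (P + Q) := by
        refine mul_le_mul (by linarith) (by linarith) hP0 (by positivity)
  · have hlow := abs_sum_windowInner_pow_four_sub_le hN hN2 hθk h4 hA0 hζ
    have he := abs_sum_elemSym_four_le hk hN1 hN hN2 h4 hw hc hA0 hζ
    set X := ∑ i, windowInner N ζ x i ^ 4 - m * fourthMoment N θ ζ
    set E := ∑ i, elemSym 4 (fun j => x (i + (j : ZMod m)) * ζ j) N
    have hX : |X| ≤ |X - 24 * E| + 24 * |E| := by
      calc |X| = |(X - 24 * E) + 24 * E| := by congr 1; ring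
        _ ≤ _ := (abs_add_le _ _).trans (by rw [abs_mul]; norm_num)
    rw [mul_assoc (127 * A + 43 * G), hD] at hch
    rw [mul_assoc (10000 * A + 1032 * G), hD]
    have b1 : A * t * √m * (69 * (θ * k)) ≤ 69 * A * P := by
      calc _ = 69 * A * (t * (√m * θ * k)) := by ring
        _ ≤ _ := by gcongr
    have b2 : A * t * (√m * θ ^ 2 + √(2 * k)) * (64 * k) ≤ 64 * A * P + 128 * A * Q := by
      have c1 : (θ : ℝ) ^ 2 ≤ θ := by nlinarith
      have c2 : (k : ℝ) ≤ k ^ 2 := le_self_pow₀ hk0 two_ne_zero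
      calc A * t * (√m * θ ^ 2 + √(2 * k)) * (64 * k)
          ≤ A * t * (√m * θ + 2 * √k) * (64 * k) := by gcongr
        _ = 64 * A * (t * (√m * θ * k)) + 128 * A * (t * (k * √k)) := by ring
        _ ≤ 64 * A * (t * (√m * θ * k)) + 128 * A * (t * (k ^ 2 * √k)) := by gcongr
        _ ≤ _ := by gcongr
    have b3 : A * t * √(2 * k) * (4 * k ^ 2) ≤ 8 * A * Q := by
      calc A * t * √(2 * k) * (4 * k ^ 2) ≤ A * t * (2 * √k) * (4 * k ^ 2) := by gcongr
        _ = 8 * A * (t * (k ^ 2 * √k)) := by ring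
        _ ≤ _ := by gcongr
    -- The coefficients needed are `69 + 24(127 + 64)` for `A * P`, `24(127 + 128 + 8)` for `A * Q`,
    -- both below `10000`, and `24 * 43 = 1032` for `G`.
    have a1 : 0 ≤ A * P := by positivity
    have a2 : 0 ≤ A * Q := by positivity
    have a3 : 0 ≤ G * P := by positivity
    have a4 : 0 ≤ G * Q := by positivity
    linarith

end

/-- With high probability the empirical second and fourth moments are uniformly close to their
means. -/
theorem exists_measure_not_windowMomentControl_le : ∃ C₁ : ℝ, 0 < C₁ ∧
    ∀ (m : ℕ) [NeZero m] (θ : unitInterval) (k N : ℕ), 3 ≤ k → 1 ≤ N → N ≤ m → N ≤ 2 * k →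
      1 ≤ θ * (k : ℝ) → k ^ 4 ≤ m →
      (signalLaw m θ).real
        {x | ¬ WindowMomentControl N θ (C₁ * (√m * θ) * deviationScale m k) x}
        ≤ 48 * ((k : ℝ) ^ 7)⁻¹ := by
  obtain ⟨A₂, hA₂, h₂⟩ := exists_measure_not_entryControl_le 2
  obtain ⟨A₄, hA₄, h₄⟩ := exists_measure_not_entryControl_le 4
  obtain ⟨A₆, hA₆, h₆⟩ := exists_measure_not_entryControl_le 6
  have hG6 : 1 ≤ gaussMomentBound 6 ^ 6 := one_le_pow₀ (one_le_gaussMomentBound 6)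
  set A := A₂ + A₄ + A₆ with hAdef
  have hA : 1 ≤ A := by linarith
  refine ⟨10000 * A + 1032 * gaussMomentBound 6 ^ 6, by positivity, ?_⟩
  intro m _ θ k N hk hN1 hN hN2 hθk hkm
  have hθ0 := θ.2.1
  have hθ1 := θ.2.2
  have hk3 : (3 : ℝ) ≤ k := by exact_mod_cast hk
  have hsl := one_le_slack (show 1 ≤ k by omega)
  -- The tail bound needs scales at least `1`. This explains the exponent `min d 4` in `fullScale`:
  -- `mθ⁴ ≥ (kθ)⁴ ≥ 1`, while higher powers of `θ` could be too small.
  have hσ1 : ∀ d, 1 ≤ fullScale m θ d := fun d => by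
    refine Real.one_le_sqrt.2 ?_
    calc (1 : ℝ) ≤ (θ * k) ^ 4 := one_le_pow₀ hθk
      _ = ((k ^ 4 : ℕ) : ℝ) * θ ^ 4 := by push_cast; ring
      _ ≤ m * θ ^ 4 := by gcongr
      _ ≤ m * θ ^ min d 4 := by
        gcongr ?_ * ?_
        exact pow_le_pow_of_le_one hθ0 hθ1 (min_le_right d 4)
  have hσ2 : ∀ d, ((Finset.univ : Finset (ZMod m)).card : ℝ) * (θ : ℝ) ^ d ≤ fullScale m θ d ^ 2 :=
    fun d => by
    rw [fullScale, Real.sq_sqrt (by positivity), Finset.card_univ, ZMod.card]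
    gcongr ?_ * ?_
    exact pow_le_pow_of_le_one hθ0 hθ1 (min_le_left d 4)
  have hw1 : 1 ≤ √(2 * (k : ℝ)) := Real.one_le_sqrt.2 (by linarith)
  have hw2 : ∀ d, ((wrapSet m N).card : ℝ) * (θ : ℝ) ^ d ≤ √(2 * (k : ℝ)) ^ 2 := fun d => by
    rw [Real.sq_sqrt (by positivity)]
    have : ((wrapSet m N).card : ℝ) ≤ 2 * k := by exact_mod_cast (card_wrapSet_le m N).trans hN2
    exact (mul_le_of_le_one_right (by positivity) (pow_le_one₀ hθ0 hθ1)).trans this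
  have e2 := h₂ A (by linarith) m θ k N Finset.univ (fullScale m θ) (by omega) hN
    (fun d _ => hσ1 d) fun d _ => hσ2 d
  have e4 := h₄ A (by linarith) m θ k N Finset.univ (fullScale m θ) (by omega) hN
    (fun d _ => hσ1 d) fun d _ => hσ2 d
  have e6 := h₆ A (by linarith) m θ k N Finset.univ (fullScale m θ) (by omega) hN
    (fun d _ => hσ1 d) fun d _ => hσ2 d
  have ew := h₄ A (by linarith) m θ k N (wrapSet m N) (fun _ => √(2 * k)) (by omega) hN
    (fun d _ => hw1) fun d _ => hw2 d
  have ec := measure_not_chaosControl_le (m := m) (A := A) hk hN hN2 hθk (by positivity)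
  have hsub : {x : ZMod m → ℝ | ¬ WindowMomentControl N θ
        ((10000 * A + 1032 * gaussMomentBound 6 ^ 6) * (√m * θ) * deviationScale m k) x}
      ⊆ (({x | ¬ EntryControl θ A k N 2 Finset.univ (fullScale m θ) x}
        ∪ {x | ¬ EntryControl θ A k N 4 Finset.univ (fullScale m θ) x})
        ∪ ({x | ¬ EntryControl θ A k N 6 Finset.univ (fullScale m θ) x}
        ∪ {x | ¬ EntryControl θ A k N 4 (wrapSet m N) (fun _ => √(2 * k)) x}))
        ∪ {x : ZMod m → ℝ | ¬ ChaosControl θ A k N x ∧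
            EntryControl θ A k N 6 Finset.univ (fullScale m θ) x} := by
    intro x hx
    by_contra hcon
    simp only [Set.mem_union, Set.mem_ofPred_eq, not_or, not_and, not_not] at hcon
    obtain ⟨⟨⟨a2, a4⟩, a6, aw⟩, ac⟩ := hcon
    exact hx (windowMomentControl_of_controls hA (by omega) hN1 hN hN2 hθk hkm a2 a4 aw
      (not_not.1 fun h => ac h a6))
  refine (measureReal_mono hsub (measure_ne_top _ _)).trans ?_
  refine (measureReal_union_le _ _).trans ?_
  refine (add_le_add (measureReal_union_le _ _) ec).trans ?_
  refine (add_le_add (add_le_add (measureReal_union_le _ _) (measureReal_union_le _ _))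
    le_rfl).trans ?_
  refine (add_le_add (add_le_add (add_le_add e2 e4) (add_le_add e6 ew)) le_rfl).trans ?_
  have hNk : (N : ℝ) ≤ 2 * k := by exact_mod_cast hN2
  have hk0 : (0 : ℝ) < k := by linarith
  have hpow : ∀ r ≤ 6, (N : ℝ) ^ r ≤ 64 * k ^ 6 := fun r hr => by
    calc (N : ℝ) ^ r ≤ (2 * k) ^ r := by gcongr
      _ ≤ (2 * k) ^ 6 := pow_le_pow_right₀ (by linarith) hr
      _ = _ := by ring
  have hone : (1 : ℝ) ≤ k ^ 6 := one_le_pow₀ (by linarith)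
  -- Four entry events contribute at most `64 k⁶` each and the chaos event `2`, all times `k⁻²⁰`.
  have hfin : (258 : ℝ) ≤ 48 * k ^ 7 := by
    calc (258 : ℝ) ≤ 48 * 3 ^ 7 := by norm_num
      _ ≤ _ := by gcongr
  calc N ^ 2 * ((k : ℝ) ^ 20)⁻¹ + N ^ 4 * ((k : ℝ) ^ 20)⁻¹
        + (N ^ 6 * ((k : ℝ) ^ 20)⁻¹ + N ^ 4 * ((k : ℝ) ^ 20)⁻¹) + 2 * ((k : ℝ) ^ 20)⁻¹
      = ((N : ℝ) ^ 2 + N ^ 4 + (N ^ 6 + N ^ 4) + 2) * ((k : ℝ) ^ 20)⁻¹ := by ring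
    _ ≤ (258 * k ^ 6) * ((k : ℝ) ^ 20)⁻¹ := by
      gcongr
      have := hpow 2 (by norm_num)
      have := hpow 4 (by norm_num)
      have := hpow 6 le_rfl
      linarith
    _ ≤ (48 * k ^ 7 * k ^ 6) * ((k : ℝ) ^ 20)⁻¹ := by gcongr
    _ = 48 * ((k : ℝ) ^ 7)⁻¹ := by field_simp

/-! ### From moments to bilinear and cubic forms by polarization. -/

section Polarization

variable {m : ℕ} {N : ℕ}

/-- The correlations of the signal with the coefficient vector `c`. -/
noncomputable def correlate (x : ZMod m → ℝ) :
    EuclideanSpace ℝ (Fin N) →ₗ[ℝ] (ZMod m → ℝ) where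
  toFun c i := ∑ j : Fin N, x (i + ((j : ℕ) : ZMod m)) * c j
  map_add' c d := by
    ext i; simp [mul_add, Finset.sum_add_distrib]
  map_smul' r c := by
    ext i; simp only [PiLp.smul_apply, smul_eq_mul, RingHom.id_apply, Pi.smul_apply, Finset.mul_sum]
    exact Finset.sum_congr rfl fun _ _ => by ring

variable [NeZero m] {θ B : ℝ} {x : ZMod m → ℝ}

lemma WindowMomentControl.correlate (h : WindowMomentControl N θ B x)
    (c : EuclideanSpace ℝ (Fin N)) :
    |∑ i, correlate x c i ^ 2 - m * (θ * ‖c‖ ^ 2)| ≤ B * ‖c‖ ^ 2 ∧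
    |∑ i, correlate x c i ^ 4 - m * (3 * θ * (1 - θ) * (∑ j, c j ^ 4) + 3 * θ ^ 2 * (‖c‖ ^ 2) ^ 2)|
      ≤ B * (‖c‖ ^ 2) ^ 2 := by
  have h := h fun j => if hj : j < N then c ⟨j, hj⟩ else 0
  have e : ∀ r : ℕ, ∑ j ∈ Finset.range N, (if hj : j < N then c ⟨j, hj⟩ else 0) ^ r
      = ∑ j, c j ^ r := fun r => by
    rw [Finset.sum_range]
    exact Finset.sum_congr rfl fun j _ => by rw [dif_pos j.2]
  have ew : ∀ i, windowInner N (fun j => if hj : j < N then c ⟨j, hj⟩ else 0) x i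
      = SparseBlindDeconv.correlate x c i := fun i => by
    simp only [windowInner, SparseBlindDeconv.correlate, LinearMap.coe_mk, AddHom.coe_mk]
    rw [Finset.sum_range]
    exact Finset.sum_congr rfl fun j _ => by rw [dif_pos j.2]
  simp only [fourthMoment, e, ew] at h
  rwa [EuclideanSpace.real_norm_sq_eq]

lemma WindowMomentControl.abs_sum_mul_sub_le (h : WindowMomentControl N θ B x) (hB : 0 ≤ B)
    {c v : EuclideanSpace ℝ (Fin N)} (hc : ‖c‖ ≤ 2) (hv : ‖v‖ ≤ 2) :
    |∑ i, SparseBlindDeconv.correlate x c i * SparseBlindDeconv.correlate x v i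
      - m * (θ * inner ℝ c v)| ≤ 4 * B := by
  have h1 := (h.correlate (c + v)).1
  have h2 := (h.correlate (c - v)).1
  have e1 : ‖c + v‖ ^ 2 = ‖c‖ ^ 2 + 2 * inner ℝ c v + ‖v‖ ^ 2 := norm_add_sq_real c v
  have e2 : ‖c - v‖ ^ 2 = ‖c‖ ^ 2 - 2 * inner ℝ c v + ‖v‖ ^ 2 := norm_sub_sq_real c v
  set X := SparseBlindDeconv.correlate (N := N) x
  have es : ∑ i, X (c + v) i ^ 2 - ∑ i, X (c - v) i ^ 2 = 4 * ∑ i, X c i * X v i := by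
    rw [← Finset.sum_sub_distrib, Finset.mul_sum]
    refine Finset.sum_congr rfl fun i _ => ?_
    simp only [map_add, map_sub, Pi.add_apply, Pi.sub_apply]; ring
  have hn : ‖c + v‖ ^ 2 + ‖c - v‖ ^ 2 ≤ 16 := by
    rw [e1, e2]
    nlinarith [norm_nonneg c, norm_nonneg v]
  have hid : ∑ i, X c i * X v i - m * (θ * inner ℝ c v)
      = ((∑ i, X (c + v) i ^ 2 - m * (θ * ‖c + v‖ ^ 2))
        - (∑ i, X (c - v) i ^ 2 - m * (θ * ‖c - v‖ ^ 2))) / 4 := by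
    rw [e1, e2]; linear_combination (-1 / 4) * es
  rw [hid, abs_div, abs_of_pos (by norm_num : (0 : ℝ) < 4), div_le_iff₀ (by norm_num)]
  refine (abs_sub _ _).trans ((add_le_add h1 h2).trans ?_)
  rw [← mul_add]
  nlinarith

/-- Fourth powers at `c ± v` and `c ± 2v` are combined with weights `8` and `-1` so that `c v³`
cancels and `48 c³ v` remains. The same identity holds for the population moment, so only deviations
are left. -/
lemma WindowMomentControl.abs_sum_cube_mul_sub_le (h : WindowMomentControl N θ B x) (hB : 0 ≤ B)
    {c v : EuclideanSpace ℝ (Fin N)} (hc : ‖c‖ ≤ 2) (hv : ‖v‖ ≤ 2) :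
    |∑ i, SparseBlindDeconv.correlate x c i ^ 3 * SparseBlindDeconv.correlate x v i
      - m * (3 * θ * (1 - θ) * (∑ j, c j ^ 3 * v j) + 3 * θ ^ 2 * (‖c‖ ^ 2 * inner ℝ c v))|
      ≤ 76 * B := by
  have h1 := (h.correlate (c + v)).2
  have h2 := (h.correlate (c - v)).2
  have h3 := (h.correlate (c + (2 : ℝ) • v)).2
  have h4 := (h.correlate (c - (2 : ℝ) • v)).2
  have e1 : ‖c + v‖ ^ 2 = ‖c‖ ^ 2 + 2 * inner ℝ c v + ‖v‖ ^ 2 := norm_add_sq_real c v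
  have e2 : ‖c - v‖ ^ 2 = ‖c‖ ^ 2 - 2 * inner ℝ c v + ‖v‖ ^ 2 := norm_sub_sq_real c v
  have e3 : ‖c + (2 : ℝ) • v‖ ^ 2 = ‖c‖ ^ 2 + 4 * inner ℝ c v + 4 * ‖v‖ ^ 2 := by
    rw [norm_add_sq_real, real_inner_smul_right, norm_smul]; norm_num; ring
  have e4 : ‖c - (2 : ℝ) • v‖ ^ 2 = ‖c‖ ^ 2 - 4 * inner ℝ c v + 4 * ‖v‖ ^ 2 := by
    rw [norm_sub_sq_real, real_inner_smul_right, norm_smul]; norm_num; ring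
  set X := SparseBlindDeconv.correlate (N := N) x
  have key : ∀ {ι : Type} (s : Finset ι) (f g : ι → ℝ),
      8 * (∑ i ∈ s, (f i + g i) ^ 4 - ∑ i ∈ s, (f i - g i) ^ 4)
        - (∑ i ∈ s, (f i + 2 * g i) ^ 4 - ∑ i ∈ s, (f i - 2 * g i) ^ 4)
      = 48 * ∑ i ∈ s, f i ^ 3 * g i := by
    intro ι s f g
    simp only [← Finset.sum_sub_distrib, Finset.mul_sum]
    exact Finset.sum_congr rfl fun i _ => by ring
  have k1 := key Finset.univ (X c) (X v)
  have k2 := key Finset.univ c v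
  have n1 : (‖c‖ ^ 2 + ‖v‖ ^ 2) ≤ 8 := by nlinarith [norm_nonneg c, norm_nonneg v]
  have n0 : ‖c‖ ^ 2 ≤ 4 := by nlinarith [norm_nonneg c]
  have n2 : ‖v‖ ^ 2 ≤ 4 := by nlinarith [norm_nonneg v]
  -- By the parallelogram law the squared norms add up to at most `16` and `40`, and `8 * 16² + 40²
  -- = 3648 = 48 * 76`.
  have hn : 8 * ((‖c + v‖ ^ 2) ^ 2 + (‖c - v‖ ^ 2) ^ 2)
      + ((‖c + (2 : ℝ) • v‖ ^ 2) ^ 2 + (‖c - (2 : ℝ) • v‖ ^ 2) ^ 2) ≤ 3648 := by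
    have p : ∀ a b t : ℝ, 0 ≤ a → 0 ≤ b → a + b ≤ t → a ^ 2 + b ^ 2 ≤ t ^ 2 := by
      intro a b t ha hb hab; nlinarith
    have := p (‖c + v‖ ^ 2) (‖c - v‖ ^ 2) 16 (by positivity) (by positivity)
      (by rw [e1, e2]; linarith)
    have := p (‖c + (2 : ℝ) • v‖ ^ 2) (‖c - (2 : ℝ) • v‖ ^ 2) 40 (by positivity) (by positivity)
      (by rw [e3, e4]; linarith)
    linarith
  simp only [map_add, map_sub, map_smul, Pi.add_apply, Pi.sub_apply, Pi.smul_apply, smul_eq_mul,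
    PiLp.add_apply, PiLp.sub_apply, PiLp.smul_apply] at h1 h2 h3 h4
  have hb : ∀ {P Q R S : ℝ} {p q r s : ℝ}, |P| ≤ B * p → |Q| ≤ B * q → |R| ≤ B * r →
      |S| ≤ B * s → 8 * (p + q) + (r + s) ≤ 3648 → |(8 * (P - Q) - (R - S)) / 48| ≤ 76 * B := by
    intro P Q R S p q r s hP hQ hR hS hpq
    rw [abs_le] at *
    have : B * (8 * (p + q) + (r + s)) ≤ B * 3648 := mul_le_mul_of_nonneg_left hpq hB
    constructor <;> linarith
  convert hb h1 h2 h3 h4 hn using 2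
  rw [e1, e2, e3, e4]
  linear_combination (-1 / 48) * k1 + (m * (3 * θ * (1 - θ)) / 48) * k2

end Polarization

/-! ### Perturbation of positive square roots, and singular values of the adjoint. -/

section Operators

variable {E F : Type*} [NormedAddCommGroup E] [InnerProductSpace ℝ E] [FiniteDimensional ℝ E]
  [NormedAddCommGroup F] [InnerProductSpace ℝ F] [FiniteDimensional ℝ F]

lemma norm_sq_apply_eq_sum_eigenvalues {D : E →ₗ[ℝ] E} (hD : D.IsSymmetric) {n : ℕ}
    (hn : Module.finrank ℝ E = n) (w : E) :
    ‖D w‖ ^ 2 = ∑ i, (hD.eigenvalues hn i * inner ℝ (hD.eigenvectorBasis hn i) w) ^ 2 := by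
  rw [← (hD.eigenvectorBasis hn).sum_sq_norm_inner_right (D w)]
  refine Finset.sum_congr rfl fun i _ => ?_
  rw [← hD, hD.apply_eigenvectorBasis, inner_smul_left]
  simp [mul_pow]

-- This is `S² ≤ σ S`, obtained from positivity of `S` at the vector `w - σ⁻¹ S w`.
omit [FiniteDimensional ℝ E] in
lemma norm_sq_apply_le_mul_inner {S : E →ₗ[ℝ] E} (hS : S.IsSymmetric)
    (hpos : ∀ w, 0 ≤ inner ℝ w (S w)) {σ : ℝ} (hσ : 0 < σ) (hle : ∀ w, ‖S w‖ ≤ σ * ‖w‖) (w : E) :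
    ‖S w‖ ^ 2 ≤ σ * inner ℝ w (S w) := by
  have h := hpos (w - σ⁻¹ • S w)
  have e : inner ℝ (w - σ⁻¹ • S w) (S (w - σ⁻¹ • S w))
      = inner ℝ w (S w) - 2 * σ⁻¹ * ‖S w‖ ^ 2 + σ⁻¹ ^ 2 * inner ℝ (S w) (S (S w)) := by
    rw [map_sub, map_smul, inner_sub_left, inner_sub_right, inner_sub_right, inner_smul_left,
      inner_smul_right, inner_smul_left, inner_smul_right, ← hS w (S w),
      real_inner_self_eq_norm_sq]
    simp only [conj_trivial]; ring
  have h2 : inner ℝ (S w) (S (S w)) ≤ σ * ‖S w‖ ^ 2 :=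
    (real_inner_le_norm _ _).trans (by
      have := mul_le_mul_of_nonneg_left (hle (S w)) (norm_nonneg (S w))
      nlinarith)
  rw [e] at h
  have h3 : σ⁻¹ ^ 2 * inner ℝ (S w) (S (S w)) ≤ σ⁻¹ ^ 2 * (σ * ‖S w‖ ^ 2) := by gcongr
  have h4 : σ⁻¹ ^ 2 * (σ * ‖S w‖ ^ 2) = σ⁻¹ * ‖S w‖ ^ 2 := by field_simp
  have h5 : σ⁻¹ * ‖S w‖ ^ 2 ≤ inner ℝ w (S w) := by linarith
  rwa [inv_mul_le_iff₀ hσ] at h5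

/-- If the squares of two positive operators are relatively close, so are the operators. -/
lemma norm_sub_apply_le {R S : E →ₗ[ℝ] E} (hR : R.IsSymmetric) (hS : S.IsSymmetric)
    (hRpos : ∀ w, 0 ≤ inner ℝ w (R w)) (hSpos : ∀ w, 0 ≤ inner ℝ w (S w))
    (hSinj : Function.Injective S) {η σ : ℝ} (hη : 0 ≤ η) (hσ : 0 < σ) (hle : ∀ w, ‖S w‖ ≤ σ * ‖w‖)
    (h : ∀ w, |‖R w‖ ^ 2 - ‖S w‖ ^ 2| ≤ η * ‖S w‖ ^ 2) (w : E) :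
    ‖R w - S w‖ ≤ η * σ * ‖w‖ := by
  have hD : (R - S).IsSymmetric := hR.sub hS
  have hev : ∀ i, |hD.eigenvalues rfl i| ≤ η * σ := by
    intro i
    set v := hD.eigenvectorBasis rfl i with hv
    set l := hD.eigenvalues rfl i
    have hv1 : ‖v‖ = 1 := (hD.eigenvectorBasis rfl).norm_eq_one i
    have hvl : R v - S v = l • v := by
      have := hD.apply_eigenvectorBasis rfl i
      simpa using this
    -- On an eigenvector of `R - S` the difference of squares factors although `R` and `S` need not
    -- commute. Dropping `⟨v, R v⟩ ≥ 0` and using `S² ≤ σ S` then bounds the eigenvalue.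
    have e1 : l * (inner ℝ v (R v) + inner ℝ v (S v)) = ‖R v‖ ^ 2 - ‖S v‖ ^ 2 := by
      have : inner ℝ (R v - S v) (R v + S v) = ‖R v‖ ^ 2 - ‖S v‖ ^ 2 := by
        rw [inner_sub_left, inner_add_right, inner_add_right, real_inner_self_eq_norm_sq,
          real_inner_self_eq_norm_sq, real_inner_comm (R v) (S v)]
        ring
      rw [← this, hvl, inner_smul_left, inner_add_right]; simp
    have hSv : 0 < ‖S v‖ ^ 2 := by
      have : S v ≠ 0 := fun h0 => by
        have : v = 0 := hSinj (by rw [h0, map_zero])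
        rw [this, norm_zero] at hv1; norm_num at hv1
      positivity
    have h2 := norm_sq_apply_le_mul_inner hS hSpos hσ hle v
    have hp : 0 < inner ℝ v (S v) := by
      by_contra hcon
      push Not at hcon
      nlinarith
    have h3 : |l| * inner ℝ v (S v) ≤ η * (σ * inner ℝ v (S v)) := by
      calc |l| * inner ℝ v (S v) ≤ |l| * (inner ℝ v (R v) + inner ℝ v (S v)) := by
            gcongr; linarith [hRpos v]
        _ = |‖R v‖ ^ 2 - ‖S v‖ ^ 2| := by
            rw [← e1, abs_mul, abs_of_nonneg (add_nonneg (hRpos v) hp.le)]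
        _ ≤ η * ‖S v‖ ^ 2 := h v
        _ ≤ _ := by gcongr
    rw [← mul_assoc] at h3
    exact le_of_mul_le_mul_right h3 hp
  have hsq : ‖R w - S w‖ ^ 2 ≤ (η * σ * ‖w‖) ^ 2 := by
    rw [← LinearMap.sub_apply, norm_sq_apply_eq_sum_eigenvalues hD rfl, mul_pow _ ‖w‖,
      ← (hD.eigenvectorBasis rfl).sum_sq_norm_inner_right w, Finset.mul_sum]
    refine Finset.sum_le_sum fun i _ => ?_
    rw [mul_pow, Real.norm_eq_abs, sq_abs]
    exact mul_le_mul_of_nonneg_right (sq_le_sq.2 ((hev i).trans (le_abs_self _))) (sq_nonneg _)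
  exact le_of_sq_le_sq hsq (by positivity)

lemma norm_adjoint_apply_le (T : E →ₗ[ℝ] F) (w : F) :
    ‖LinearMap.adjoint T w‖ ≤ T.singularValues 0 * ‖w‖ := by
  have hS := T.isSymmetric_adjoint_comp_self
  have hσ0 := T.singularValues_nonneg 0
  have hT : ∀ u, ‖T u‖ ≤ T.singularValues 0 * ‖u‖ := by
    intro u
    refine le_of_sq_le_sq ?_ (by positivity)
    have e : ‖T u‖ ^ 2 = ∑ i, hS.eigenvalues rfl i * inner ℝ (hS.eigenvectorBasis rfl i) u ^ 2 := by
      rw [← real_inner_self_eq_norm_sq, ← LinearMap.adjoint_inner_right,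
        ← (hS.eigenvectorBasis rfl).sum_inner_mul_inner]
      refine Finset.sum_congr rfl fun i _ => ?_
      rw [← LinearMap.comp_apply, ← hS, hS.apply_eigenvectorBasis, inner_smul_left,
        real_inner_comm]
      simp only [RCLike.ofReal_real_eq_id, id_eq, conj_trivial]; ring
    rw [e, mul_pow, ← (hS.eigenvectorBasis rfl).sum_sq_norm_inner_right u, Finset.mul_sum]
    refine Finset.sum_le_sum fun i _ => ?_
    rw [Real.norm_eq_abs, sq_abs, ← T.sq_singularValues_fin rfl i]
    gcongr
    · exact T.singularValues_nonneg _
    · exact T.singularValues_antitone (Nat.zero_le _)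
  rcases (norm_nonneg (LinearMap.adjoint T w)).eq_or_lt with h0 | hpos
  · rw [← h0]; positivity
  · have h1 : ‖LinearMap.adjoint T w‖ ^ 2 ≤ ‖w‖ * (T.singularValues 0 * ‖LinearMap.adjoint T w‖) := by
      rw [← real_inner_self_eq_norm_sq, LinearMap.adjoint_inner_left]
      exact (real_inner_le_norm _ _).trans (mul_le_mul_of_nonneg_left (hT _) (norm_nonneg _))
    refine le_of_mul_le_mul_right ?_ hpos
    nlinarith

/-- Eigenvectors of `T* T` with index at least `k` lie in the kernel of `T`, hence are orthogonal to
the range of `T*`; the others have singular value at least the one of index `k - 1`. -/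
lemma norm_apply_adjoint_ge (T : E →ₗ[ℝ] F) {k : ℕ} (hk : 1 ≤ k)
    (hrank : Module.finrank ℝ (LinearMap.range T) = k) (z : F) :
    T.singularValues (k - 1) * ‖LinearMap.adjoint T z‖ ≤ ‖T (LinearMap.adjoint T z)‖ := by
  have hS := T.isSymmetric_adjoint_comp_self
  have hσ0 := T.singularValues_nonneg (k - 1)
  set y := LinearMap.adjoint T z
  refine le_of_sq_le_sq ?_ (norm_nonneg _)
  have e : ‖T y‖ ^ 2 = ∑ i, hS.eigenvalues rfl i * inner ℝ (hS.eigenvectorBasis rfl i) y ^ 2 := by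
    rw [← real_inner_self_eq_norm_sq, ← LinearMap.adjoint_inner_right,
      ← (hS.eigenvectorBasis rfl).sum_inner_mul_inner]
    refine Finset.sum_congr rfl fun i _ => ?_
    rw [← LinearMap.comp_apply, ← hS, hS.apply_eigenvectorBasis, inner_smul_left,
      real_inner_comm]
    simp only [RCLike.ofReal_real_eq_id, id_eq, conj_trivial]; ring
  rw [e, mul_pow, ← (hS.eigenvectorBasis rfl).sum_sq_norm_inner_right y, Finset.mul_sum]
  refine Finset.sum_le_sum fun i _ => ?_
  rw [Real.norm_eq_abs, sq_abs, ← T.sq_singularValues_fin rfl i]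
  by_cases hi : (i : ℕ) < k
  · gcongr
    exact T.singularValues_antitone (by omega)
  · have h0 : T.singularValues i = 0 :=
      T.singularValues_eq_zero_iff_le_finrank_range.2 (by omega)
    have hTv : T (hS.eigenvectorBasis rfl i) = 0 := by
      rw [← norm_eq_zero, ← sq_eq_zero_iff, ← real_inner_self_eq_norm_sq,
        ← LinearMap.adjoint_inner_right, ← LinearMap.comp_apply, hS.apply_eigenvectorBasis,
        ← T.sq_singularValues_fin rfl i, h0]
      simp
    have : inner ℝ (hS.eigenvectorBasis rfl i) y = 0 := by
      rw [LinearMap.adjoint_inner_right, hTv, inner_zero_left]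
    rw [this]; simp

/-- The bound is carried over from `T` on the range of `T*`: write `w = T y` with `y = T* z`, and
combine `‖T y‖² ≤ ‖y‖ ‖T* T y‖` with `σ ‖y‖ ≤ ‖T y‖`. -/
lemma norm_adjoint_apply_ge (T : E →ₗ[ℝ] F) (hT : Function.Injective (LinearMap.adjoint T))
    {k : ℕ} (hk : 1 ≤ k) (hF : Module.finrank ℝ F = k) :
    0 < T.singularValues (k - 1) ∧
      ∀ w, T.singularValues (k - 1) * ‖w‖ ≤ ‖LinearMap.adjoint T w‖ := by
  have hinj : Function.Injective (T ∘ₗ LinearMap.adjoint T) := by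
    rw [← LinearMap.ker_eq_bot, LinearMap.ker_eq_bot']
    intro w hw
    refine hT ?_
    rw [map_zero, ← norm_eq_zero, ← sq_eq_zero_iff, ← real_inner_self_eq_norm_sq,
      LinearMap.adjoint_inner_left, ← LinearMap.comp_apply, hw, inner_zero_right]
  have hsurj := LinearMap.surjective_of_injective hinj
  have hrank : Module.finrank ℝ (LinearMap.range T) = k := by
    rw [LinearMap.range_eq_top.2 (Function.Surjective.of_comp (g := LinearMap.adjoint T) hsurj),
      finrank_top, hF]
  refine ⟨T.singularValues_pos_iff_lt_finrank_range.2 (by omega), fun w => ?_⟩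
  obtain ⟨z, rfl⟩ := hsurj w
  have h1 := norm_apply_adjoint_ge T hk hrank z
  rw [LinearMap.comp_apply]
  set y := LinearMap.adjoint T z
  have h2 : ‖T y‖ ^ 2 ≤ ‖y‖ * ‖LinearMap.adjoint T (T y)‖ := by
    rw [← real_inner_self_eq_norm_sq, ← LinearMap.adjoint_inner_right]
    exact real_inner_le_norm _ _
  rcases (norm_nonneg (T y)).eq_or_lt with h0 | hpos
  · rw [← h0, mul_zero]; exact norm_nonneg _
  · refine le_of_mul_le_mul_right ?_ hpos
    have hσ0 := T.singularValues_nonneg (k - 1)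
    calc T.singularValues (k - 1) * ‖T y‖ * ‖T y‖
        = T.singularValues (k - 1) * ‖T y‖ ^ 2 := by ring
      _ ≤ T.singularValues (k - 1) * (‖y‖ * ‖LinearMap.adjoint T (T y)‖) := by gcongr
      _ = (T.singularValues (k - 1) * ‖y‖) * ‖LinearMap.adjoint T (T y)‖ := by ring
      _ ≤ ‖T y‖ * ‖LinearMap.adjoint T (T y)‖ := by gcongr
      _ = _ := mul_comm _ _

end Operators

/-! ### The convolution matrix: factorization of `Y`, injectivity, singular values. -/

section Convolution

variable {k : ℕ} (a : EuclideanSpace ℝ (Fin k))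

/-- Row `r` holds the kernel entry `s` in column `r + (k - 1) - s`. The function `g` allows one
proof for sums of entries and of their squares. -/
lemma sum_convMatrix {g : ℝ → ℝ} (hg : g 0 = 0) (f : ℕ → ℝ) (r : Fin k) :
    ∑ j, g (convMatrix a r j) * f j = ∑ s : Fin k, g (a s) * f (r + (k - 1) - s) := by
  symm
  have hlt : ∀ s : Fin k, (r : ℕ) + (k - 1) - s < 2 * k - 1 := fun s => by omega
  refine Fintype.sum_of_injective (fun s : Fin k => (⟨r + (k - 1) - s, hlt s⟩ : Fin (2 * k - 1)))
    (fun s t hst => ?_) _ _ (fun j hj => ?_) fun s => ?_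
  · have := Fin.mk.inj_iff.1 hst
    exact Fin.ext (by omega)
  · have : convMatrix a r j = 0 := by
      rw [convMatrix, dif_neg]
      intro h
      refine hj ⟨⟨r + (k - 1) - j, by omega⟩, Fin.ext ?_⟩
      simp only
      omega
    rw [this, hg, zero_mul]
  · have : convMatrix a r ⟨r + (k - 1) - s, hlt s⟩ = a s := by
      rw [convMatrix, dif_pos ⟨by simp only; omega, by simp only; omega⟩]
      have e : (r : ℕ) + (k - 1) - (r + (k - 1) - s) = s := by omega
      simp only [e, Fin.eta]
    rw [this]

/-- The matrix whose rows are the shifts of the signal. -/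
noncomputable def signalMatrix {m : ℕ} (k : ℕ) (x : ZMod m → ℝ) :
    Matrix (Fin (2 * k - 1)) (ZMod m) ℝ := fun j i =>
  x (i - ((k - 1 : ℕ) : ZMod m) + ((j : ℕ) : ZMod m))

lemma windows_eq_mul {m : ℕ} (x : ZMod m → ℝ) :
    windows a x = convMatrix a * signalMatrix k x := by
  ext r i
  rw [Matrix.mul_apply]
  have h := sum_convMatrix a (g := id) rfl
    (fun n => x (i - ((k - 1 : ℕ) : ZMod m) + (n : ZMod m))) r
  simp only [id_eq] at h
  simp only [signalMatrix, windows, observation]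
  rw [h]
  refine Finset.sum_congr rfl fun s _ => ?_
  have e : ((r + (k - 1) - s : ℕ) : ZMod m) = r + ((k - 1 : ℕ) : ZMod m) - s := by
    rw [Nat.cast_sub (by omega), Nat.cast_add]
  rw [e]
  congr 2
  ring

lemma sum_convMatrix_sq (r : Fin k) : ∑ j, convMatrix a r j ^ 2 = ‖a‖ ^ 2 := by
  have h := sum_convMatrix a (g := fun y => y ^ 2) (by norm_num) (fun _ => 1) r
  simpa only [mul_one, ← EuclideanSpace.real_norm_sq_eq] using h

/-- `A₀ᵀ w` is a linear convolution, that is, multiplication of `w` by the reversed kernel as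
polynomials. -/
lemma transpose_convMatrix_mulVec_eq_coeff (w : Fin k → ℝ) (n : Fin (2 * k - 1)) :
    (convMatrix a).transpose.mulVec w n
      = PowerSeries.coeff n (PowerSeries.mk (fun r => if h : r < k then w ⟨r, h⟩ else 0)
        * PowerSeries.mk (fun s => if h : s < k then a ⟨k - 1 - s, by omega⟩ else 0)) := by
  rw [PowerSeries.coeff_mul, Finset.Nat.sum_antidiagonal_eq_sum_range_succ_mk]
  simp only [PowerSeries.coeff_mk]
  set g : ℕ → ℝ := fun r => if h : r < k ∧ r ≤ n ∧ (n : ℕ) - r < k then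
    w ⟨r, h.1⟩ * a ⟨k - 1 - (n - r), by omega⟩ else 0 with hg
  have e1 : ∑ r ∈ Finset.range (n + 1), ((if h : r < k then w ⟨r, h⟩ else 0)
      * if h : (n : ℕ) - r < k then a ⟨k - 1 - (n - r), by omega⟩ else 0)
      = ∑ r ∈ Finset.range (n + 1 + k), g r := by
    refine Eq.trans ?_ (Finset.sum_subset (Finset.range_subset_range.2
      (Nat.le_add_right (n + 1) k)) ?_)
    · refine Finset.sum_congr rfl fun r hr => ?_
      have := Finset.mem_range.1 hr
      simp only [hg]
      split_ifs <;> first | rfl | (exfalso; omega) | simp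
    · intro r _ hr
      simp only [hg]
      rw [dif_neg]
      intro h
      exact hr (Finset.mem_range.2 (by omega))
  have e2 : ∑ r ∈ Finset.range k, g r = ∑ r ∈ Finset.range (n + 1 + k), g r := by
    refine Finset.sum_subset (Finset.range_subset_range.2 (Nat.le_add_left _ _)) ?_
    intro r _ hr
    simp only [hg]
    rw [dif_neg]
    intro h
    exact hr (Finset.mem_range.2 h.1)
  rw [e1, ← e2, Finset.sum_range, Matrix.mulVec, dotProduct]
  refine Finset.sum_congr rfl fun r _ => ?_
  simp only [Matrix.transpose_apply, convMatrix, hg]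
  have hr := r.2
  split_ifs with h1 h2 h2
  · rw [mul_comm]
    have e : (r : ℕ) + (k - 1) - n = k - 1 - (n - r) := by omega
    simp only [e]
  · omega
  · omega
  · simp

/-- Power series over `ℝ` have no zero divisors, and the reversed kernel is not zero. -/
lemma transpose_convMatrix_mulVec_injective (ha : a ≠ 0) {w : Fin k → ℝ}
    (hw : (convMatrix a).transpose.mulVec w = 0) : w = 0 := by
  set P := PowerSeries.mk (fun r => if h : r < k then w ⟨r, h⟩ else 0) with hP
  set Q := PowerSeries.mk (fun s => if h : s < k then a ⟨k - 1 - s, by omega⟩ else 0) with hQ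
  have hPQ : P * Q = 0 := by
    ext n
    by_cases hn : n < 2 * k - 1
    · have := transpose_convMatrix_mulVec_eq_coeff a w ⟨n, hn⟩
      rw [hw] at this
      simpa using this.symm
    · rw [PowerSeries.coeff_mul, map_zero]
      refine Finset.sum_eq_zero fun p hp => ?_
      have := Finset.HasAntidiagonal.mem_antidiagonal.1 hp
      simp only [hP, hQ, PowerSeries.coeff_mk]
      by_cases h1 : p.1 < k
      · rw [dif_neg (show ¬ p.2 < k by omega), mul_zero]
      · rw [dif_neg h1, zero_mul]
  rcases mul_eq_zero.1 hPQ with h | h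
  · ext r
    have := congrArg (PowerSeries.coeff r) h
    simpa [hP] using this
  · exfalso
    refine ha ?_
    ext s
    have := congrArg (PowerSeries.coeff (k - 1 - s)) h
    rw [hQ, PowerSeries.coeff_mk, dif_pos (by omega)] at this
    have hs : k - 1 - (k - 1 - (s : ℕ)) = s := by omega
    simpa [hs] using this

/-- The transpose of the convolution matrix as a linear map of Euclidean spaces. -/
noncomputable def convAdjoint : EuclideanSpace ℝ (Fin k) →ₗ[ℝ] EuclideanSpace ℝ (Fin (2 * k - 1)) :=
  Matrix.toEuclideanLin (convMatrix a).transpose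

lemma convAdjoint_eq_adjoint :
    convAdjoint a = LinearMap.adjoint (Matrix.toEuclideanLin (convMatrix a)) := by
  rw [convAdjoint, ← Matrix.conjTranspose_eq_transpose_of_trivial,
    Matrix.toEuclideanLin_conjTranspose_eq_adjoint]

variable {a}

lemma one_le_of_norm_eq_one (ha : ‖a‖ = 1) : 1 ≤ k := by
  rcases Nat.eq_zero_or_pos k with rfl | h
  · have : a = 0 := Subsingleton.elim _ _
    rw [this, norm_zero] at ha
    norm_num at ha
  · exact h

lemma convAdjoint_injective (ha : ‖a‖ = 1) : Function.Injective (convAdjoint a) := by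
  rw [← LinearMap.ker_eq_bot, LinearMap.ker_eq_bot']
  intro w hw
  have ha0 : a ≠ 0 := fun h => by rw [h, norm_zero] at ha; norm_num at ha
  have := transpose_convMatrix_mulVec_injective a ha0 (w := w.ofLp)
    (congrArg WithLp.ofLp hw)
  ext i
  exact congrFun this i

lemma norm_convAdjoint_le (w : EuclideanSpace ℝ (Fin k)) :
    ‖convAdjoint a w‖ ≤ sigmaMax a * ‖w‖ := by
  rw [convAdjoint_eq_adjoint]
  exact norm_adjoint_apply_le _ w

lemma sigmaMin_pos_and_le_norm_convAdjoint (ha : ‖a‖ = 1) :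
    0 < sigmaMin a ∧ ∀ w, sigmaMin a * ‖w‖ ≤ ‖convAdjoint a w‖ := by
  rw [convAdjoint_eq_adjoint]
  refine norm_adjoint_apply_ge _ ?_ (one_le_of_norm_eq_one ha) (by simp)
  rw [← convAdjoint_eq_adjoint]
  exact convAdjoint_injective ha

/-- Test on the first basis vector: its image under `A₀ᵀ` is the first row, of norm `‖a‖ = 1`. -/
lemma sigmaMin_le_one (ha : ‖a‖ = 1) : sigmaMin a ≤ 1 := by
  have hk := one_le_of_norm_eq_one ha
  have h := (sigmaMin_pos_and_le_norm_convAdjoint ha).2 (EuclideanSpace.single ⟨0, hk⟩ 1)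
  rw [PiLp.norm_single, norm_one, mul_one] at h
  have h2 : ‖convAdjoint a (EuclideanSpace.single ⟨0, hk⟩ 1)‖ ^ 2 = 1 := by
    rw [EuclideanSpace.real_norm_sq_eq]
    refine Eq.trans ?_ ((sum_convMatrix_sq a ⟨0, hk⟩).trans (by rw [ha, one_pow]))
    refine Finset.sum_congr rfl fun j _ => ?_
    simp [convAdjoint, Matrix.toLpLin_apply]
  have h3 : ‖convAdjoint a (EuclideanSpace.single ⟨0, hk⟩ 1)‖ = 1 := by
    nlinarith [norm_nonneg (convAdjoint a (EuclideanSpace.single ⟨0, hk⟩ 1))]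
  linarith

lemma sigmaMin_le_sigmaMax : sigmaMin a ≤ sigmaMax a :=
  LinearMap.singularValues_antitone _ (Nat.zero_le _)

lemma one_le_kappa (ha : ‖a‖ = 1) : 1 ≤ kappa a :=
  (one_le_div (sigmaMin_pos_and_le_norm_convAdjoint ha).1).2 sigmaMin_le_sigmaMax

end Convolution

/-! ### Gradients of fourth powers of `ℓ⁴` norms. -/

section Gradient

lemma norm4_nonneg {ι : Type*} [Fintype ι] (v : ι → ℝ) : 0 ≤ norm4 v := by
  unfold norm4; positivity

lemma norm4_pow_four {ι : Type*} [Fintype ι] (v : ι → ℝ) : norm4 v ^ 4 = ∑ i, v i ^ 4 := by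
  unfold norm4
  rw [← Real.rpow_natCast, ← Real.rpow_mul (by positivity)]
  norm_num
  exact Finset.sum_congr rfl fun i _ => by
    rw [← abs_pow, abs_of_nonneg (by positivity)]

lemma inner_gradient_norm4 {ι : Type*} [Fintype ι] {k : ℕ}
    (L : EuclideanSpace ℝ (Fin k) →ₗ[ℝ] (ι → ℝ)) (b : ℝ) {f : EuclideanSpace ℝ (Fin k) → ℝ}
    (hf : ∀ q, f q = b * norm4 (L q) ^ 4) (q v : EuclideanSpace ℝ (Fin k)) :
    inner ℝ (gradient f q) v = b * (4 * ∑ i, L q i ^ 3 * L v i) := by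
  have hL : ∀ i, HasFDerivAt (fun q => L q i)
      (LinearMap.toContinuousLinearMap ((LinearMap.proj i : (ι → ℝ) →ₗ[ℝ] ℝ) ∘ₗ L)) q := fun i =>
    (LinearMap.toContinuousLinearMap ((LinearMap.proj i : (ι → ℝ) →ₗ[ℝ] ℝ) ∘ₗ L)).hasFDerivAt
  have hfe : f = fun q => b * ∑ i, L q i ^ 4 := by
    ext q; rw [hf, norm4_pow_four]
  have hd : HasFDerivAt f (b • ∑ i, (4 * L q i ^ 3) •
      LinearMap.toContinuousLinearMap (LinearMap.proj i ∘ₗ L)) q := by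
    rw [hfe]
    refine HasFDerivAt.const_mul ?_ b
    refine HasFDerivAt.fun_sum fun i _ => ?_
    have := (hL i).pow 4
    simpa using this
  rw [gradient, ← InnerProductSpace.toDual_apply_apply, LinearIsometryEquiv.apply_symm_apply, hd.fderiv]
  simp only [smul_apply, sum_apply, smul_eq_mul,
    LinearMap.coe_toContinuousLinearMap', LinearMap.comp_apply, LinearMap.proj_apply,
    Finset.mul_sum]
  exact Finset.sum_congr rfl fun i _ => by ring

/-- A difference of Riemannian gradients is small if the directional derivatives are close along
all tangential unit vectors. -/
lemma norm_riemGrad_sub_smul_le {k : ℕ} {f g : EuclideanSpace ℝ (Fin k) → ℝ} {s b : ℝ}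
    {q : EuclideanSpace ℝ (Fin k)} (hq : ‖q‖ = 1) (hb : 0 ≤ b)
    (h : ∀ v, ‖v‖ = 1 → inner ℝ q v = 0 →
      |inner ℝ (gradient f q) v - s * inner ℝ (gradient g q) v| ≤ b) :
    ‖riemGrad f q - s • riemGrad g q‖ ≤ b := by
  set w := riemGrad f q - s • riemGrad g q with hw
  have hqq : inner ℝ q q = 1 := by rw [real_inner_self_eq_norm_sq, hq, one_pow]
  have hqw : inner ℝ q w = 0 := by
    simp only [hw, riemGrad, inner_sub_right, inner_smul_right, hqq]; ring
  rcases (norm_nonneg w).eq_or_lt with h0 | hpos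
  · rw [← h0]; exact hb
  have h1 := h (‖w‖⁻¹ • w) (by rw [norm_smul, norm_inv, norm_norm, inv_mul_cancel₀ hpos.ne'])
    (by rw [inner_smul_right, hqw, mul_zero])
  have h2 : inner ℝ (gradient f q) w - s * inner ℝ (gradient g q) w = ‖w‖ ^ 2 := by
    rw [← real_inner_self_eq_norm_sq]
    have e : inner ℝ w w = inner ℝ (riemGrad f q - s • riemGrad g q) w := by rw [← hw]
    rw [e]
    simp only [riemGrad, inner_sub_left, inner_smul_left, hqw, conj_trivial]
    ring
  rw [inner_smul_right, inner_smul_right] at h1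
  have h3 : ‖w‖⁻¹ * inner ℝ (gradient f q) w - s * (‖w‖⁻¹ * inner ℝ (gradient g q) w) = ‖w‖ := by
    calc _ = ‖w‖⁻¹ * (inner ℝ (gradient f q) w - s * inner ℝ (gradient g q) w) := by ring
      _ = ‖w‖ := by rw [h2]; field_simp
  rw [h3] at h1
  exact (le_abs_self _).trans h1

end Gradient

/-! ### Inverse square roots of Gram matrices. -/

section InverseSquareRoot

open scoped MatrixOrder

variable {k : ℕ} {ι : Type*} [Fintype ι]

lemma isHermitian_invSqrt (M : Matrix (Fin k) (Fin k) ℝ) : (invSqrt M).IsHermitian :=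
  (Matrix.nonneg_iff_posSemidef.1 (CFC.sqrt_nonneg M)).isHermitian.inv

/-- The inverse square root of `B Bᵀ` inverts a positive operator `S` with `S² = B Bᵀ`. -/
lemma exists_sqrt_mul_transpose {B : Matrix (Fin k) ι ℝ}
    (hB : ∀ w, B.transpose.mulVec w = 0 → w = 0) :
    ∃ S : EuclideanSpace ℝ (Fin k) →ₗ[ℝ] EuclideanSpace ℝ (Fin k), S.IsSymmetric ∧
      (∀ w, 0 ≤ inner ℝ w (S w)) ∧ Function.Injective S ∧
      (∀ w, S (Matrix.toEuclideanLin (invSqrt (B * B.transpose)) w) = w) ∧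
      ∀ w w' : EuclideanSpace ℝ (Fin k), inner ℝ (S w) (S w')
        = ∑ i, B.transpose.mulVec w.ofLp i * B.transpose.mulVec w'.ofLp i := by
  set M := B * B.transpose with hM
  have hMpos : M.PosSemidef := by
    have := Matrix.posSemidef_self_mul_conjTranspose B
    rwa [Matrix.conjTranspose_eq_transpose_of_trivial] at this
  have hS := Matrix.nonneg_iff_posSemidef.1 (CFC.sqrt_nonneg M)
  have hSS : CFC.sqrt M * CFC.sqrt M = M := CFC.sqrt_mul_sqrt_self M hMpos.nonneg
  have hpos : (Matrix.toEuclideanLin (CFC.sqrt M)).IsPositive :=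
    Matrix.isPositive_toEuclideanLin_iff.2 hS
  have hform : ∀ w w' : EuclideanSpace ℝ (Fin k),
      inner ℝ (Matrix.toEuclideanLin (CFC.sqrt M) w) (Matrix.toEuclideanLin (CFC.sqrt M) w')
        = ∑ i, B.transpose.mulVec w.ofLp i * B.transpose.mulVec w'.ofLp i := by
    intro w w'
    rw [hpos.isSymmetric, EuclideanSpace.inner_eq_star_dotProduct]
    simp only [Matrix.ofLp_toLpLin, Matrix.toLin'_apply, Matrix.mulVec_mulVec, hSS, star_trivial]
    rw [hM, ← Matrix.mulVec_mulVec, dotProduct_comm, Matrix.dotProduct_mulVec,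
      ← Matrix.mulVec_transpose]
    rfl
  have hinj : Function.Injective (Matrix.toEuclideanLin (CFC.sqrt M)) := by
    rw [← LinearMap.ker_eq_bot, LinearMap.ker_eq_bot']
    intro w hw
    have h := hform w w
    rw [hw, inner_zero_left] at h
    have h2 := (Finset.sum_eq_zero_iff_of_nonneg fun i _ => mul_self_nonneg _).1 h.symm
    have := hB w.ofLp (funext fun i => mul_self_eq_zero.1 (h2 i (Finset.mem_univ i)))
    ext i
    exact congrFun this i
  refine ⟨_, hpos.isSymmetric, fun w => ?_, hinj, fun w => ?_, hform⟩
  · have := hpos.re_inner_nonneg_right w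
    simpa using this
  · have hunit : IsUnit (CFC.sqrt M) := by
      rw [← Matrix.mulVec_injective_iff_isUnit]
      intro v v' hv
      have : Matrix.toEuclideanLin (CFC.sqrt M) (WithLp.toLp 2 v)
          = Matrix.toEuclideanLin (CFC.sqrt M) (WithLp.toLp 2 v') := by
        simp only [Matrix.toLpLin_apply]
        exact congrArg _ hv
      exact congrArg WithLp.ofLp (hinj this)
    have hdet := (Matrix.isUnit_iff_isUnit_det _).1 hunit
    simp only [Matrix.toLpLin_apply, Matrix.mulVec_mulVec, invSqrt,
      Matrix.mul_nonsing_inv _ hdet, Matrix.one_mulVec]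

end InverseSquareRoot

/-! ### The two whitenings as operators and their comparison. -/

section Deterministic

lemma sum_abs_mul_abs_le {n : ℕ} (c v : EuclideanSpace ℝ (Fin n)) :
    ∑ j, |c j| * |v j| ≤ ‖c‖ * ‖v‖ := by
  refine le_of_sq_le_sq ?_ (by positivity)
  have h := Finset.sum_mul_sq_le_sq_mul_sq Finset.univ (fun j => |c j|) fun j => |v j|
  simp only [sq_abs] at h
  rwa [mul_pow, EuclideanSpace.real_norm_sq_eq, EuclideanSpace.real_norm_sq_eq]

lemma abs_apply_le_norm {n : ℕ} (c : EuclideanSpace ℝ (Fin n)) (j : Fin n) : |c j| ≤ ‖c‖ := by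
  simpa using PiLp.norm_apply_le c j

/-- The factor `c'² + c'c + c²` is at most `7` entrywise and `‖v'‖ ≤ 2`, so the constant is `7 * 2 +
1`. -/
lemma abs_sum_cube_mul_sub_le {n : ℕ} {c c' v v' : EuclideanSpace ℝ (Fin n)} {δ : ℝ}
    (hc : ‖c‖ ≤ 1) (hc' : ‖c'‖ ≤ 2) (hv' : ‖v'‖ ≤ 2) (hcc : ‖c' - c‖ ≤ δ) (hvv : ‖v' - v‖ ≤ δ) :
    |∑ j, c' j ^ 3 * v' j - ∑ j, c j ^ 3 * v j| ≤ 15 * δ := by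
  have hδ : 0 ≤ δ := (norm_nonneg _).trans hcc
  rw [← Finset.sum_sub_distrib]
  have hent : ∀ j, |c' j ^ 3 * v' j - c j ^ 3 * v j|
      ≤ 7 * (|(c' - c) j| * |v' j|) + |c j| * |(v' - v) j| := by
    intro j
    have h1 := (abs_apply_le_norm c j).trans hc
    have h2 := (abs_apply_le_norm c' j).trans hc'
    have e : c' j ^ 3 * v' j - c j ^ 3 * v j
        = (c' j ^ 2 + c' j * c j + c j ^ 2) * ((c' - c) j * v' j)
          + c j ^ 2 * (c j * (v' - v) j) := by
      simp only [PiLp.sub_apply]; ring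
    rw [e]
    refine (abs_add_le _ _).trans ?_
    rw [abs_mul, abs_mul, abs_mul (c j ^ 2), abs_mul (c j)]
    have h3 : |c' j ^ 2 + c' j * c j + c j ^ 2| ≤ 7 := by
      have q1 : |c' j ^ 2| ≤ 4 := by
        rw [abs_pow]
        have := pow_le_pow_left₀ (abs_nonneg _) h2 2
        linarith
      have q2 : |c' j * c j| ≤ 2 := by
        rw [abs_mul]
        have := mul_le_mul h2 h1 (abs_nonneg _) (by norm_num)
        linarith
      have q3 : |c j ^ 2| ≤ 1 := by
        rw [abs_pow]
        exact pow_le_one₀ (abs_nonneg _) h1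
      have := abs_add_le (c' j ^ 2 + c' j * c j) (c j ^ 2)
      have := abs_add_le (c' j ^ 2) (c' j * c j)
      linarith
    have h4 : |c j ^ 2| ≤ 1 := by
      rw [abs_pow]
      exact pow_le_one₀ (abs_nonneg _) h1
    exact add_le_add (mul_le_mul_of_nonneg_right h3 (by positivity))
      (mul_le_of_le_one_left (by positivity) h4)
  refine (Finset.abs_sum_le_sum_abs _ _).trans ((Finset.sum_le_sum fun j _ => hent j).trans ?_)
  rw [Finset.sum_add_distrib, ← Finset.mul_sum]
  have b1 : ∑ j, |(c' - c) j| * |v' j| ≤ δ * 2 :=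
    (sum_abs_mul_abs_le _ _).trans (mul_le_mul hcc hv' (norm_nonneg _) hδ)
  have b2 : ∑ j, |c j| * |(v' - v) j| ≤ 1 * δ :=
    (sum_abs_mul_abs_le _ _).trans (mul_le_mul hc hvv (norm_nonneg _) (by norm_num))
  linarith

variable {k m : ℕ} {a : EuclideanSpace ℝ (Fin k)}

/-- The preconditioner `(A₀ A₀ᵀ)^{-1/2}` as an operator. -/
noncomputable def kernelWhitening (a : EuclideanSpace ℝ (Fin k)) :
    EuclideanSpace ℝ (Fin k) →ₗ[ℝ] EuclideanSpace ℝ (Fin k) :=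
  Matrix.toEuclideanLin (invSqrt (convMatrix a * (convMatrix a).transpose))

/-- The preconditioner `(Y Yᵀ)^{-1/2}` as an operator. -/
noncomputable def sampleWhitening [NeZero m] (a : EuclideanSpace ℝ (Fin k)) (x : ZMod m → ℝ) :
    EuclideanSpace ℝ (Fin k) →ₗ[ℝ] EuclideanSpace ℝ (Fin k) :=
  Matrix.toEuclideanLin (invSqrt (windows a x * (windows a x).transpose))

lemma zeta_eq (q : EuclideanSpace ℝ (Fin k)) :
    zeta a q = (convAdjoint a (kernelWhitening a q)).ofLp := by
  have := isHermitian_invSqrt (convMatrix a * (convMatrix a).transpose)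
  rw [Matrix.IsHermitian, Matrix.conjTranspose_eq_transpose_of_trivial] at this
  simp only [zeta, precond, convAdjoint, kernelWhitening, Matrix.transpose_mul, this,
    Matrix.toLpLin_apply, Matrix.mulVec_mulVec]

/-- The window of the signal seen by column `i` of `Y` starts `k - 1` places earlier. The offset
disappears in cyclic sums. -/
lemma windows_transpose_mulVec (x : ZMod m → ℝ) (w : EuclideanSpace ℝ (Fin k)) (i : ZMod m) :
    (windows a x).transpose.mulVec w.ofLp i
      = correlate x (convAdjoint a w) (i - ((k - 1 : ℕ) : ZMod m)) := by
  rw [windows_eq_mul, Matrix.transpose_mul, ← Matrix.mulVec_mulVec]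
  rfl

lemma sum_windows_transpose [NeZero m] (x : ZMod m → ℝ) (w v : EuclideanSpace ℝ (Fin k)) (r : ℕ) :
    ∑ i, (windows a x).transpose.mulVec w.ofLp i ^ r * (windows a x).transpose.mulVec v.ofLp i
      = ∑ i, correlate x (convAdjoint a w) i ^ r * correlate x (convAdjoint a v) i := by
  simp only [windows_transpose_mulVec]
  exact (Equiv.subRight ((k - 1 : ℕ) : ZMod m)).sum_comp
    fun i => correlate x (convAdjoint a w) i ^ r * correlate x (convAdjoint a v) i

lemma inner_gradient_phi (q v : EuclideanSpace ℝ (Fin k)) :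
    inner ℝ (gradient (phi a) q) v = -∑ j, zeta a q j ^ 3 * zeta a v j := by
  have h := inner_gradient_norm4 (Matrix.toLin' (precond a).transpose ∘ₗ
    (WithLp.linearEquiv 2 ℝ (Fin k → ℝ)).toLinearMap) (-(1 / 4)) (f := phi a) (fun q => rfl) q v
  rw [h]
  simp only [LinearMap.comp_apply, zeta, Matrix.toLin'_apply]
  change -(1 / 4) * (4 * ∑ j, (precond a).transpose.mulVec q.ofLp j ^ 3
    * (precond a).transpose.mulVec v.ofLp j) = _
  ring

lemma inner_gradient_psi [NeZero m] (x : ZMod m → ℝ) (q v : EuclideanSpace ℝ (Fin k)) :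
    inner ℝ (gradient (psi a x) q) v
      = -(1 / m) * ∑ i, correlate x (convAdjoint a (sampleWhitening a x q)) i ^ 3
          * correlate x (convAdjoint a (sampleWhitening a x v)) i := by
  have h := inner_gradient_norm4 (Matrix.toLin' ((windows a x).transpose *
      invSqrt (windows a x * (windows a x).transpose)) ∘ₗ
    (WithLp.linearEquiv 2 ℝ (Fin k → ℝ)).toLinearMap) (-(1 / (4 * m))) (f := psi a x)
    (fun q => rfl) q v
  rw [h, ← sum_windows_transpose]
  simp only [LinearMap.comp_apply, Matrix.toLin'_apply, sampleWhitening, Matrix.toLpLin_apply,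
    Matrix.mulVec_mulVec]
  change -(1 / (4 * (m : ℝ))) * (4 * ∑ j, ((windows a x).transpose *
      invSqrt (windows a x * (windows a x).transpose)).mulVec q.ofLp j ^ 3
    * ((windows a x).transpose *
      invSqrt (windows a x * (windows a x).transpose)).mulVec v.ofLp j) = _
  have : (m : ℝ) ≠ 0 := Nat.cast_ne_zero.2 (NeZero.ne m)
  field_simp

/-- The rows of the preconditioned matrix `A` are orthonormal, so `Aᵀ` is an isometry. -/
lemma norm_convAdjoint_kernelWhitening (ha : ‖a‖ = 1) (q : EuclideanSpace ℝ (Fin k)) :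
    ‖convAdjoint a (kernelWhitening a q)‖ = ‖q‖ := by
  have ha0 : a ≠ 0 := fun h => by rw [h, norm_zero] at ha; norm_num at ha
  obtain ⟨S, -, -, -, hSI, hSS⟩ := exists_sqrt_mul_transpose (B := convMatrix a)
    fun w => transpose_convMatrix_mulVec_injective a ha0
  have h := hSS (kernelWhitening a q) (kernelWhitening a q)
  have h2 : ‖convAdjoint a (kernelWhitening a q)‖ ^ 2 = ‖q‖ ^ 2 := by
    rw [kernelWhitening, hSI, real_inner_self_eq_norm_sq] at h
    rw [h, EuclideanSpace.real_norm_sq_eq]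
    exact Finset.sum_congr rfl fun j _ => sq _
  exact (sq_eq_sq₀ (norm_nonneg _) (norm_nonneg _)).1 h2

/-- Stability of the preconditioned coefficients: if the empirical covariance is close to its mean,
the empirical whitening is close to the population one. -/
lemma norm_convAdjoint_sampleWhitening_sub_le [NeZero m] (ha : ‖a‖ = 1) {θ η : ℝ} (hθ : 0 < θ)
    (hη0 : 0 ≤ η) (hη : η ≤ 1 / 4) {x : ZMod m → ℝ}
    (h : WindowMomentControl (2 * k - 1) θ (η * (m * θ)) x) :
    (∀ q, ‖convAdjoint a (√(m * θ) • sampleWhitening a x q)‖ ≤ 2 * ‖q‖ ∧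
      ‖convAdjoint a (√(m * θ) • sampleWhitening a x q) - convAdjoint a (kernelWhitening a q)‖
        ≤ 2 * (η * kappa a) * ‖q‖) ∧
    ∀ q v, ∑ i, correlate x (convAdjoint a (√(m * θ) • sampleWhitening a x q)) i
      * correlate x (convAdjoint a (√(m * θ) • sampleWhitening a x v)) i = m * θ * inner ℝ q v := by
  have ha0 : a ≠ 0 := fun h => by rw [h, norm_zero] at ha; norm_num at ha
  obtain ⟨hσ, hσle⟩ := sigmaMin_pos_and_le_norm_convAdjoint ha
  have hσmax : 0 < sigmaMax a := hσ.trans_le sigmaMin_le_sigmaMax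
  have hm : (0 : ℝ) < m := Nat.cast_pos.2 (NeZero.pos m)
  set t := √((m : ℝ) * θ) with ht
  have ht0 : 0 < t := by positivity
  have ht2 : t ^ 2 = m * θ := Real.sq_sqrt (by positivity)
  obtain ⟨S, hSsymm, hSpos, hSinj, hSI, hSS⟩ := exists_sqrt_mul_transpose (B := convMatrix a)
    fun w => transpose_convMatrix_mulVec_injective a ha0
  have hSn : ∀ w, ‖S w‖ = ‖convAdjoint a w‖ := fun w => by
    have h2 : ‖S w‖ ^ 2 = ‖convAdjoint a w‖ ^ 2 := by
      rw [← real_inner_self_eq_norm_sq, hSS, EuclideanSpace.real_norm_sq_eq]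
      exact Finset.sum_congr rfl fun j _ => (sq _).symm
    exact (sq_eq_sq₀ (norm_nonneg _) (norm_nonneg _)).1 h2
  have hcov : ∀ w, |∑ i, (windows a x).transpose.mulVec w.ofLp i
      * (windows a x).transpose.mulVec w.ofLp i - m * θ * ‖S w‖ ^ 2| ≤ η * (m * θ) * ‖S w‖ ^ 2 := by
    intro w
    have h1 := (h.correlate (convAdjoint a w)).1
    have h2 := sum_windows_transpose (a := a) x w w 1
    simp only [pow_one] at h2
    rw [h2, hSn]
    simp only [← sq]
    rwa [← mul_assoc] at h1
  -- Relative closeness with `η < 1` forces `Y Yᵀ` to be invertible, so its inverse square root is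
  -- genuine.
  have hY : ∀ w, (windows a x).transpose.mulVec w = 0 → w = 0 := by
    intro w hw
    have h1 := hcov (WithLp.toLp 2 w)
    simp only [hw, Pi.zero_apply, mul_zero, Finset.sum_const_zero, zero_sub, abs_neg] at h1
    rw [abs_of_nonneg (by positivity)] at h1
    have h2 : ‖S (WithLp.toLp 2 w)‖ ^ 2 = 0 := by
      have : 0 < m * θ := by positivity
      nlinarith [sq_nonneg ‖S (WithLp.toLp 2 w)‖, mul_nonneg this.le (sq_nonneg ‖S (WithLp.toLp 2 w)‖)]
    have h3 : WithLp.toLp 2 w = 0 := hSinj (by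
      rw [map_zero]; exact norm_eq_zero.1 (pow_eq_zero_iff two_ne_zero |>.1 h2))
    exact congrArg WithLp.ofLp h3
  obtain ⟨R, hRsymm, hRpos, hRinj, hRI, hRR⟩ := exists_sqrt_mul_transpose hY
  have hclose : ∀ w, |‖(t⁻¹ • R) w‖ ^ 2 - ‖S w‖ ^ 2| ≤ η * ‖S w‖ ^ 2 := by
    intro w
    have h1 := hcov w
    rw [← hRR, real_inner_self_eq_norm_sq] at h1
    have e : ‖(t⁻¹ • R) w‖ ^ 2 - ‖S w‖ ^ 2 = (‖R w‖ ^ 2 - m * θ * ‖S w‖ ^ 2) / (m * θ) := by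
      rw [LinearMap.smul_apply, norm_smul, norm_inv, Real.norm_of_nonneg ht0.le, mul_pow, inv_pow, ht2]
      field_simp
    rw [e, abs_div, abs_of_pos (by positivity : 0 < m * θ), div_le_iff₀ (by positivity)]
    linarith
  have hdiff := norm_sub_apply_le (R := t⁻¹ • R) (hRsymm.smul (by simp)) hSsymm
    (fun w => by
      rw [LinearMap.smul_apply, inner_smul_right]
      exact mul_nonneg (by positivity) (hRpos w))
    hSpos hSinj hη0 hσmax (fun w => by rw [hSn]; exact norm_convAdjoint_le w) hclose
  have hRu : ∀ q, (t⁻¹ • R) (t • sampleWhitening a x q) = q := fun q => by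
    rw [LinearMap.smul_apply, map_smul, smul_smul, inv_mul_cancel₀ ht0.ne', one_smul,
      sampleWhitening, hRI]
  -- Since `(1 - η)‖A₀ᵀ u‖² ≤ ‖q‖²` and `η ≤ 1/4`, the factor `2` is ample.
  have hnorm : ∀ q, ‖convAdjoint a (t • sampleWhitening a x q)‖ ≤ 2 * ‖q‖ := by
    intro q
    have h1 := hclose (t • sampleWhitening a x q)
    rw [hRu, hSn] at h1
    have h2 := (abs_le.1 h1).1
    refine le_of_sq_le_sq ?_ (by positivity)
    nlinarith [sq_nonneg ‖convAdjoint a (t • sampleWhitening a x q)‖, sq_nonneg ‖q‖]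
  refine ⟨fun q => ⟨hnorm q, ?_⟩, fun q v => ?_⟩
  · have h1 := hdiff (t • sampleWhitening a x q)
    rw [hRu] at h1
    -- Passing from `A₀ᵀ u` to `u` divides by the smallest singular value, while the perturbation
    -- bound multiplies by the largest; together they give `κ`.
    have h2 : ‖t • sampleWhitening a x q‖ ≤ 2 * ‖q‖ / sigmaMin a := by
      rw [le_div_iff₀ hσ, mul_comm]
      exact (hσle _).trans (hnorm q)
    rw [← map_sub, ← hSn, map_sub]
    have h3 : S (kernelWhitening a q) = q := hSI q
    rw [h3, norm_sub_rev]
    calc _ ≤ η * sigmaMax a * ‖t • sampleWhitening a x q‖ := h1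
      _ ≤ η * sigmaMax a * (2 * ‖q‖ / sigmaMin a) := by gcongr
      _ = 2 * (η * kappa a) * ‖q‖ := by rw [kappa]; ring
  · have h1 := hRR (t • sampleWhitening a x q) (t • sampleWhitening a x v)
    have h2 := sum_windows_transpose (a := a) x (t • sampleWhitening a x q)
      (t • sampleWhitening a x v) 1
    simp only [pow_one] at h2
    rw [← h2, ← h1, map_smul, map_smul, inner_smul_left, inner_smul_right, ← ht2]
    simp only [sampleWhitening, hRI, conj_trivial]
    ring

end Deterministic

/-! ### Comparison of the Riemannian gradients on the good event. -/

section GradientComparison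

variable {k m : ℕ} [NeZero m] {a : EuclideanSpace ℝ (Fin k)}

lemma norm4_zeta_le_one (ha : ‖a‖ = 1) {q : EuclideanSpace ℝ (Fin k)} (hq : ‖q‖ = 1) :
    norm4 (zeta a q) ≤ 1 := by
  have h1 : ∑ j, zeta a q j ^ 2 = 1 := by
    rw [zeta_eq, ← EuclideanSpace.real_norm_sq_eq, norm_convAdjoint_kernelWhitening ha, hq, one_pow]
  have h2 : norm4 (zeta a q) ^ 4 ≤ 1 := by
    rw [norm4_pow_four, ← h1]
    refine Finset.sum_le_sum fun j _ => ?_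
    have h3 : zeta a q j ^ 2 ≤ 1 :=
      h1 ▸ Finset.single_le_sum (f := fun j => zeta a q j ^ 2) (fun _ _ => sq_nonneg _)
        (Finset.mem_univ j)
    nlinarith [sq_nonneg (zeta a q j)]
  exact (pow_le_one_iff_of_nonneg (norm4_nonneg _) (by norm_num)).1 h2

/-- Along a tangential `v` the difference of derivatives is a cubic form minus its population value.
The error has three sources: the empirical cubic form, the change of whitened coefficients, and the
`ℓ²` part of the fourth moment. In units of `mθηκ` they contribute at most `76 + 90 + 48 = 214`. -/
theorem norm_riemGrad_psi_sub_le (ha : ‖a‖ = 1) {θ η ε : ℝ} (hθ : 0 < θ) (hθ1 : θ < 1)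
    (hη0 : 0 ≤ η) (hε : ε ≤ 1 / 4) {x : ZMod m → ℝ}
    (h : WindowMomentControl (2 * k - 1) θ (η * (m * θ)) x) {q : EuclideanSpace ℝ (Fin k)}
    (hq : ‖q‖ = 1)
    (hη : η * kappa a ≤ ε * ((1 - θ) * (norm4 (zeta a q) ^ 6 / kappa a ^ 2))) :
    ‖riemGrad (psi a x) q - (3 * (1 - θ) / (θ * (m : ℝ) ^ 2)) • riemGrad (phi a) q‖
      ≤ 214 * ε * ((1 - θ) / (θ * (m : ℝ) ^ 2)) * (norm4 (zeta a q) ^ 6 / kappa a ^ 2) := by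
  have hκ := one_le_kappa ha
  have hm : (0 : ℝ) < m := Nat.cast_pos.2 (NeZero.pos m)
  have hn0 := norm4_nonneg (zeta a q)
  set Δ := norm4 (zeta a q) ^ 6 / kappa a ^ 2 with hΔ
  have hΔ0 : 0 ≤ Δ := by positivity
  have hΔ1 : Δ ≤ 1 := div_le_one_of_le₀
    ((pow_le_one₀ hn0 (norm4_zeta_le_one ha hq)).trans (one_le_pow₀ hκ)) (by positivity)
  have hθ' : 0 < 1 - θ := by linarith
  have hηκ : η ≤ η * kappa a := le_mul_of_one_le_right hη0 hκ
  have hε0 : 0 ≤ ε * ((1 - θ) * Δ) := (mul_nonneg hη0 (by linarith)).trans hη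
  have hηε : η * kappa a ≤ 1 / 4 := by
    refine hη.trans ?_
    have : (1 - θ) * Δ ≤ 1 := mul_le_one₀ (by linarith) hΔ0 hΔ1
    nlinarith [mul_nonneg hθ'.le hΔ0]
  obtain ⟨hT, hXX⟩ := norm_convAdjoint_sampleWhitening_sub_le ha hθ hη0 (hηκ.trans hηε) h
  have hB : 0 ≤ η * (m * θ) := by positivity
  refine norm_riemGrad_sub_smul_le hq ?_ fun v hv hqv => ?_
  · have : 214 * ε * ((1 - θ) / (θ * (m : ℝ) ^ 2)) * Δ
        = 214 / (θ * (m : ℝ) ^ 2) * (ε * ((1 - θ) * Δ)) := by ring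
    rw [this]; positivity
  set t := √((m : ℝ) * θ) with ht
  have ht2 : t ^ 2 = m * θ := Real.sq_sqrt (by positivity)
  set c := convAdjoint a (kernelWhitening a q) with hc
  set d := convAdjoint a (kernelWhitening a v) with hd
  set c' := convAdjoint a (t • sampleWhitening a x q) with hc'
  set d' := convAdjoint a (t • sampleWhitening a x v) with hd'
  have nc : ‖c‖ = 1 := (norm_convAdjoint_kernelWhitening ha q).trans hq
  have nc' : ‖c'‖ ≤ 2 := by have := (hT q).1; rwa [hq, mul_one] at this
  have nd' : ‖d'‖ ≤ 2 := by have := (hT v).1; rwa [hv, mul_one] at this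
  have ncc : ‖c' - c‖ ≤ 2 * (η * kappa a) := by have := (hT q).2; rwa [hq, mul_one] at this
  have ndd : ‖d' - d‖ ≤ 2 * (η * kappa a) := by have := (hT v).2; rwa [hv, mul_one] at this
  have b1 := h.abs_sum_cube_mul_sub_le hB nc' nd'
  have b2 := abs_sum_cube_mul_sub_le nc.le nc' nd' ncc ndd
  -- Whitening makes the empirical correlations of orthogonal `q` and `v` exactly orthogonal. So
  -- `⟨c', d'⟩` is only of order `η`, which disposes of the `ℓ²` part.
  have b3 := h.abs_sum_mul_sub_le hB nc' nd'
  rw [hXX, hqv, mul_zero, zero_sub, abs_neg, ← mul_assoc, abs_mul,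
    abs_of_pos (by positivity : 0 < m * θ)] at b3
  have b3' : |inner ℝ c' d'| ≤ 4 * η := by
    have : m * θ * |inner ℝ c' d'| ≤ m * θ * (4 * η) := by linarith
    exact le_of_mul_le_mul_left this (by positivity)
  have b4 : |‖c'‖ ^ 2 * inner ℝ c' d'| ≤ 16 * η := by
    rw [abs_mul, abs_of_nonneg (sq_nonneg _)]
    have : ‖c'‖ ^ 2 ≤ 4 := by nlinarith [norm_nonneg c']
    calc _ ≤ 4 * (4 * η) := by gcongr
      _ = _ := by ring
  set Z := ∑ i, correlate x c' i ^ 3 * correlate x d' i with hZ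
  have hgrad : inner ℝ (gradient (psi a x) q) v
      - 3 * (1 - θ) / (θ * (m : ℝ) ^ 2) * inner ℝ (gradient (phi a) q) v
      = -(Z - m * (3 * θ * (1 - θ) * ∑ j, c j ^ 3 * d j)) / (θ ^ 2 * m ^ 3) := by
    have e1 : Z = t ^ 4 * ∑ i, correlate x (convAdjoint a (sampleWhitening a x q)) i ^ 3
          * correlate x (convAdjoint a (sampleWhitening a x v)) i := by
      rw [hZ, hc', hd', Finset.mul_sum]
      refine Finset.sum_congr rfl fun i _ => ?_
      simp only [map_smul, Pi.smul_apply, smul_eq_mul]; ring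
    have e2 : t ^ 4 = θ ^ 2 * m ^ 2 := by
      rw [show t ^ 4 = (t ^ 2) ^ 2 by ring, ht2]; ring
    rw [inner_gradient_psi, inner_gradient_phi, e1, e2, zeta_eq, zeta_eq, ← hc, ← hd]
    field_simp
    ring
  rw [hgrad, abs_div, abs_neg, abs_of_pos (by positivity : 0 < θ ^ 2 * (m : ℝ) ^ 3),
    div_le_iff₀ (by positivity)]
  have hsplit : Z - m * (3 * θ * (1 - θ) * ∑ j, c j ^ 3 * d j)
      = (Z - m * (3 * θ * (1 - θ) * (∑ j, c' j ^ 3 * d' j) + 3 * θ ^ 2 * (‖c'‖ ^ 2 * inner ℝ c' d')))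
        + (3 * m * θ * (1 - θ) * (∑ j, c' j ^ 3 * d' j - ∑ j, c j ^ 3 * d j)
          + 3 * m * θ ^ 2 * (‖c'‖ ^ 2 * inner ℝ c' d')) := by ring
  rw [hsplit]
  refine (abs_add_le _ _).trans ((add_le_add b1 (abs_add_le _ _)).trans ?_)
  rw [abs_mul (3 * m * θ * (1 - θ)), abs_of_pos (by positivity : 0 < 3 * m * θ * (1 - θ)),
    abs_mul (3 * m * θ ^ 2), abs_of_pos (by positivity : 0 < 3 * m * θ ^ 2)]
  have r1 : 3 * m * θ * (1 - θ) * |∑ j, c' j ^ 3 * d' j - ∑ j, c j ^ 3 * d j|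
      ≤ 3 * m * θ * 1 * (15 * (2 * (η * kappa a))) := by
    gcongr
    linarith
  have r2 : 3 * m * θ ^ 2 * |‖c'‖ ^ 2 * inner ℝ c' d'| ≤ 3 * m * (θ * 1) * (16 * η) := by
    rw [sq]; gcongr
  have r3 : 214 * ε * ((1 - θ) / (θ * (m : ℝ) ^ 2)) * Δ * (θ ^ 2 * m ^ 3)
      = 214 * (m * θ) * (ε * ((1 - θ) * Δ)) := by field_simp
  rw [r3]
  have hmθ : 0 < m * θ := by positivity
  have r4 : (m * θ) * (η * kappa a) ≤ (m * θ) * (ε * ((1 - θ) * Δ)) := by gcongr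
  have r5 : (m * θ) * η ≤ (m * θ) * (ε * ((1 - θ) * Δ)) := by gcongr; linarith
  linarith

end GradientComparison

/-! ### The sample size condition against the deviation of the moments. -/

section SampleSize

/-- Cauchy-Schwarz on at most `2k` coordinates gives `‖ζ‖₄⁴ ≥ 1 / (2k)`. Raised to the power `3/2`
this uses `slack k ^ 24 = k^(3/2)` and `√8 ≤ 3`. -/
lemma one_le_mul_norm4_zeta {k : ℕ} {a : EuclideanSpace ℝ (Fin k)} (ha : ‖a‖ = 1)
    {q : EuclideanSpace ℝ (Fin k)} (hq : ‖q‖ = 1) :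
    1 ≤ 3 * slack k ^ 24 * norm4 (zeta a q) ^ 6 := by
  have hk := one_le_of_norm_eq_one ha
  have ht := one_le_slack hk
  have h1 : ∑ j, zeta a q j ^ 2 = 1 := by
    rw [zeta_eq, ← EuclideanSpace.real_norm_sq_eq, norm_convAdjoint_kernelWhitening ha, hq, one_pow]
  have h2 : 1 ≤ 2 * slack k ^ 16 * norm4 (zeta a q) ^ 4 := by
    have h := sq_sum_le_card_mul_sum_sq (s := Finset.univ) (f := fun j => zeta a q j ^ 2)
    rw [h1, one_pow, Finset.card_univ, Fintype.card_fin] at h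
    have e : ∑ j, (zeta a q j ^ 2) ^ 2 = norm4 (zeta a q) ^ 4 := by
      rw [norm4_pow_four]
      exact Finset.sum_congr rfl fun j _ => by ring
    rw [e] at h
    refine h.trans ?_
    rw [slack_pow]
    have : ((2 * k - 1 : ℕ) : ℝ) ≤ 2 * k := by exact_mod_cast Nat.sub_le _ _
    exact mul_le_mul_of_nonneg_right this (by positivity)
  have hn := norm4_nonneg (zeta a q)
  set n := norm4 (zeta a q)
  set t := slack k
  refine le_of_sq_le_sq ?_ (by positivity)
  calc (1 : ℝ) ^ 2 = 1 ^ 3 := by norm_num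
    _ ≤ (2 * t ^ 16 * n ^ 4) ^ 3 := by gcongr
    _ = 8 * (t ^ 24 * n ^ 6) ^ 2 := by ring
    _ ≤ 9 * (t ^ 24 * n ^ 6) ^ 2 := by gcongr; norm_num
    _ = _ := by ring

/-- The branch `(Dμ)⁻¹` is the definition of the region. For the branch `κ²k²` the general bound
`‖ζ‖₄⁶ ≥ k^(-3/2) / 3` suffices, since `√k ≥ 3` when `k ≥ 9`. -/
lemma one_le_minFactor_mul {k : ℕ} (hk : 9 ≤ k) {a : EuclideanSpace ℝ (Fin k)} (ha : ‖a‖ = 1)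
    {D : ℝ} (hD : 0 < D) {q : EuclideanSpace ℝ (Fin k)} (hq : q ∈ regionHat a D) :
    1 ≤ minFactor a D * (norm4 (zeta a q) ^ 6 / kappa a ^ 2) := by
  obtain ⟨hq1, hq2⟩ := hq
  have hκ := one_le_kappa ha
  have hn := norm4_nonneg (zeta a q)
  have hΔ : 0 ≤ norm4 (zeta a q) ^ 6 / kappa a ^ 2 := by positivity
  have h1 : 1 ≤ kappa a ^ 2 * (k : ℝ) ^ 2 * (norm4 (zeta a q) ^ 6 / kappa a ^ 2) := by
    have h := one_le_mul_norm4_zeta ha hq1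
    have e : kappa a ^ 2 * (k : ℝ) ^ 2 * (norm4 (zeta a q) ^ 6 / kappa a ^ 2)
        = slack k ^ 8 * (slack k ^ 24 * norm4 (zeta a q) ^ 6) := by
      rw [← slack_pow k]; field_simp
    have ht := one_le_slack (show 1 ≤ k by omega)
    have h3 : 3 ≤ slack k ^ 8 := by
      refine le_of_sq_le_sq ?_ (by positivity)
      rw [← pow_mul, slack_pow]
      have : (9 : ℝ) ≤ k := by exact_mod_cast hk
      linarith
    rw [e]
    refine h.trans ?_
    rw [mul_assoc]
    gcongr
  unfold minFactor
  split_ifs with h0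
  · exact h1
  · have hμ : 0 < coherence a :=
      lt_of_le_of_ne (Real.iSup_nonneg fun _ => abs_nonneg _) (Ne.symm h0)
    have h2 : 1 ≤ (D * coherence a)⁻¹ * (norm4 (zeta a q) ^ 6 / kappa a ^ 2) := by
      rw [← div_eq_inv_mul, one_le_div (by positivity), le_div_iff₀ (by positivity)]
      exact hq2
    rcases min_choice (D * coherence a)⁻¹ (kappa a ^ 2 * (k : ℝ) ^ 2) with h | h <;> rw [h]
    · exact h2
    · exact h1

/-- Here `t = k^(1/16)`, `r = m^(1/4)`, `s = 1 - θ` and `Δ = ‖ζ‖₄⁶ / κ²`, so that all exponents are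
integers. The first deviation term is squared and compared with `hmain`; the second is raised to the
fourth power and compared with its cube. Each uses `hlow` once to make up for a missing power of
`Δ`. -/
lemma add_div_le_of_budget {C C₁ ε κ t r Δ s : ℝ} (hC₁ : 0 < C₁) (hε : 0 < ε) (hκ : 1 ≤ κ)
    (ht : 1 ≤ t) (hr : 0 < r) (hΔ : 0 < Δ) (hs0 : 0 < s) (hs1 : s ≤ 1) (hC : 0 ≤ C)
    (hC2 : 12 * (C₁ / ε) ^ 2 ≤ C) (hC3 : 48 * (C₁ / ε) ^ 4 ≤ C ^ 3)
    (hlow : 1 ≤ 3 * t ^ 24 * (κ ^ 2 * Δ)) (hmain : C * κ ^ 8 * (t ^ 16) ^ 4 ≤ s ^ 2 * Δ * r ^ 4) :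
    C₁ * (t ^ 16 * t ^ 2 + (t ^ 16) ^ 2 * t ^ 8 * t / r) / r ^ 2 * κ ≤ ε * (s * Δ) := by
  have g1 : C₁ * κ * t ^ 18 ≤ ε / 2 * (s * Δ * r ^ 2) := by
    refine le_of_sq_le_sq ?_ (by positivity)
    calc (C₁ * κ * t ^ 18) ^ 2 = ε ^ 2 * ((C₁ / ε) ^ 2 * κ ^ 2 * t ^ 36) := by field_simp
      _ ≤ ε ^ 2 * ((C₁ / ε) ^ 2 * κ ^ 6 * t ^ 40) := by
        have h1 : κ ^ 2 ≤ κ ^ 6 := pow_le_pow_right₀ hκ (by norm_num)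
        have h2 : t ^ 36 ≤ t ^ 40 := pow_le_pow_right₀ ht (by norm_num)
        gcongr
      _ ≤ ε ^ 2 * ((C₁ / ε) ^ 2 * κ ^ 6 * t ^ 40) * (3 * t ^ 24 * (κ ^ 2 * Δ)) :=
        le_mul_of_one_le_right (by positivity) hlow
      _ = ε ^ 2 / 4 * Δ * (12 * (C₁ / ε) ^ 2 * κ ^ 8 * (t ^ 16) ^ 4) := by ring
      _ ≤ ε ^ 2 / 4 * Δ * (C * κ ^ 8 * (t ^ 16) ^ 4) := by gcongr
      _ ≤ ε ^ 2 / 4 * Δ * (s ^ 2 * Δ * r ^ 4) := by gcongr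
      _ = _ := by ring
  have g2 : C₁ * κ * t ^ 41 ≤ ε / 2 * (s * Δ * r ^ 3) := by
    refine le_of_pow_le_pow_left₀ (n := 4) (by norm_num) (by positivity) ?_
    calc (C₁ * κ * t ^ 41) ^ 4 = ε ^ 4 * ((C₁ / ε) ^ 4 * κ ^ 4 * t ^ 164) := by field_simp
      _ ≤ ε ^ 4 * ((C₁ / ε) ^ 4 * κ ^ 22 * t ^ 168) := by
        have h1 : κ ^ 4 ≤ κ ^ 22 := pow_le_pow_right₀ hκ (by norm_num)
        have h2 : t ^ 164 ≤ t ^ 168 := pow_le_pow_right₀ ht (by norm_num)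
        gcongr
      _ ≤ ε ^ 4 * ((C₁ / ε) ^ 4 * κ ^ 22 * t ^ 168) * (3 * t ^ 24 * (κ ^ 2 * Δ)) :=
        le_mul_of_one_le_right (by positivity) hlow
      _ = ε ^ 4 / 16 * Δ * (48 * (C₁ / ε) ^ 4 * (κ ^ 8 * (t ^ 16) ^ 4) ^ 3) := by ring
      _ ≤ ε ^ 4 / 16 * Δ * (C ^ 3 * (κ ^ 8 * (t ^ 16) ^ 4) ^ 3) := by gcongr
      _ = ε ^ 4 / 16 * Δ * (C * κ ^ 8 * (t ^ 16) ^ 4) ^ 3 := by ring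
      _ ≤ ε ^ 4 / 16 * Δ * (s ^ 2 * Δ * r ^ 4) ^ 3 := by gcongr
      _ = ε ^ 4 / 16 * Δ ^ 4 * r ^ 12 * s ^ 6 := by ring
      _ ≤ ε ^ 4 / 16 * Δ ^ 4 * r ^ 12 * s ^ 4 :=
        mul_le_mul_of_nonneg_left (pow_le_pow_of_le_one hs0.le hs1 (by norm_num)) (by positivity)
      _ = _ := by ring
  have e : C₁ * (t ^ 16 * t ^ 2 + (t ^ 16) ^ 2 * t ^ 8 * t / r) / r ^ 2 * κ
      = C₁ * κ * t ^ 18 / r ^ 2 + C₁ * κ * t ^ 41 / r ^ 3 := by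
    field_simp
  rw [e]
  have f1 : C₁ * κ * t ^ 18 / r ^ 2 ≤ ε / 2 * (s * Δ) := by
    rw [div_le_iff₀ (by positivity)]; linarith
  have f2 : C₁ * κ * t ^ 41 / r ^ 3 ≤ ε / 2 * (s * Δ) := by
    rw [div_le_iff₀ (by positivity)]; linarith
  linarith

/-- The sample size condition makes the deviations of the moments small compared with the
gradient of the population objective. -/
lemma exists_deviationScale_le {C₁ ε : ℝ} (hC₁ : 0 < C₁) (hε : 0 < ε) : ∃ C : ℝ, 0 < C ∧
    ∀ (k m : ℕ) [NeZero m] (a : EuclideanSpace ℝ (Fin k)) (θ D : ℝ), 9 ≤ k → ‖a‖ = 1 →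
      0 < θ → θ < 1 → 0 < D →
      C * (minFactor a D / ((1 - θ) ^ 2 * sigmaMin a ^ 2)) *
            kappa a ^ 8 * (k : ℝ) ^ 4 * Real.log (kappa a * k) ^ 3 ≤ m →
      ∀ q ∈ regionHat a D, k ^ 4 ≤ m ∧
        C₁ * deviationScale m k / √m * kappa a
          ≤ ε * ((1 - θ) * (norm4 (zeta a q) ^ 6 / kappa a ^ 2)) := by
  set C := 1 + 12 * (C₁ / ε) ^ 2 + 48 * (C₁ / ε) ^ 4 with hC
  refine ⟨C, by positivity, ?_⟩
  intro k m _ a θ D hk ha hθ hθ1 hD hm q hq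
  have hκ := one_le_kappa ha
  have hn := norm4_nonneg (zeta a q)
  have hk9 : (9 : ℝ) ≤ k := by exact_mod_cast hk
  have ht := one_le_slack (show 1 ≤ k by omega)
  have hm0 : (0 : ℝ) < m := Nat.cast_pos.2 (NeZero.pos m)
  have hσ := (sigmaMin_pos_and_le_norm_convAdjoint ha).1
  have hσ1 := sigmaMin_le_one ha
  have hMΔ := one_le_minFactor_mul hk ha hD hq
  have hlow := one_le_mul_norm4_zeta ha hq.1
  have hΔ1 : norm4 (zeta a q) ^ 6 / kappa a ^ 2 ≤ 1 := div_le_one_of_le₀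
    ((pow_le_one₀ hn (norm4_zeta_le_one ha hq.1)).trans (one_le_pow₀ hκ)) (by positivity)
  set Δ := norm4 (zeta a q) ^ 6 / kappa a ^ 2 with hΔ
  have hΔn : norm4 (zeta a q) ^ 6 = kappa a ^ 2 * Δ := by rw [hΔ]; field_simp
  have hΔ0 : 0 < Δ := by
    rcases (show 0 ≤ Δ by positivity).eq_or_lt with h | h
    · rw [← h, mul_zero] at hMΔ; norm_num at hMΔ
    · exact h
  rw [hΔn] at hlow
  have hs0 : 0 < 1 - θ := by linarith
  have hs1 : 1 - θ ≤ 1 := by linarith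
  set κ := kappa a
  set M := minFactor a D
  have hM0 : 0 < M := by
    by_contra hcon
    push Not at hcon
    nlinarith
  have hlog : 1 ≤ Real.log (κ * k) := by
    rw [Real.le_log_iff_exp_le (by positivity)]
    have := Real.exp_one_lt_d9
    nlinarith
  -- The factors `sigmaMin⁻²` and `log³` of the sample size are at least `1` and are simply
  -- discarded.
  have hmain : C * κ ^ 8 * k ^ 4 ≤ (1 - θ) ^ 2 * Δ * m := by
    have h1 : C * (M / (1 - θ) ^ 2) * κ ^ 8 * k ^ 4 ≤ m := by
      refine le_trans ?_ hm
      have e : M / (1 - θ) ^ 2 ≤ M / ((1 - θ) ^ 2 * sigmaMin a ^ 2) := by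
        gcongr
        exact mul_le_of_le_one_right (by positivity) (pow_le_one₀ hσ.le hσ1)
      calc C * (M / (1 - θ) ^ 2) * κ ^ 8 * k ^ 4
          ≤ C * (M / ((1 - θ) ^ 2 * sigmaMin a ^ 2)) * κ ^ 8 * k ^ 4 := by gcongr
        _ ≤ _ := le_mul_of_one_le_right (by positivity) (one_le_pow₀ hlog)
    calc C * κ ^ 8 * k ^ 4 ≤ (C * κ ^ 8 * k ^ 4) * (M * Δ) := le_mul_of_one_le_right (by positivity) hMΔ
      _ = (1 - θ) ^ 2 * Δ * (C * (M / (1 - θ) ^ 2) * κ ^ 8 * k ^ 4) := by field_simp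
      _ ≤ _ := by gcongr
  have hC1 : 1 ≤ C := by rw [hC]; nlinarith [sq_nonneg (C₁ / ε), sq_nonneg ((C₁ / ε) ^ 2)]
  have hC2 : 12 * (C₁ / ε) ^ 2 ≤ C := by rw [hC]; nlinarith [sq_nonneg ((C₁ / ε) ^ 2)]
  have hC3 : 48 * (C₁ / ε) ^ 4 ≤ C ^ 3 := by
    have : C ≤ C ^ 3 := le_self_pow₀ hC1 (by norm_num)
    rw [hC] at this ⊢; nlinarith [sq_nonneg (C₁ / ε)]
  clear_value C
  constructor
  · have h1 : (k : ℝ) ^ 4 ≤ m := by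
      calc (k : ℝ) ^ 4 ≤ (C * κ ^ 8) * k ^ 4 :=
            le_mul_of_one_le_left (by positivity) (one_le_mul_of_one_le_of_one_le hC1 (one_le_pow₀ hκ))
        _ ≤ (1 - θ) ^ 2 * Δ * m := hmain
        _ ≤ m := mul_le_of_le_one_left hm0.le
            (mul_le_one₀ (pow_le_one₀ hs0.le hs1) hΔ0.le hΔ1)
    exact_mod_cast h1
  · set r := √(√(m : ℝ)) with hr
    have hr0 : 0 < r := by positivity
    have hr2 : √(m : ℝ) = r ^ 2 := (Real.sq_sqrt (by positivity)).symm
    have hm4 : (m : ℝ) = r ^ 4 := by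
      rw [show r ^ 4 = (r ^ 2) ^ 2 by ring, ← hr2, Real.sq_sqrt hm0.le]
    have hsqrtk : √(k : ℝ) = slack k ^ 8 := by
      rw [Real.sqrt_eq_iff_mul_self_eq (by positivity) (by positivity), ← pow_add, slack_pow]
    rw [deviationScale, ← hr, hr2, hsqrtk, ← slack_pow k]
    rw [hm4, ← slack_pow k] at hmain
    set t := slack k
    exact add_div_le_of_budget hC₁ hε hκ ht hr0 hΔ0 hs0 hs1 (by linarith) hC2 hC3 hlow hmain

end SampleSize

/-! ### Transfer to the given probability space and conclusion. -/

lemma one_sub_le_measureReal_of_hasLaw {Ω X : Type*} [MeasurableSpace Ω] [MeasurableSpace X]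
    {P : Measure Ω} [IsProbabilityMeasure P] {μ : Measure X} [IsProbabilityMeasure μ] {x : Ω → X}
    (hx : HasLaw x μ P) {B : Set X} {b : ℝ} (hB : μ.real B ≤ b) {S : Set Ω}
    (hS : ∀ ω, x ω ∉ B → ω ∈ S) : 1 - b ≤ P.real S := by
  -- The bad set `B` is not assumed measurable, so its measurable hull, of equal measure, is pulled
  -- back.
  have h1 : P.real (x ⁻¹' toMeasurable μ B) = μ.real B := by
    rw [← map_measureReal_apply_of_aemeasurable hx.aemeasurable (measurableSet_toMeasurable μ B),
      hx.map_eq, measureReal_def, measure_toMeasurable, measureReal_def]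
  have h2 : (Set.univ : Set Ω) ⊆ S ∪ x ⁻¹' toMeasurable μ B := fun ω _ => by
    by_cases h : x ω ∈ B
    · exact Or.inr (subset_toMeasurable μ B h)
    · exact Or.inl (hS ω h)
  have h3 := (measureReal_mono h2 (measure_ne_top P _)).trans (measureReal_union_le _ _)
  rw [probReal_univ, h1] at h3
  linarith

end SparseBlindDeconv

theorem mainTheorem4 (Cstar : ℝ) (hCstar : 10 ≤ Cstar) :
    ∃ C c : ℝ, 0 < C ∧ 0 < c ∧ c ≤ 3 / (2 * Cstar) ∧
      ∀ (k m : ℕ) [NeZero m] (a : EuclideanSpace ℝ (Fin k)) (θ : unitInterval)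
        (Ω : Type*) [MeasurableSpace Ω] (P : Measure Ω) [IsProbabilityMeasure P]
        (x : Ω → ZMod m → ℝ),
        ‖a‖ = 1 →
        1 / (k : ℝ) ≤ θ → (θ : ℝ) < 1 →
        HasLaw x (Measure.pi fun _ => bernoulliGaussian θ) P →
        C * (minFactor a (2 * Cstar) / ((1 - (θ : ℝ)) ^ 2 * sigmaMin a ^ 2)) *
            kappa a ^ 8 * (k : ℝ) ^ 4 * Real.log (kappa a * k) ^ 3 ≤ m →
        1 - Real.exp (-(k : ℝ)) - (θ : ℝ) ^ 2 * (1 - (θ : ℝ)) ^ 2 * ((k : ℝ) ^ 4)⁻¹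
            - 2 * Real.exp (-((θ : ℝ) * k)) - 48 * ((k : ℝ) ^ 7)⁻¹ - 48 * ((m : ℝ) ^ 5)⁻¹
            - 24 * k * Real.exp (-(1 / 144) * min (k : ℝ) (3 * √((θ : ℝ) * m)))
          ≤ P.real {ω | ∀ q ∈ regionHat a (2 * Cstar),
              ‖riemGrad (psi a (x ω)) q
                  - (3 * (1 - (θ : ℝ)) / (θ * (m : ℝ) ^ 2)) • riemGrad (phi a) q‖
                ≤ c * ((1 - (θ : ℝ)) / (θ * (m : ℝ) ^ 2))
                    * (norm4 (zeta a q) ^ 6 / kappa a ^ 2)} := by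
  obtain ⟨C₁, hC₁, hprob⟩ := exists_measure_not_windowMomentControl_le
  have hc : 0 < 3 / (2 * Cstar) := by positivity
  have hc4 : 3 / (2 * Cstar) ≤ 1 / 4 := by
    rw [div_le_iff₀ (by positivity)]; linarith
  -- The division by `214` cancels the constant of `norm_riemGrad_psi_sub_le`, so `c` can be the
  -- largest admissible value.
  obtain ⟨C, hC, hbudget⟩ := exists_deviationScale_le hC₁ (ε := 3 / (2 * Cstar) / 214) (by positivity)
  refine ⟨C, 3 / (2 * Cstar), hC, hc, le_rfl, ?_⟩
  intro k m _ a θ Ω _ P _ x ha hθk hθ1 hx hm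
  have hk1 := one_le_of_norm_eq_one ha
  have hk0 : (0 : ℝ) < k := Nat.cast_pos.2 hk1
  have hθ0 : (0 : ℝ) < θ := lt_of_lt_of_le (by positivity) hθk
  have p1 := Real.exp_pos (-(k : ℝ))
  have p2 : 0 ≤ (θ : ℝ) ^ 2 * (1 - (θ : ℝ)) ^ 2 * ((k : ℝ) ^ 4)⁻¹ := by positivity
  have p3 := Real.exp_pos (-((θ : ℝ) * k))
  have p4 : 0 ≤ 48 * ((k : ℝ) ^ 7)⁻¹ := by positivity
  have p5 : 0 ≤ 48 * ((m : ℝ) ^ 5)⁻¹ := by positivity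
  have p6 : 0 ≤ 24 * k * Real.exp (-(1 / 144) * min (k : ℝ) (3 * √((θ : ℝ) * m))) := by positivity
  -- For `k < 100` the last exponential term alone is at least `24 * 44 / 144 > 1`, so the claimed
  -- lower bound is negative.
  rcases lt_or_ge k 100 with hk | hk
  · have h1 : (1 : ℝ) ≤ 24 * k * Real.exp (-(1 / 144) * min (k : ℝ) (3 * √((θ : ℝ) * m))) := by
      have hk' : (k : ℝ) ≤ 100 := by exact_mod_cast hk.le
      have h2 := Real.add_one_le_exp (-(1 / 144) * min (k : ℝ) (3 * √((θ : ℝ) * m)))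
      have h3 := min_le_left (k : ℝ) (3 * √((θ : ℝ) * m))
      have h4 : (1 : ℝ) ≤ k := by exact_mod_cast hk1
      have h5 : (44 / 144 : ℝ) ≤ Real.exp (-(1 / 144) * min (k : ℝ) (3 * √((θ : ℝ) * m))) := by
        linarith
      nlinarith
    have h6 := measureReal_nonneg (μ := P) (s := {ω | ∀ q ∈ regionHat a (2 * Cstar),
              ‖riemGrad (psi a (x ω)) q
                  - (3 * (1 - (θ : ℝ)) / (θ * (m : ℝ) ^ 2)) • riemGrad (phi a) q‖
                ≤ 3 / (2 * Cstar) * ((1 - (θ : ℝ)) / (θ * (m : ℝ) ^ 2))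
                    * (norm4 (zeta a q) ^ 6 / kappa a ^ 2)})
    linarith
  -- An empty region makes the event certain. Otherwise one point of it is needed to extract `k⁴ ≤
  -- m` from the sample size.
  rcases (regionHat a (2 * Cstar)).eq_empty_or_nonempty with hempty | ⟨q₀, hq₀⟩
  · simp only [hempty, Set.mem_empty_iff_false, false_imp_iff, implies_true, Set.ofPred_true,
      probReal_univ]
    linarith
  have hb := hbudget k m a θ (2 * Cstar) (by omega) ha hθ0 hθ1 (by positivity) hm
  have hkm := (hb q₀ hq₀).1
  have hNm : 2 * k - 1 ≤ m := by
    have : 2 * k ≤ k ^ 4 := by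
      calc 2 * k ≤ k * k := Nat.mul_le_mul_right k (by omega)
        _ = k ^ 2 := (sq k).symm
        _ ≤ k ^ 4 := Nat.pow_le_pow_right hk1 (by norm_num)
    omega
  have hθk' : 1 ≤ θ * (k : ℝ) := by rwa [div_le_iff₀ hk0] at hθk
  refine le_trans (b := 1 - 48 * ((k : ℝ) ^ 7)⁻¹) (by linarith) ?_
  have hm0 : (0 : ℝ) < m := Nat.cast_pos.2 (NeZero.pos m)
  refine one_sub_le_measureReal_of_hasLaw (μ := signalLaw m θ) hx
    (hprob m θ k (2 * k - 1) (by omega) (by omega) hNm (by omega) hθk' hkm) fun ω hω q hq => ?_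
  have hcontrol : WindowMomentControl (2 * k - 1) θ
      (C₁ * deviationScale m k / √m * (m * θ)) (x ω) := by
    have e : C₁ * deviationScale m k / √m * (m * θ) = C₁ * (√m * θ) * deviationScale m k := by
      have h1 : √(m : ℝ) ≠ 0 := by positivity
      have h2 : (m : ℝ) = √m * √m := (Real.mul_self_sqrt hm0.le).symm
      rw [div_mul_eq_mul_div, div_eq_iff h1]
      linear_combination (C₁ * deviationScale m k * θ) * h2
    rw [e]
    exact not_not.1 hω
  have hD0 : 0 ≤ deviationScale m k := by
    have := one_le_slack hk1
    unfold deviationScale; positivity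
  have hfin := norm_riemGrad_psi_sub_le ha hθ0 hθ1 (by positivity) (by linarith) hcontrol hq.1
    (hb q hq).2
  refine hfin.trans (le_of_eq ?_)
  ring
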